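/- Let $n\ge 0$, $X=2\pi$, and let $A_1,A_0,B_0:\mathbb R\to\mathbb C^{n\times n}$ be $X$-periodic with entries in $L^2(0,X)$; write $\hat A_{0}=\frac1X\int_0^X A(x)\,dx$ for the mean of a matrix function $A$ (so $\hat A_{1,0}=A_{1,\mathrm{ave}}$, $\hat A_{0,0}$, $\hat B_{0,0}$ are the means of $A_1,A_0,B_0$). Consider, for $\lambda\in\mathbb C$, the periodic eigenvalue problem $$\big(\partial_x^2+\partial_xA_1+A_0-\lambda B_0\big)U=0. \qquad (*)$$ For a Hilbert–Schmidt operator $T$ on a separable Hilbert space, ${\det}_2(I-T)$ denotes the limit of $\det(I-T_J)\,e^{\operatorname{tr}T_J}$ along the Galerkin approximations $T_J=P_{H_J}T|_{H_J}$ for any increasing sequence of finite-dimensional subspaces $H_J$ with dense union. *The functions $D$, $F$, $E$.* All inverses are taken with periodic boundary conditions on $[0,X]$, in the sense of periodic distributions. - $D(\lambda)={\det}_2(I+K(\lambda))$ on $L^2([0,X];\mathbb C^n)$, where $K(\lambda)=\partial_x(\partial_x^2-1)^{-1}A_1+(\partial_x^2-1)^{-1}(A_0+1-\lambda B_0)$,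 so that $(*)$ is equivalent to $(I+K(\lambda))U=0$. - Let $\partial_xW=\mathbb A(\lambda)W$ be $(*)$ written as a first-order system, in either of the following forms: with $W=(U,\partial_xU)$, $$\mathbb A=\begin{pmatrix}0&I\\ \lambda B_0-A_0-\partial_xA_1&-A_1\end{pmatrix},$$ if the distributional derivative $\partial_xA_1$ of the periodic function $A_1$ is in $L^2(0,X)$; or, for arbitrary $A_1\in L^2$, with $W=(U,\partial_xU+A_1U)$, $$\mathbb A=\begin{pmatrix}-A_1&I\\ \lambda B_0-A_0&0\end{pmatrix}.$$ - $F(\lambda)={\det}_2(I-\mathbb K)$ on $L^2([0,X];\mathbb C^{2n})$, where $\mathbb K=(\partial_x-1)^{-1}(\mathbb A-1)$. - $E(\lambda)=\det(\Psi(X)-I)$, where $\Psi$ is the fundamental solution: $\Psi$ is absolutely continuous, $\partial_x\Psi=\mathbb A\Psi$ a.e. on $[0,X]$, $\Psi(0)=I$. *The constants.* Put $$\gamma=e^{\frac{e^X}{1-e^X}\int_0^X(\operatorname{tr}\mathbb A-2n)\,dy}=e^{\frac{e^X}{e^X-1}(\operatorname{tr}A_{1,\mathrm{ave}}+2n)X},$$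 $$\hat\delta=\operatorname{tr}(\hat A_{1,0}+2I)\Big(1+\sum_{|j|\ge1}\frac1{j^2+ij}\Big),\qquad \delta=\operatorname{tr}(\hat A_{0,0}+I-\lambda\hat B_{0,0})\sum_{j\in\mathbb Z}\frac1{j^2+1},$$ $$\epsilon=\lim_{J\to\infty}\prod_{|j|\le J}\Big(1-\frac{2}{ij+1}\Big)^{n}.$$ **Claim.** The two sums converge absolutely, the limit $\epsilon$ exists and is nonzero, the operators $K(\lambda)$ and $\mathbb K$ are well defined and Hilbert–Schmidt (so $D$ and $F$ are well defined), $\Psi$ exists, the two expressions for $\gamma$ agree, and for every $\lambda\in\mathbb C$ and either form of the system $$D(\lambda)=\frac{e^{\delta-\hat\delta}}{\epsilon}F(\lambda)=\frac{e^{\delta-\hat\delta}}{\epsilon}\,\gamma\,(e^X-1)^{-2n}E(\lambda),$$ where the factor $\frac{e^{\delta-\hat\delta}}{\epsilon}\gamma(e^X-1)^{-2n}$ is nonvanishing for all $\lambda$. -/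

import Mathlib

open MeasureTheory Filter Topology Set
open scoped Matrix ContDiff

noncomputable section

namespace HillEvans

/-! ## Function spaces, test functions, and square-integrable matrix coefficients -/

/-- The Hilbert space `L²((0,X]; ℂ^ι)` of (periodic) vector-valued functions over one period. -/
abbrev L2 (X : ℝ) (ι : Type) [Fintype ι] : Type :=
  Lp (EuclideanSpace ℂ ι) 2 (volume.restrict (Ioc 0 X))

/-- Smooth `X`-periodic scalar test functions on the line. -/
def IsPeriodicTest (X : ℝ) (φ : ℝ → ℂ) : Prop :=
  ContDiff ℝ ∞ φ ∧ Function.Periodic φ X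

/-- An `X`-periodic matrix-valued coefficient whose entries are square integrable over a period. -/
def IsL2Coeff {ι : Type} (X : ℝ) (A : ℝ → Matrix ι ι ℂ) : Prop :=
  Function.Periodic A X ∧ ∀ i j, MemLp (fun x => A x i j) 2 (volume.restrict (Ioc 0 X))

/-- `A'` is the derivative of `A` in the sense of `X`-periodic distributions. -/
def IsPeriodicWeakDeriv {ι : Type} (X : ℝ) (A A' : ℝ → Matrix ι ι ℂ) : Prop :=
  ∀ φ : ℝ → ℂ, IsPeriodicTest X φ → ∀ i j,
    ∫ x in (0)..X, φ x * A' x i j = -∫ x in (0)..X, deriv φ x * A x i j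

/-- The mean over one period, that is, the zeroth Fourier coefficient `Â₀ = A_ave`. -/
def mean {ι : Type} (X : ℝ) (A : ℝ → Matrix ι ι ℂ) : Matrix ι ι ℂ :=
  fun i j => (1 / (X : ℂ)) * ∫ x in (0)..X, A x i j

/-! ## `2`-modified Fredholm determinants of Hilbert-Schmidt perturbations of the identity -/

section Fredholm

variable {H : Type} [NormedAddCommGroup H] [InnerProductSpace ℂ H]

/-- Hilbert-Schmidt operators: `∑ ‖T e_i‖² < ∞` for every Hilbert basis `(e_i)`. -/
def IsHilbertSchmidt (T : H →L[ℂ] H) : Prop :=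
  ∀ (ι : Type) (b : HilbertBasis ι ℂ H), Summable fun i => ‖T (b i)‖ ^ 2

/-- The Galerkin approximation `P_V T|_V` of `T` on a finite-dimensional subspace `V`. -/
def galerkin (T : H →L[ℂ] H) (V : Submodule ℂ H) [FiniteDimensional ℂ V] : V →ₗ[ℂ] V :=
  (V.orthogonalProjectionOnto ∘L T ∘L V.subtypeL : V →L[ℂ] V)

/-- In finite dimension, `det₂ (I - A) = det (I - A) * exp (tr A)`. -/
def finDet2 {V : Type} [AddCommGroup V] [Module ℂ V] (A : V →ₗ[ℂ] V) : ℂ :=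
  LinearMap.det (LinearMap.id - A) * Complex.exp (LinearMap.trace ℂ V A)

/-- `T` is Hilbert-Schmidt and `det₂ (I - T) = d`: along *every* increasing sequence of
finite-dimensional subspaces filling up `H`, the determinants of the Galerkin approximations
converge to `d`. -/
def HasDet2 (T : H →L[ℂ] H) (d : ℂ) : Prop :=
  IsHilbertSchmidt T ∧
    ∀ (V : ℕ → Submodule ℂ H) [∀ J, FiniteDimensional ℂ (V J)], Monotone V →
      (⨆ J, V J).topologicalClosure = ⊤ →
      Tendsto (fun J => finDet2 (galerkin T (V J))) atTop (𝓝 d)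

open Classical in
/-- The `2`-modified Fredholm determinant `det₂ (I - T)` (with value `0` if it does not exist). -/
def det2 (T : H →L[ℂ] H) : ℂ :=
  if h : ∃ d, HasDet2 T d then h.choose else 0

end Fredholm

/-! ## The Birman-Schwinger Evans function -/

section Operators

variable {n : ℕ}

/-- `K = ∂ₓ (∂ₓ² - 1)⁻¹ A₁ + (∂ₓ² - 1)⁻¹ (A₀ + 1 - lam B₀)` on `L²` with periodic boundary
conditions: for every `U`, the function `K U` is the solution of
`(∂ₓ² - 1) (K U) = ∂ₓ (A₁ U) + (A₀ + 1 - lam B₀) U` in the sense of periodic distributions. -/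
def IsBirmanSchwingerOp (X : ℝ) (A₁ A₀ B₀ : ℝ → Matrix (Fin n) (Fin n) ℂ) (lam : ℂ)
    (K : L2 X (Fin n) →L[ℂ] L2 X (Fin n)) : Prop :=
  ∀ (U : L2 X (Fin n)) (φ : ℝ → ℂ), IsPeriodicTest X φ → ∀ i : Fin n,
    ∫ x in (0)..X, (deriv (deriv φ) x - φ x) * (K U x) i =
      ∫ x in (0)..X, (-deriv φ x * (A₁ x *ᵥ (U x).ofLp) i +
        φ x * ((A₀ x + 1 - lam • B₀ x) *ᵥ (U x).ofLp) i)

open Classical in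
/-- The operator `K(lam)`. -/
def birmanSchwingerOp (X : ℝ) (A₁ A₀ B₀ : ℝ → Matrix (Fin n) (Fin n) ℂ) (lam : ℂ) :
    L2 X (Fin n) →L[ℂ] L2 X (Fin n) :=
  if h : ∃ K, IsBirmanSchwingerOp X A₁ A₀ B₀ lam K then h.choose else 0

/-- The Birman-Schwinger Evans function `D(lam) = det₂ (I + K(lam))`; the eigenvalue equation
`(∂ₓ² + ∂ₓ A₁ + A₀ - lam B₀) U = 0` is equivalent to `(I + K(lam)) U = 0`. -/
def evansD (X : ℝ) (A₁ A₀ B₀ : ℝ → Matrix (Fin n) (Fin n) ℂ) (lam : ℂ) : ℂ :=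
  det2 (-birmanSchwingerOp X A₁ A₀ B₀ lam)

/-! ## First-order systems and the Evans functions `F` and `E` -/

/-- `𝔸` is the coefficient matrix of a first-order system `∂ₓ W = 𝔸 W` that represents
`(∂ₓ² + ∂ₓ A₁ + A₀ - lam B₀) U = 0`. -/
inductive IsFirstOrderForm (X : ℝ) (A₁ A₀ B₀ : ℝ → Matrix (Fin n) (Fin n) ℂ) (lam : ℂ) :
    (ℝ → Matrix (Fin n ⊕ Fin n) (Fin n ⊕ Fin n) ℂ) → Prop
  /-- The system for `W = (U, ∂ₓ U)`. Its matrix is square integrable exactly if the distributional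
  derivative `A₁'` of `A₁` is. -/
  | standard (A₁' : ℝ → Matrix (Fin n) (Fin n) ℂ) (hmem : IsL2Coeff X A₁')
      (hderiv : IsPeriodicWeakDeriv X A₁ A₁') :
      IsFirstOrderForm X A₁ A₀ B₀ lam
        (fun x => Matrix.fromBlocks 0 1 (lam • B₀ x - A₀ x - A₁' x) (-A₁ x))
  /-- The system for `W = (U, ∂ₓ U + A₁ U)`, which makes sense for all square-integrable
  coefficients, whether or not `∂ₓ A₁` is a function. -/
  | quasi :
      IsFirstOrderForm X A₁ A₀ B₀ lam
        (fun x => Matrix.fromBlocks (-A₁ x) 1 (lam • B₀ x - A₀ x) 0)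

variable {m : Type} [Fintype m] [DecidableEq m]

/-- `𝕂 = (∂ₓ - 1)⁻¹ (𝔸 - 1)` on `L²` with periodic boundary conditions: for every `W`,
`(∂ₓ - 1) (𝕂 W) = (𝔸 - 1) W` in the sense of periodic distributions. -/
def IsFirstOrderOp (X : ℝ) (𝔸 : ℝ → Matrix m m ℂ) (𝕂 : L2 X m →L[ℂ] L2 X m) : Prop :=
  ∀ (W : L2 X m) (φ : ℝ → ℂ), IsPeriodicTest X φ → ∀ i : m,
    ∫ x in (0)..X, (-deriv φ x - φ x) * (𝕂 W x) i =
      ∫ x in (0)..X, φ x * ((𝔸 x - 1) *ᵥ (W x).ofLp) i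

open Classical in
/-- The operator `𝕂`. -/
def firstOrderOp (X : ℝ) (𝔸 : ℝ → Matrix m m ℂ) : L2 X m →L[ℂ] L2 X m :=
  if h : ∃ 𝕂, IsFirstOrderOp X 𝔸 𝕂 then h.choose else 0

/-- The first-order Birman-Schwinger Evans function `F = det₂ (I - 𝕂)`. -/
def evansF (X : ℝ) (𝔸 : ℝ → Matrix m m ℂ) : ℂ := det2 (firstOrderOp X 𝔸)

/-- `Ψ` is the fundamental solution on `[0,X]` of `∂ₓ Ψ = 𝔸 Ψ`, `Ψ(0) = I`, in the sense of
Carathéodory (absolutely continuous, the equation holding almost everywhere). -/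
def IsFundamentalSolution (X : ℝ) (𝔸 Ψ : ℝ → Matrix m m ℂ) : Prop :=
  ContinuousOn Ψ (Icc 0 X) ∧
    ∀ x ∈ Icc 0 X, ∀ i j,
      Ψ x i j = (1 : Matrix m m ℂ) i j + ∫ y in (0)..x, (𝔸 y * Ψ y) i j

open Classical in
/-- The fundamental solution. -/
def fundamentalSolution (X : ℝ) (𝔸 : ℝ → Matrix m m ℂ) : ℝ → Matrix m m ℂ :=
  if h : ∃ Ψ, IsFundamentalSolution X 𝔸 Ψ then h.choose else 0

/-- Gardner's Jost-type Evans function `E = det (Ψ(X) - I)`. -/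
def evansE (X : ℝ) (𝔸 : ℝ → Matrix m m ℂ) : ℂ :=
  (fundamentalSolution X 𝔸 X - 1).det

/-! ## The constants -/

/-- `γ = exp ((e^X / (e^X - 1)) (tr A_{1,ave} + 2n) X)`. -/
def gamma (X : ℝ) (A₁ : ℝ → Matrix (Fin n) (Fin n) ℂ) : ℂ :=
  Complex.exp (Complex.exp X / (Complex.exp X - 1) * ((mean X A₁).trace + 2 * n) * X)

/-- `δ̂ = tr (Â_{1,0} + 2 I) (1 + ∑_{|j| ≥ 1} 1 / (j² + i j))`. -/
def deltaHat (X : ℝ) (A₁ : ℝ → Matrix (Fin n) (Fin n) ℂ) : ℂ :=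
  (mean X A₁ + (2 : ℂ) • (1 : Matrix (Fin n) (Fin n) ℂ)).trace *
    (1 + ∑' j : {j : ℤ // j ≠ 0}, 1 / ((j : ℂ) ^ 2 + Complex.I * (j : ℂ)))

/-- `δ = tr (Â_{0,0} + I - lam B̂_{0,0}) ∑_j 1 / (j² + 1)`. -/
def delta (X : ℝ) (A₀ B₀ : ℝ → Matrix (Fin n) (Fin n) ℂ) (lam : ℂ) : ℂ :=
  (mean X A₀ + 1 - lam • mean X B₀).trace * ∑' j : ℤ, 1 / ((j : ℂ) ^ 2 + 1)

/-- The partial products `∏_{|j| ≤ J} (1 - 2 / (i j + 1))^n` that define `ε`. -/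
def epsilonProd (n J : ℕ) : ℂ :=
  ∏ j ∈ Finset.Icc (-(J : ℤ)) (J : ℤ), (1 - 2 / (Complex.I * (j : ℂ) + 1)) ^ n

/-- `ε = lim_{J → ∞} ∏_{|j| ≤ J} (1 - 2 / (i j + 1))^n`. -/
def epsilon (n : ℕ) : ℂ := limUnder atTop (epsilonProd n)

end Operators

end HillEvans

end

/-! The comparison of `D` with `F` is an exact identity between Galerkin determinants on the Fourier
modes with `|j| ≤ J`, followed by `J → ∞`. Multiplying the truncation of `I + K` by the diagonal
matrix `-(j² + 1)` gives the truncation `L_J` of `∂ₓ² + ∂ₓA₁ + A₀ - λB₀`. Multiplying the truncation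
of `I - 𝕂` by `ij - 1` gives the truncation of `∂ₓ - 𝔸`. The latter is a `2 × 2` block matrix with
the block `-1` in its upper right corner, so it is a linearization with the same determinant `det
L_J` (`IsFirstOrderForm.det_truncation`). No truncation error arises: `∂ₓ` is diagonal in Fourier
modes, so truncation is compatible with products by `∂ₓ` and with the commutator that represents
`∂ₓA₁`. What remains is the ratio of the two diagonal determinants, which is the partial product of
`ε`, and the exponentials of the two traces. On a symmetric window the odd parts of these traces
cancel, and the even parts converge to `δ` and `δ̂` (`finDet2_galerkin_eq`, `evansD_eq`).

The comparison of `F` with `E` (`det2_firstOrder`) uses the Green kernel of `(∂ₓ - 1)⁻¹`, which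
splits `𝕂` into a Volterra operator `W` and a finite-rank operator `u ∘ l`. With `w = (1 - W)⁻¹ u`
one has `1 - 𝕂 = (1 - W)(1 - w ∘ l)`. Conjugation by `e^{-kx}` preserves `det₂(1 - W)` and sends the
Hilbert-Schmidt norm to zero as `k → ∞`; hence `det₂(1 - W) = 1` and `1 - W` is invertible
(`exists_volterraOp`). The second factor reduces to a matrix on `ℂ^m`: `w` produces the columns of
`Ψ`, and `1 - l ∘ w = (e^X - 1)⁻¹ (Ψ(X) - 1)`. The correction terms in the product formula for
`det₂` combine into `exp (tr (l ∘ u))`, which is `γ`.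

Both halves rest on a theory of `det₂` built from one estimate: on matrices, `det (1 - A) e^{tr A}`
is locally Lipschitz in the Frobenius norm with constants independent of the dimension
(`norm_matDet2_sub_le`). This gives convergence along every exhaustion, continuity in the
Hilbert-Schmidt norm, similarity invariance and the product formula. -/

noncomputable section

set_option linter.unusedSectionVars false

namespace HillEvans

/-! ### Dimension-free estimates for the modified determinant of a matrix. -/

section FiniteDimensional

open scoped ComplexOrder

variable {ι κ : Type*} [Fintype ι] [DecidableEq ι] [Fintype κ] [DecidableEq κ]

attribute [local instance] Matrix.frobeniusNormedAddCommGroup Matrix.frobeniusNormedSpace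

/-- The `2`-modified determinant of `1 - A` for a square matrix `A`. -/
def matDet2 (A : Matrix ι ι ℂ) : ℂ := (1 - A).det * Complex.exp A.trace

lemma frobenius_sq {ι κ : Type*} [Fintype ι] [Fintype κ] (A : Matrix ι κ ℂ) :
    ‖A‖ ^ 2 = ∑ i, ∑ j, ‖A i j‖ ^ 2 := by
  rw [Matrix.frobenius_norm_def, ← Real.rpow_natCast, ← Real.rpow_mul (by positivity)]
  norm_num

/-- Each eigenvalue satisfies `t ≤ e^{t - 1}`; multiply over the spectrum. -/
lemma det_le_exp_trace_of_posSemidef {M : Matrix ι ι ℂ} (hM : M.PosSemidef) :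
    ‖M.det‖ ≤ Real.exp (M.trace.re - Fintype.card ι) := by
  rw [hM.1.det_eq_prod_eigenvalues, hM.1.trace_eq_sum_eigenvalues, norm_prod]
  have h : (∑ i, (hM.1.eigenvalues i : ℂ)).re - Fintype.card ι
      = ∑ i, (hM.1.eigenvalues i - 1) := by
    simp [Finset.sum_sub_distrib]
  erw [h, Real.exp_sum]
  refine Finset.prod_le_prod (fun i _ => norm_nonneg _) fun i _ => ?_
  have h0 := hM.eigenvalues_nonneg i
  have : ‖((hM.1.eigenvalues i : ℝ) : ℂ)‖ = hM.1.eigenvalues i := by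
    rw [Complex.norm_real, Real.norm_of_nonneg h0]
  erw [this]
  linarith [Real.add_one_le_exp (hM.1.eigenvalues i - 1)]

/-- The eigenvalue bound for `(1 - A)ᴴ(1 - A)` gives `|det (1 - A)|² ≤ exp (‖A‖² - 2 Re tr A)`. The
factor `e^{tr A}` removes exactly the trace term, which is not controlled by the Frobenius norm. -/
lemma norm_matDet2_le (A : Matrix ι ι ℂ) : ‖matDet2 A‖ ≤ Real.exp (‖A‖ ^ 2 / 2) := by
  have h1 := det_le_exp_trace_of_posSemidef (Matrix.posSemidef_conjTranspose_mul_self (1 - A))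
  rw [Matrix.det_mul, Matrix.det_conjTranspose, norm_mul, norm_star] at h1
  have h2 : ((1 - A)ᴴ * (1 - A)).trace.re - Fintype.card ι = ‖A‖ ^ 2 - 2 * A.trace.re := by
    have h3 : (Aᴴ * A).trace = ((∑ i, ∑ j, ‖A i j‖ ^ 2 : ℝ) : ℂ) := by
      rw [Finset.sum_comm]
      simp [Matrix.trace, Matrix.mul_apply, Complex.conj_mul']
    have h4 : (1 - A)ᴴ * (1 - A) = 1 - A - Aᴴ + Aᴴ * A := by
      simp only [Matrix.conjTranspose_sub, Matrix.conjTranspose_one]; noncomm_ring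
    rw [h4, frobenius_sq]
    simp only [Matrix.trace_add, Matrix.trace_sub, h3, Matrix.trace_one,
      Matrix.trace_conjTranspose, Complex.add_re, Complex.sub_re, Complex.ofReal_re,
      Complex.natCast_re, Complex.star_def, Complex.conj_re]
    ring
  rw [h2] at h1
  have h5 : ‖matDet2 A‖ ^ 2 ≤ Real.exp (‖A‖ ^ 2 / 2) ^ 2 := by
    rw [matDet2, norm_mul, mul_pow, Complex.norm_exp, ← Real.exp_nat_mul, ← Real.exp_nat_mul]
    calc _ ≤ Real.exp (‖A‖ ^ 2 - 2 * A.trace.re) * Real.exp ((2 : ℕ) * A.trace.re) := by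
          gcongr; rw [sq]; exact h1
      _ = _ := by rw [← Real.exp_add]; congr 1; push_cast; ring
  exact le_of_sq_le_sq h5 (by positivity)

lemma differentiable_matDet2_line (A B : Matrix ι ι ℂ) :
    Differentiable ℂ fun z : ℂ => matDet2 (B + z • A) := by
  unfold matDet2
  simp only [Matrix.det_apply, Matrix.trace, Matrix.diag, Matrix.sub_apply, Matrix.add_apply,
    Matrix.smul_apply, smul_eq_mul]
  fun_prop

/-- Local Lipschitz continuity of `matDet2` in the Frobenius norm, uniformly in the dimension. -/
lemma norm_matDet2_sub_le {A B : Matrix ι ι ℂ} {M : ℝ} (hA : ‖A‖ ≤ M) (hB : ‖B‖ ≤ M) :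
    ‖matDet2 A - matDet2 B‖ ≤ Real.exp ((3 * M + 1) ^ 2 / 2) * ‖A - B‖ := by
  rcases eq_or_ne A B with rfl | hne
  · simp
  have hd : 0 < ‖A - B‖ := norm_pos_iff.2 (sub_ne_zero.2 hne)
  set d := ‖A - B‖ with hd'
  have hdM : d ≤ 2 * M := (norm_sub_le _ _).trans (by linarith)
  let g : ℂ → ℂ := fun z => matDet2 (B + z • (A - B))
  have hg : Differentiable ℂ g := differentiable_matDet2_line (A - B) B
  have hder : ∀ z ∈ Metric.closedBall (0 : ℂ) 1,
      ‖deriv g z‖ ≤ Real.exp ((3 * M + 1) ^ 2 / 2) * d := by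
    intro z hz
    -- Cauchy's estimate on a circle of radius `1 / d`: the radius supplies the factor `d`, and on
    -- the circle the argument has norm at most `M + (1 + 1 / d) d ≤ 3 M + 1`.
    have := Complex.norm_deriv_le_of_forall_mem_sphere_norm_le (c := z) (R := 1 / d)
      (C := Real.exp ((3 * M + 1) ^ 2 / 2)) (by positivity) hg.diffContOnCl ?_
    · simpa using this
    intro w hw
    refine (norm_matDet2_le _).trans (Real.exp_le_exp.2 ?_)
    have hz1 : ‖z‖ ≤ 1 := by simpa using hz
    have hw1 : ‖w‖ ≤ 1 + 1 / d := by
      have : ‖w - z‖ = 1 / d := by simpa [dist_eq_norm] using hw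
      calc ‖w‖ = ‖z + (w - z)‖ := by ring_nf
        _ ≤ _ := (norm_add_le _ _).trans (by rw [this]; gcongr)
    have hn : ‖B + w • (A - B)‖ ≤ 3 * M + 1 := by
      calc _ ≤ ‖B‖ + ‖w • (A - B)‖ := norm_add_le _ _
        _ = ‖B‖ + ‖w‖ * d := by rw [norm_smul]
        _ ≤ M + (1 + 1 / d) * d := by gcongr
        _ = M + d + 1 := by field_simp; ring
        _ ≤ _ := by linarith
    gcongr
  have := (convex_closedBall (0 : ℂ) 1).norm_image_sub_le_of_norm_deriv_le
    (fun z _ => hg z) hder (x := 0) (y := 1) (by simp) (by simp)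
  simpa [g] using this

lemma matDet2_mul_comm (A : Matrix ι κ ℂ) (B : Matrix κ ι ℂ) :
    matDet2 (A * B) = matDet2 (B * A) := by
  rw [matDet2, matDet2, Matrix.det_one_sub_mul_comm, Matrix.trace_mul_comm]

/-- The determinant of `(1 - A)(1 - B)` factors; the trace of `A + B - AB` is off by `-tr (AB)`,
whence the exponential. -/
lemma matDet2_add_sub_mul (A B : Matrix ι ι ℂ) :
    matDet2 (A + B - A * B) = matDet2 A * matDet2 B * Complex.exp (-(A * B).trace) := by
  have : 1 - (A + B - A * B) = (1 - A) * (1 - B) := by noncomm_ring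
  rw [matDet2, matDet2, matDet2, this, Matrix.det_mul, Matrix.trace_sub, Matrix.trace_add,
    sub_eq_add_neg (A.trace + B.trace), Complex.exp_add, Complex.exp_add]
  ring

end FiniteDimensional

/-! ### Basis-free form of the modified determinant. -/

section LinearMaps

variable {V W : Type} [AddCommGroup V] [Module ℂ V] [AddCommGroup W] [Module ℂ W]

lemma finDet2_eq_matDet2 {ι : Type*} [Fintype ι] [DecidableEq ι] (b : Module.Basis ι ℂ V)
    (A : V →ₗ[ℂ] V) : finDet2 A = matDet2 (LinearMap.toMatrix b b A) := by
  rw [finDet2, matDet2, ← LinearMap.det_toMatrix b, map_sub, LinearMap.toMatrix_id,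
    LinearMap.trace_eq_matrix_trace ℂ b]

variable [FiniteDimensional ℂ V] [FiniteDimensional ℂ W]

lemma finDet2_comp_comm (f : V →ₗ[ℂ] W) (g : W →ₗ[ℂ] V) : finDet2 (f ∘ₗ g) = finDet2 (g ∘ₗ f) := by
  classical
  let bV := Module.finBasis ℂ V
  let bW := Module.finBasis ℂ W
  rw [finDet2_eq_matDet2 bW, finDet2_eq_matDet2 bV, LinearMap.toMatrix_comp bW bV bW,
    LinearMap.toMatrix_comp bV bW bV, matDet2_mul_comm]

lemma finDet2_add_sub_comp (A B : V →ₗ[ℂ] V) :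
    finDet2 (A + B - A ∘ₗ B) =
      finDet2 A * finDet2 B * Complex.exp (-LinearMap.trace ℂ V (A ∘ₗ B)) := by
  classical
  let bV := Module.finBasis ℂ V
  rw [finDet2_eq_matDet2 bV, finDet2_eq_matDet2 bV, finDet2_eq_matDet2 bV,
    LinearMap.trace_eq_matrix_trace ℂ bV, map_sub, map_add, LinearMap.toMatrix_comp bV bV bV,
    matDet2_add_sub_mul]

end LinearMaps

/-! ### Hilbert-Schmidt bounds. -/

section HilbertSchmidt

variable {H : Type} [NormedAddCommGroup H] [InnerProductSpace ℂ H]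

/-- The Hilbert-Schmidt norm of `T` is at most `C`. -/
def HSBound (T : H →L[ℂ] H) (C : ℝ) : Prop :=
  0 ≤ C ∧ ∀ (ι : Type) [Fintype ι] (b : ι → H), Orthonormal ℂ b → ∑ i, ‖T (b i)‖ ^ 2 ≤ C ^ 2

namespace HSBound

variable {T S : H →L[ℂ] H} {C D : ℝ}

lemma mono (h : HSBound T C) (hCD : C ≤ D) : HSBound T D :=
  ⟨h.1.trans hCD, fun ι _ b hb => (h.2 ι b hb).trans (by have := h.1; gcongr)⟩

lemma add (hT : HSBound T C) (hS : HSBound S D) : HSBound (T + S) (C + D) := by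
  refine ⟨add_nonneg hT.1 hS.1, fun ι _ b hb => ?_⟩
  have h1 := hT.2 ι b hb
  have h2 := hS.2 ι b hb
  have h3 : ∑ i, ‖T (b i)‖ * ‖S (b i)‖ ≤ C * D := by
    refine (Real.sum_mul_le_sqrt_mul_sqrt _ _ _).trans ?_
    have := hT.1
    gcongr
    · exact (Real.sqrt_le_left hT.1).2 h1
    · exact (Real.sqrt_le_left hS.1).2 h2
  calc ∑ i, ‖(T + S) (b i)‖ ^ 2
      ≤ ∑ i, (‖T (b i)‖ ^ 2 + 2 * (‖T (b i)‖ * ‖S (b i)‖) + ‖S (b i)‖ ^ 2) := by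
        refine Finset.sum_le_sum fun i _ => ?_
        have : ‖(T + S) (b i)‖ ≤ ‖T (b i)‖ + ‖S (b i)‖ := norm_add_le _ _
        calc _ ≤ (‖T (b i)‖ + ‖S (b i)‖) ^ 2 := by gcongr
          _ = _ := by ring
    _ = ∑ i, ‖T (b i)‖ ^ 2 + 2 * ∑ i, ‖T (b i)‖ * ‖S (b i)‖ + ∑ i, ‖S (b i)‖ ^ 2 := by
        rw [Finset.sum_add_distrib, Finset.sum_add_distrib, Finset.mul_sum]
    _ ≤ _ := by nlinarith

lemma neg (hT : HSBound T C) : HSBound (-T) C :=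
  ⟨hT.1, fun ι _ b hb => by simpa using hT.2 ι b hb⟩

lemma sub (hT : HSBound T C) (hS : HSBound S D) : HSBound (T - S) (C + D) := by
  rw [sub_eq_add_neg]; exact hT.add hS.neg

lemma comp_left (A : H →L[ℂ] H) (hT : HSBound T C) : HSBound (A ∘L T) (‖A‖ * C) := by
  refine ⟨mul_nonneg (norm_nonneg _) hT.1, fun ι _ b hb => ?_⟩
  calc ∑ i, ‖(A ∘L T) (b i)‖ ^ 2 ≤ ∑ i, (‖A‖ * ‖T (b i)‖) ^ 2 := by
        gcongr with i; exact A.le_opNorm _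
    _ = ‖A‖ ^ 2 * ∑ i, ‖T (b i)‖ ^ 2 := by simp only [mul_pow, Finset.mul_sum]
    _ ≤ ‖A‖ ^ 2 * C ^ 2 := by gcongr; exact hT.2 ι b hb
    _ = _ := by ring

lemma norm_le (hT : HSBound T C) : ‖T‖ ≤ C := by
  refine T.opNorm_le_bound hT.1 fun x => ?_
  rcases eq_or_ne x 0 with rfl | hx
  · simp
  have hx' : ‖x‖ ≠ 0 := norm_ne_zero_iff.2 hx
  -- A single normalized vector is already an orthonormal family.
  have h := hT.2 Unit (fun _ => ((‖x‖⁻¹ : ℝ) : ℂ) • x)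
    ⟨fun _ => by simp [norm_smul, hx'], fun i j hij => (hij rfl).elim⟩
  simp only [Finset.univ_unique, Finset.sum_const, Finset.card_singleton, one_smul, map_smul,
    norm_smul] at h
  have h2 := le_of_sq_le_sq h hT.1
  rw [Complex.norm_real, norm_inv, norm_norm, inv_mul_le_iff₀ (by positivity)] at h2
  linarith

lemma isHilbertSchmidt (hT : HSBound T C) : IsHilbertSchmidt T := by
  intro ι b
  refine summable_of_sum_le (c := C ^ 2) (fun i => by positivity) fun s => ?_
  have := hT.2 s (fun i => b i) (b.orthonormal.comp _ Subtype.val_injective)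
  rwa [Finset.sum_coe_sort s (fun i => ‖T (b i)‖ ^ 2)] at this

variable [CompleteSpace H]

/-- The vectors `T* c_j` span a finite-dimensional space. Expanding them in an orthonormal basis
`e_i` of it and exchanging the sums leaves `∑ |⟨c_j, T e_i⟩|²`, which Bessel's inequality for the
`c_j` bounds by `∑ ‖T e_i‖²`. -/
lemma adjoint (hT : HSBound T C) : HSBound (ContinuousLinearMap.adjoint T) C := by
  refine ⟨hT.1, fun ι _ c hc => ?_⟩
  set T' := ContinuousLinearMap.adjoint T
  let U : Submodule ℂ H := Submodule.span ℂ (Set.range fun j => T' (c j))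
  have : FiniteDimensional ℂ U := FiniteDimensional.span_of_finite ℂ (Set.finite_range _)
  let e := stdOrthonormalBasis ℂ U
  have he : Orthonormal ℂ fun i => (e i : H) := e.orthonormal.comp_linearIsometry U.subtypeₗᵢ
  have h1 : ∀ j, ‖T' (c j)‖ ^ 2 = ∑ i, ‖inner ℂ (c j) (T (e i))‖ ^ 2 := by
    intro j
    have hm : T' (c j) ∈ U := Submodule.subset_span ⟨j, rfl⟩
    have := e.sum_sq_norm_inner_left (⟨T' (c j), hm⟩ : U)
    simp only [Submodule.coe_inner, Submodule.coe_norm] at this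
    rw [← this]
    exact Finset.sum_congr rfl fun i _ => by rw [ContinuousLinearMap.adjoint_inner_left]
  simp only [h1]
  rw [Finset.sum_comm]
  refine (Finset.sum_le_sum fun i _ => ?_).trans (hT.2 _ _ he)
  exact hc.sum_inner_products_le (s := Finset.univ) _

lemma comp_right (hT : HSBound T C) (A : H →L[ℂ] H) : HSBound (T ∘L A) (C * ‖A‖) := by
  have := (hT.adjoint.comp_left (ContinuousLinearMap.adjoint A)).adjoint
  rw [ContinuousLinearMap.adjoint_comp, ContinuousLinearMap.adjoint_adjoint,
    ContinuousLinearMap.adjoint_adjoint, LinearIsometryEquiv.norm_map, mul_comm] at this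
  exact this

/-- One Hilbert basis suffices: Parseval in that basis and Bessel for an arbitrary orthonormal
family bound the adjoint, and the bound passes back to `T`. -/
lemma of_hilbertBasis {w : Type} (b : HilbertBasis w ℂ H) (hs : Summable fun i => ‖T (b i)‖ ^ 2) :
    HSBound T √(∑' i, ‖T (b i)‖ ^ 2) := by
  suffices h : HSBound (ContinuousLinearMap.adjoint T) √(∑' i, ‖T (b i)‖ ^ 2) by
    simpa using h.adjoint
  refine ⟨Real.sqrt_nonneg _, fun ι _ c hc => ?_⟩
  rw [Real.sq_sqrt (tsum_nonneg fun i => by positivity)]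
  have h1 : ∀ j, HasSum (fun i => ‖inner ℂ (c j) (T (b i))‖ ^ 2)
      (‖ContinuousLinearMap.adjoint T (c j)‖ ^ 2) := by
    intro j
    have := b.hasSum_inner_mul_inner (ContinuousLinearMap.adjoint T (c j))
      (ContinuousLinearMap.adjoint T (c j))
    rw [inner_self_eq_norm_sq_to_K] at this
    have h2 : ∀ i, inner ℂ (ContinuousLinearMap.adjoint T (c j)) (b i) *
        inner ℂ (b i) (ContinuousLinearMap.adjoint T (c j))
        = ((‖inner ℂ (c j) (T (b i))‖ ^ 2 : ℝ) : ℂ) := by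
      intro i
      rw [← inner_conj_symm (b i), Complex.mul_conj', ContinuousLinearMap.adjoint_inner_left]
      push_cast; rfl
    simp only [h2] at this
    rw [← Complex.hasSum_ofReal]; push_cast at this ⊢; exact this
  have h2 := hasSum_sum fun j (_ : j ∈ (Finset.univ : Finset ι)) => h1 j
  rw [← h2.tsum_eq]
  refine Summable.tsum_le_tsum (fun i => ?_) h2.summable hs
  exact hc.sum_inner_products_le (s := Finset.univ) _

end HSBound

/-! ### Hilbert-Schmidt convergence of finite-rank truncations. -/

section Projections

variable [CompleteSpace H] {T : H →L[ℂ] H} {C : ℝ}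

/-- A sequence of finite-dimensional subspaces that exhausts `H`. -/
structure IsExhaustion (V : ℕ → Submodule ℂ H) : Prop where
  finiteDimensional : ∀ J, FiniteDimensional ℂ (V J)
  monotone : Monotone V
  dense : (⨆ J, V J).topologicalClosure = ⊤

variable {V : ℕ → Submodule ℂ H} [∀ J, FiniteDimensional ℂ (V J)]

lemma IsExhaustion.tendsto (hV : IsExhaustion V) (x : H) :
    Tendsto (fun J => (V J).starProjection x) atTop (𝓝 x) :=
  Submodule.starProjection_tendsto_self V hV.monotone x hV.dense.ge

/-- The projections converge strongly to the identity, and `‖T b_i‖²` is a summable majorant for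
dominated convergence over a Hilbert basis. -/
lemma HSBound.exists_tendsto (hT : HSBound T C) (hV : IsExhaustion V) :
    ∃ d : ℕ → ℝ, Tendsto d atTop (𝓝 0) ∧ ∀ J, HSBound (T - (V J).starProjection ∘L T) (d J) := by
  obtain ⟨w, b, -⟩ := exists_hilbertBasis ℂ H
  have hs := hT.isHilbertSchmidt _ b
  have hle : ∀ J x, ‖(T - (V J).starProjection ∘L T) x‖ ≤ ‖T x‖ := by
    intro J x
    have h0 : (T - (V J).starProjection ∘L T) x = (V J)ᗮ.starProjection (T x) := by
      simp [Submodule.starProjection_orthogonal_val]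
    rw [h0]
    exact Submodule.norm_starProjection_apply_le _ _
  refine ⟨fun J => √(∑' i, ‖(T - (V J).starProjection ∘L T) (b i)‖ ^ 2), ?_, fun J => ?_⟩
  · rw [← Real.sqrt_zero]
    refine (Real.continuous_sqrt.tendsto 0).comp ?_
    have : (0 : ℝ) = ∑' _ : w, (0 : ℝ) := by simp
    rw [this]
    refine tendsto_tsum_of_dominated_convergence hs (fun i => ?_) (Eventually.of_forall fun J i => ?_)
    · have h1 := (hV.tendsto (T (b i))).const_sub (T (b i))
      have h2 := (h1.norm).pow 2
      simpa using h2
    · rw [norm_pow, norm_norm]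
      have := hle J (b i)
      gcongr
  · refine HSBound.of_hilbertBasis b (hs.of_nonneg_of_le (fun i => by positivity) fun i => ?_)
    have := hle J (b i)
    gcongr

/-- The finite-rank truncation `P T P` of `T`. -/
def trunc (T : H →L[ℂ] H) (U : Submodule ℂ H) [FiniteDimensional ℂ U] : H →L[ℂ] H :=
  U.starProjection ∘L T ∘L U.starProjection

lemma HSBound.trunc (hT : HSBound T C) (U : Submodule ℂ H) [FiniteDimensional ℂ U] :
    HSBound (trunc T U) C := by
  refine ((hT.comp_right U.starProjection).comp_left U.starProjection).mono ?_
  have h1 := U.starProjection_norm_le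
  have h2 := hT.1
  calc _ ≤ 1 * (C * 1) := by gcongr
    _ = C := by ring

/-- Write `T - PTP = (T - PT) + P(T - TP)`; the second bracket is the adjoint of `T* - PT*`, so the
one-sided convergence applies to both terms. -/
lemma HSBound.exists_tendsto_trunc (hT : HSBound T C) (hV : IsExhaustion V) :
    ∃ d : ℕ → ℝ, Tendsto d atTop (𝓝 0) ∧ ∀ J, HSBound (T - HillEvans.trunc T (V J)) (d J) := by
  obtain ⟨d, hd, h⟩ := hT.exists_tendsto hV
  obtain ⟨d', hd', h'⟩ := hT.adjoint.exists_tendsto hV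
  refine ⟨fun J => d J + d' J, by simpa using hd.add hd', fun J => ?_⟩
  have h1 := ((h' J).adjoint.comp_left (V J).starProjection).mono (D := d' J) (by
    have := (V J).starProjection_norm_le
    have h2 := (h' J).1
    calc _ ≤ 1 * d' J := by gcongr
      _ = _ := one_mul _)
  have h2 := (h J).add h1
  convert h2 using 1
  rw [map_sub, ContinuousLinearMap.adjoint_comp, ContinuousLinearMap.adjoint_adjoint,
    (ContinuousLinearMap.isSelfAdjoint_iff'.1 (isSelfAdjoint_starProjection (V J)))]
  ext x
  simp [HillEvans.trunc]

end Projections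

/-! ### Galerkin determinants and their comparison on different subspaces. -/

section Galerkin

variable {U : Submodule ℂ H} [FiniteDimensional ℂ U]

lemma galerkin_apply (T : H →L[ℂ] H) (x : U) :
    galerkin T U x = U.orthogonalProjectionOnto (T x) := rfl

lemma galerkin_add (T S : H →L[ℂ] H) : galerkin (T + S) U = galerkin T U + galerkin S U := by
  ext x; simp [galerkin_apply]

lemma galerkin_sub (T S : H →L[ℂ] H) : galerkin (T - S) U = galerkin T U - galerkin S U := by
  ext x; simp [galerkin_apply]

attribute [local instance] Matrix.frobeniusNormedAddCommGroup Matrix.frobeniusNormedSpace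

lemma toMatrix_galerkin {ι : Type*} [Fintype ι] [DecidableEq ι] (e : OrthonormalBasis ι ℂ U)
    (T : H →L[ℂ] H) (i j : ι) :
    LinearMap.toMatrix e.toBasis e.toBasis (galerkin T U) i j = inner ℂ (e i : H) (T (e j)) := by
  rw [LinearMap.toMatrix_apply, OrthonormalBasis.coe_toBasis_repr_apply,
    OrthonormalBasis.repr_apply_apply, OrthonormalBasis.coe_toBasis, galerkin_apply,
    Submodule.coe_inner, ← Submodule.starProjection_apply,
    ← Submodule.inner_starProjection_left_eq_right, Submodule.starProjection_mem_subspace_eq_self]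

lemma HSBound.norm_toMatrix_galerkin_le {T : H →L[ℂ] H} {C : ℝ} (hT : HSBound T C)
    {ι : Type} [Fintype ι] [DecidableEq ι] (e : OrthonormalBasis ι ℂ U) :
    ‖LinearMap.toMatrix e.toBasis e.toBasis (galerkin T U)‖ ≤ C := by
  refine le_of_sq_le_sq ?_ hT.1
  have he : Orthonormal ℂ fun i => (e i : H) := e.orthonormal.comp_linearIsometry U.subtypeₗᵢ
  rw [frobenius_sq, Finset.sum_comm]
  simp only [toMatrix_galerkin]
  refine (Finset.sum_le_sum fun j _ => ?_).trans (hT.2 _ _ he)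
  exact he.sum_inner_products_le (s := Finset.univ) _

/-- The Lipschitz constant of the `2`-modified determinant on the Hilbert-Schmidt ball of
radius `M`. -/
def lipConst (M : ℝ) : ℝ := Real.exp ((3 * M + 1) ^ 2 / 2)

lemma norm_finDet2_galerkin_sub_le {T S : H →L[ℂ] H} {M d : ℝ} (hT : HSBound T M)
    (hS : HSBound S M) (hd : HSBound (T - S) d) (U : Submodule ℂ H) [FiniteDimensional ℂ U] :
    ‖finDet2 (galerkin T U) - finDet2 (galerkin S U)‖ ≤ lipConst M * d := by
  let e := stdOrthonormalBasis ℂ U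
  rw [finDet2_eq_matDet2 e.toBasis, finDet2_eq_matDet2 e.toBasis]
  refine (norm_matDet2_sub_le (hT.norm_toMatrix_galerkin_le e)
    (hS.norm_toMatrix_galerkin_le e)).trans ?_
  rw [← map_sub, ← galerkin_sub]
  unfold lipConst
  gcongr
  exact hd.norm_toMatrix_galerkin_le e

/-- Sylvester's identity moves the determinant from the varying space `U` to the fixed space `E`,
where limits in `U` are elementary. -/
lemma finDet2_galerkin_finiteRank {E : Type} [NormedAddCommGroup E] [NormedSpace ℂ E]
    [FiniteDimensional ℂ E] (u : E →L[ℂ] H) (l : H →L[ℂ] E) (U : Submodule ℂ H)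
    [FiniteDimensional ℂ U] :
    finDet2 (galerkin (u ∘L l) U) = finDet2 (l ∘L U.starProjection ∘L u : E →L[ℂ] E).toLinearMap :=
  finDet2_comp_comm (U.orthogonalProjectionOnto ∘L u : E →L[ℂ] U).toLinearMap
    (l ∘L U.subtypeL : U →L[ℂ] E).toLinearMap

variable [CompleteSpace H]

/-- Enlarging the subspace does not change the determinant of an operator that factors through `V`.
Galerkin determinants on different subspaces can therefore be read off on one common subspace. -/
lemma finDet2_galerkin_trunc (T : H →L[ℂ] H) {V U : Submodule ℂ H} [FiniteDimensional ℂ U]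
    [FiniteDimensional ℂ V] (h : V ≤ U) :
    finDet2 (galerkin (trunc T V) U) = finDet2 (galerkin T V) := by
  have h1 : trunc T V = V.subtypeL ∘L (V.orthogonalProjectionOnto ∘L T ∘L V.starProjection) := rfl
  rw [h1, finDet2_galerkin_finiteRank]
  congr 1
  ext x
  have h2 : U.starProjection (x : H) = x := U.starProjection_eq_self_iff.2 (h x.2)
  have h3 : V.starProjection (x : H) = x := V.starProjection_eq_self_iff.2 x.2
  simp [galerkin_apply, h2]

/-- Both determinants are realized on `V ⊔ W` and compared there with that of `T` itself. Neither
subspace has to contain the other, so this yields the Cauchy property and also independence of the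
exhaustion. -/
lemma norm_finDet2_galerkin_sub_le_trunc {T : H →L[ℂ] H} {M d d' : ℝ} (hT : HSBound T M)
    (V W : Submodule ℂ H) [FiniteDimensional ℂ V] [FiniteDimensional ℂ W]
    (hV : HSBound (T - trunc T V) d) (hW : HSBound (T - trunc T W) d') :
    ‖finDet2 (galerkin T V) - finDet2 (galerkin T W)‖ ≤ lipConst M * (d + d') := by
  have h1 := norm_finDet2_galerkin_sub_le hT (hT.trunc V) hV (V ⊔ W)
  have h2 := norm_finDet2_galerkin_sub_le hT (hT.trunc W) hW (V ⊔ W)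
  rw [finDet2_galerkin_trunc T le_sup_left] at h1
  rw [finDet2_galerkin_trunc T le_sup_right] at h2
  rw [norm_sub_rev] at h1
  calc _ ≤ _ := norm_sub_le_norm_sub_add_norm_sub _ (finDet2 (galerkin T (V ⊔ W))) _
    _ ≤ lipConst M * d + lipConst M * d' := add_le_add h1 h2
    _ = _ := by ring

/-! ### Existence, continuity, similarity invariance and product formula for `det₂`. -/

section Limits

variable {V : ℕ → Submodule ℂ H} [∀ J, FiniteDimensional ℂ (V J)]

theorem HSBound.exists_hasDet2 {T : H →L[ℂ] H} {M : ℝ} (hT : HSBound T M) (hV : IsExhaustion V) :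
    ∃ d, HasDet2 T d := by
  obtain ⟨d, hd, hdV⟩ := hT.exists_tendsto_trunc hV
  have hc : CauchySeq fun J => finDet2 (galerkin T (V J)) := by
    rw [Metric.cauchySeq_iff']
    intro ε hε
    have h1 : Tendsto (fun J => lipConst M * (d J + d J)) atTop (𝓝 0) := by
      simpa using (hd.add hd).const_mul (lipConst M)
    have h2 : Tendsto (fun J => lipConst M * d J) atTop (𝓝 0) := by
      simpa using hd.const_mul (lipConst M)
    obtain ⟨N, hN⟩ := eventually_atTop.1 (h2.eventually (gt_mem_nhds (half_pos hε)))
    refine ⟨N, fun n hn => ?_⟩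
    rw [dist_eq_norm]
    refine (norm_finDet2_galerkin_sub_le_trunc hT (V n) (V N) (hdV n) (hdV N)).trans_lt ?_
    have := hN n hn
    have := hN N le_rfl
    linarith
  obtain ⟨a, ha⟩ := cauchySeq_tendsto_of_complete hc
  refine ⟨a, hT.isHilbertSchmidt, fun W _ hWm hWd => ?_⟩
  obtain ⟨d', hd', hdW⟩ := hT.exists_tendsto_trunc ⟨inferInstance, hWm, hWd⟩
  have h0 : Tendsto (fun J => finDet2 (galerkin T (W J)) - finDet2 (galerkin T (V J))) atTop
      (𝓝 0) := by
    refine squeeze_zero_norm (fun J => norm_finDet2_galerkin_sub_le_trunc hT (W J) (V J)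
      (hdW J) (hdV J)) ?_
    simpa using (hd'.add hd).const_mul (lipConst M)
  simpa using h0.add ha

lemma HasDet2.tendsto {T : H →L[ℂ] H} {a : ℂ} (h : HasDet2 T a) (hV : IsExhaustion V) :
    Tendsto (fun J => finDet2 (galerkin T (V J))) atTop (𝓝 a) :=
  h.2 V hV.monotone hV.dense

lemma HasDet2.unique {T : H →L[ℂ] H} {a b : ℂ} (ha : HasDet2 T a) (hb : HasDet2 T b)
    (hV : IsExhaustion V) : a = b :=
  tendsto_nhds_unique (ha.tendsto hV) (hb.tendsto hV)

lemma hasDet2_det2 {T : H →L[ℂ] H} (h : ∃ d, HasDet2 T d) : HasDet2 T (det2 T) := by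
  rw [det2, dif_pos h]; exact h.choose_spec

lemma HSBound.hasDet2 {T : H →L[ℂ] H} {M : ℝ} (hT : HSBound T M) (hV : IsExhaustion V) :
    HasDet2 T (det2 T) :=
  hasDet2_det2 (hT.exists_hasDet2 hV)

theorem norm_det2_sub_le {T S : H →L[ℂ] H} {M d : ℝ} (hV : IsExhaustion V) (hT : HSBound T M)
    (hS : HSBound S M) (hd : HSBound (T - S) d) : ‖det2 T - det2 S‖ ≤ lipConst M * d :=
  le_of_tendsto (((hT.hasDet2 hV).tendsto hV).sub ((hS.hasDet2 hV).tendsto hV)).norm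
    (Eventually.of_forall fun J => norm_finDet2_galerkin_sub_le hT hS hd (V J))

section FiniteRank

variable {E : Type} [NormedAddCommGroup E] [NormedSpace ℂ E] [FiniteDimensional ℂ E]

lemma tendsto_toMatrix {B : ℕ → E →L[ℂ] E} {B' : E →L[ℂ] E}
    (h : ∀ x, Tendsto (fun J => B J x) atTop (𝓝 (B' x))) {ι : Type*} [Fintype ι] [DecidableEq ι]
    (b : Module.Basis ι ℂ E) :
    Tendsto (fun J => LinearMap.toMatrix b b (B J).toLinearMap) atTop
      (𝓝 (LinearMap.toMatrix b b B'.toLinearMap)) := by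
  refine tendsto_pi_nhds.2 fun i => tendsto_pi_nhds.2 fun j => ?_
  simp only [LinearMap.toMatrix_apply]
  have hc : Continuous fun x => b.repr x i :=
    LinearMap.continuous_of_finiteDimensional (b.coord i)
  exact (hc.tendsto _).comp (h (b j))

lemma tendsto_finDet2 {B : ℕ → E →L[ℂ] E} {B' : E →L[ℂ] E}
    (h : ∀ x, Tendsto (fun J => B J x) atTop (𝓝 (B' x))) :
    Tendsto (fun J => finDet2 (B J).toLinearMap) atTop (𝓝 (finDet2 B'.toLinearMap)) := by
  let b := Module.finBasis ℂ E
  simp only [finDet2_eq_matDet2 b]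
  have hc : Continuous (matDet2 : Matrix (Fin (Module.finrank ℂ E)) _ ℂ → ℂ) := by
    unfold matDet2
    exact ((continuous_const.sub continuous_id).matrix_det).mul
      (Complex.continuous_exp.comp continuous_id.matrix_trace)
  exact (hc.tendsto _).comp (tendsto_toMatrix h b)

lemma tendsto_trace {B : ℕ → E →L[ℂ] E} {B' : E →L[ℂ] E}
    (h : ∀ x, Tendsto (fun J => B J x) atTop (𝓝 (B' x))) :
    Tendsto (fun J => LinearMap.trace ℂ E (B J).toLinearMap) atTop
      (𝓝 (LinearMap.trace ℂ E B'.toLinearMap)) := by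
  let b := Module.finBasis ℂ E
  simp only [LinearMap.trace_eq_matrix_trace ℂ b]
  exact (continuous_id.matrix_trace.tendsto _).comp (tendsto_toMatrix h b)

lemma tendsto_finDet2_galerkin_finiteRank (hV : IsExhaustion V) (u : E →L[ℂ] H) (l : H →L[ℂ] E) :
    Tendsto (fun J => finDet2 (galerkin (u ∘L l) (V J))) atTop
      (𝓝 (finDet2 (l ∘L u : E →L[ℂ] E).toLinearMap)) := by
  simp only [finDet2_galerkin_finiteRank]
  exact tendsto_finDet2 fun x => (l.continuous.tendsto _).comp (hV.tendsto (u x))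

end FiniteRank

/-- The `2`-modified determinant is invariant under similarity. -/
theorem det2_conj (hV : IsExhaustion V) {T : H →L[ℂ] H} {M : ℝ} (hT : HSBound T M)
    (S S' : H →L[ℂ] H) (hS : S' ∘L S = ContinuousLinearMap.id ℂ H) :
    det2 (S ∘L T ∘L S') = det2 T := by
  obtain ⟨d, hd, hdV⟩ := hT.exists_tendsto_trunc hV
  have hb : ∀ {R : H →L[ℂ] H} {C : ℝ}, HSBound R C → HSBound (S ∘L R ∘L S') (‖S‖ * (C * ‖S'‖)) :=
    fun h => (h.comp_right S').comp_left S
  -- The conjugated truncation `S P T P S'` has finite rank, so its determinant is computed on `V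
  -- J`; there `S' S = 1` makes it equal to the Galerkin determinant of `T`.
  have key : ∀ J, ‖finDet2 (galerkin T (V J)) - det2 (S ∘L T ∘L S')‖
      ≤ lipConst (‖S‖ * (M * ‖S'‖)) * (‖S‖ * (d J * ‖S'‖)) := by
    intro J
    have h1 := tendsto_finDet2_galerkin_finiteRank hV (S ∘L (V J).subtypeL)
      (((V J).orthogonalProjectionOnto ∘L T ∘L (V J).starProjection) ∘L S')
    have h2 : ((((V J).orthogonalProjectionOnto ∘L T ∘L (V J).starProjection) ∘L S') ∘L
        (S ∘L (V J).subtypeL) : V J →L[ℂ] V J).toLinearMap = galerkin T (V J) := by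
      ext x
      have h3 : S' (S (x : H)) = x := DFunLike.congr_fun hS (x : H)
      simp [h3, galerkin_apply]
    rw [h2] at h1
    refine le_of_tendsto (h1.sub (((hb hT).hasDet2 hV).tendsto hV)).norm
      (Eventually.of_forall fun K => ?_)
    refine norm_finDet2_galerkin_sub_le (T := S ∘L trunc T (V J) ∘L S')
      (hb (hT.trunc (V J))) (hb hT) ?_ (V K)
    have := hb (hdV J).neg
    convert this using 1
    ext x
    simp
  have h4 := le_of_tendsto_of_tendsto
    (((hT.hasDet2 hV).tendsto hV).sub_const (det2 (S ∘L T ∘L S'))).norm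
    (((hd.mul_const ‖S'‖).const_mul ‖S‖).const_mul (lipConst (‖S‖ * (M * ‖S'‖))))
    (Eventually.of_forall key)
  simp only [zero_mul, mul_zero, norm_le_zero_iff, sub_eq_zero] at h4
  exact h4.symm

/-- Multiplicativity of the `2`-modified determinant for a finite-rank second factor. -/
theorem det2_mul_finiteRank (hV : IsExhaustion V) {E : Type} [NormedAddCommGroup E]
    [NormedSpace ℂ E] [FiniteDimensional ℂ E] {A : H →L[ℂ] H} {M M' : ℝ} (hA : HSBound A M)
    (w : E →L[ℂ] H) (l : H →L[ℂ] E) (hB : HSBound (w ∘L l) M') :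
    det2 (A + w ∘L l - A ∘L (w ∘L l)) = det2 A * finDet2 (l ∘L w : E →L[ℂ] E).toLinearMap *
      Complex.exp (-LinearMap.trace ℂ E (l ∘L A ∘L w : E →L[ℂ] E).toLinearMap) := by
  set B := w ∘L l with hBdef
  obtain ⟨d, hd, hdB⟩ := hB.exists_tendsto hV
  have hprod : HSBound (A + B - A ∘L B) (M + M' + ‖A‖ * M') := (hA.add hB).sub (hB.comp_left A)
  have hJ : ∀ J, HSBound (A + B - A ∘L ((V J).starProjection ∘L B)) (M + M' + ‖A‖ * M') := by
    intro J
    refine (hA.add hB).sub ((hB.comp_left (V J).starProjection).mono ?_ |>.comp_left A)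
    have := (V J).starProjection_norm_le
    have h2 := hB.1
    calc _ ≤ 1 * M' := by gcongr
      _ = _ := one_mul _
  -- Compression is not multiplicative on `A B`, but it is on `A P_J B`. Replacing one by the other
  -- costs an error that vanishes in the Hilbert-Schmidt norm.
  have h1 : Tendsto (fun J => finDet2 (galerkin (A + B - A ∘L B) (V J)) -
      finDet2 (galerkin (A + B - A ∘L ((V J).starProjection ∘L B)) (V J))) atTop (𝓝 0) := by
    refine squeeze_zero_norm (a := fun J => lipConst (M + M' + ‖A‖ * M') * (‖A‖ * d J))
      (fun J => norm_finDet2_galerkin_sub_le hprod (hJ J) ?_ (V J)) ?_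
    · have := ((hdB J).comp_left A).neg
      convert this using 1
      ext x
      simp
    · simpa using (hd.const_mul ‖A‖).const_mul (lipConst (M + M' + ‖A‖ * M'))
  have h2 : ∀ J, finDet2 (galerkin (A + B - A ∘L ((V J).starProjection ∘L B)) (V J)) =
      finDet2 (galerkin A (V J)) * finDet2 (galerkin B (V J)) *
        Complex.exp (-LinearMap.trace ℂ E
          (l ∘L trunc A (V J) ∘L w : E →L[ℂ] E).toLinearMap) := by
    intro J
    rw [galerkin_sub, galerkin_add]
    have h3 : galerkin (A ∘L ((V J).starProjection ∘L B)) (V J) =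
        galerkin A (V J) ∘ₗ galerkin B (V J) := rfl
    have h4 : LinearMap.trace ℂ (V J) (galerkin A (V J) ∘ₗ galerkin B (V J)) =
        LinearMap.trace ℂ E (l ∘L trunc A (V J) ∘L w : E →L[ℂ] E).toLinearMap :=
      LinearMap.trace_comp_comm' (l ∘L (V J).subtypeL : V J →L[ℂ] E).toLinearMap
        ((V J).orthogonalProjectionOnto ∘L A ∘L (V J).starProjection ∘L w :
          E →L[ℂ] V J).toLinearMap
    rw [h3, finDet2_add_sub_comp, h4]
  -- The trace of the product of two compressions has been moved cyclically to `E`, so strong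
  -- convergence of `P_J A P_J` is enough.
  have h5 : Tendsto (fun J => LinearMap.trace ℂ E
      (l ∘L trunc A (V J) ∘L w : E →L[ℂ] E).toLinearMap) atTop
      (𝓝 (LinearMap.trace ℂ E (l ∘L A ∘L w : E →L[ℂ] E).toLinearMap)) := by
    refine tendsto_trace fun x => (l.continuous.tendsto _).comp ?_
    have h6 : Tendsto (fun J => (V J).starProjection (A ((V J).starProjection (w x)) - A (w x)) +
        (V J).starProjection (A (w x))) atTop (𝓝 (0 + A (w x))) := by
      refine Tendsto.add (squeeze_zero_norm
        (a := fun J => ‖A ((V J).starProjection (w x)) - A (w x)‖) (fun J => ?_) ?_) (hV.tendsto _)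
      · exact Submodule.norm_starProjection_apply_le _ _
      · have := (A.continuous.tendsto _).comp (hV.tendsto (w x))
        simpa using (this.sub_const (A (w x))).norm
    simpa [trunc] using h6
  have h7 := h1.add ((((hA.hasDet2 hV).tendsto hV).mul
    (tendsto_finDet2_galerkin_finiteRank hV w l)).mul h5.neg.cexp)
  simp only [← hBdef, h2, sub_add_cancel, zero_add] at h7
  exact tendsto_nhds_unique ((hprod.hasDet2 hV).tendsto hV) h7

end Limits

end Galerkin

end HilbertSchmidt

/-! ### Integral operators with kernel `g(x,y) M(y)`. -/

section KernelOperators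

/-- Lebesgue measure on one period. -/
abbrev perMeasure (X : ℝ) : Measure ℝ := volume.restrict (Ioc 0 X)

variable {X : ℝ} {m : Type} [Fintype m]

/-- The entries of the matrix function `M` are square integrable over one period. -/
def HasL2Entries (X : ℝ) (M : ℝ → Matrix m m ℂ) : Prop :=
  ∀ i j, MemLp (fun x => M x i j) 2 (perMeasure X)

/-- The squared Frobenius norm of a matrix function. -/
def frobSq (M : ℝ → Matrix m m ℂ) (y : ℝ) : ℝ := ∑ a, ∑ b, ‖M y a b‖ ^ 2

lemma frobSq_nonneg (M : ℝ → Matrix m m ℂ) (y : ℝ) : 0 ≤ frobSq M y := by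
  unfold frobSq; positivity

lemma HasL2Entries.integrable_frobSq {M : ℝ → Matrix m m ℂ} (hM : HasL2Entries X M) :
    Integrable (frobSq M) (perMeasure X) :=
  integrable_finsetSum _ fun a _ => integrable_finsetSum _ fun b _ =>
    (memLp_two_iff_integrable_sq_norm (hM a b).1).1 (hM a b)

lemma memLp_coord (f : L2 X m) (b : m) : MemLp (fun y => f y b) 2 (perMeasure X) :=
  (Lp.memLp f).eval_piLp b

lemma HasL2Entries.integrable_mulVec {M : ℝ → Matrix m m ℂ} (hM : HasL2Entries X M) (f : L2 X m)
    (a : m) : Integrable (fun y => (M y *ᵥ (f y).ofLp) a) (perMeasure X) := by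
  simp only [Matrix.mulVec, dotProduct]
  exact integrable_finsetSum _ fun b _ => (hM a b).integrable_mul (memLp_coord f b)

lemma norm_sq_L2 (f : L2 X m) : ‖f‖ ^ 2 = ∫ y, ‖f y‖ ^ 2 ∂perMeasure X := by
  have h := L2.inner_def (𝕜 := ℂ) f f
  rw [inner_self_eq_norm_sq_to_K] at h
  have h2 : ∀ y, inner ℂ (f y) (f y) = ((‖f y‖ ^ 2 : ℝ) : ℂ) := fun y => by
    rw [inner_self_eq_norm_sq_to_K]; push_cast; rfl
  simp only [h2] at h
  rw [integral_complex_ofReal] at h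
  rw [← Complex.ofReal_inj, Complex.ofReal_pow]; exact h

lemma integrable_norm_sq_L2 (f : L2 X m) : Integrable (fun y => ‖f y‖ ^ 2) (perMeasure X) :=
  (memLp_two_iff_integrable_sq_norm (Lp.memLp f).1).1 (Lp.memLp f)

variable {g : ℝ → ℝ → ℂ} {C : ℝ} {M : ℝ → Matrix m m ℂ}

lemma memLp_kernelRow (hg : Measurable (Function.uncurry g)) (hC : ∀ x y, ‖g x y‖ ≤ C)
    (hM : HasL2Entries X M) (x : ℝ) (a : m) :
    MemLp (fun y => WithLp.toLp 2 fun b => star (g x y * M y a b) : ℝ → EuclideanSpace ℂ m) 2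
      (perMeasure X) := by
  refine MemLp.of_eval_piLp fun b => ?_
  have h1 : MemLp (fun y => g x y * M y a b) 2 (perMeasure X) := by
    refine MemLp.of_le_mul (c := C) (hM a b) ?_ (Eventually.of_forall fun y => ?_)
    · exact (hg.comp measurable_prodMk_left).aestronglyMeasurable.mul (hM a b).1
    · rw [norm_mul]
      exact mul_le_mul_of_nonneg_right (hC x y) (norm_nonneg _)
  exact h1.star

/-- The rows of the integral kernel `g(x,y) M(y)`, as elements of `L²`. -/
def kernelRow (hg : Measurable (Function.uncurry g)) (hC : ∀ x y, ‖g x y‖ ≤ C)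
    (hM : HasL2Entries X M) (x : ℝ) (a : m) : L2 X m :=
  (memLp_kernelRow hg hC hM x a).toLp _

lemma inner_kernelRow (hg : Measurable (Function.uncurry g)) (hC : ∀ x y, ‖g x y‖ ≤ C)
    (hM : HasL2Entries X M) (x : ℝ) (a : m) (f : L2 X m) :
    inner ℂ (kernelRow hg hC hM x a) f =
      ∫ y, g x y * (M y *ᵥ (f y).ofLp) a ∂perMeasure X := by
  rw [L2.inner_def]
  refine integral_congr_ae ?_
  filter_upwards [(memLp_kernelRow hg hC hM x a).coeFn_toLp] with y hy
  rw [kernelRow, hy, PiLp.inner_apply]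
  simp only [Matrix.mulVec, dotProduct, Finset.mul_sum]
  refine Finset.sum_congr rfl fun b _ => ?_
  simp [RCLike.inner_apply]
  ring

lemma sum_norm_sq_kernelRow (hg : Measurable (Function.uncurry g)) (hC : ∀ x y, ‖g x y‖ ≤ C)
    (hM : HasL2Entries X M) (x : ℝ) :
    ∑ a, ‖kernelRow hg hC hM x a‖ ^ 2 = ∫ y, ‖g x y‖ ^ 2 * frobSq M y ∂perMeasure X := by
  have h : ∀ a, (fun y => ‖kernelRow hg hC hM x a y‖ ^ 2) =ᵐ[perMeasure X]
      fun y => ‖g x y‖ ^ 2 * ∑ b, ‖M y a b‖ ^ 2 := by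
    intro a
    filter_upwards [(memLp_kernelRow hg hC hM x a).coeFn_toLp] with y hy
    rw [kernelRow, hy, EuclideanSpace.norm_sq_eq]
    simp [mul_pow, Finset.mul_sum]
  simp only [norm_sq_L2, frobSq, Finset.mul_sum (s := Finset.univ) (f := fun a => ∑ b, _)]
  rw [integral_finsetSum]
  · exact Finset.sum_congr rfl fun a _ => integral_congr_ae (h a)
  · exact fun a _ => (integrable_norm_sq_L2 _).congr (h a)

lemma integrable_kernel_prod (hg : Measurable (Function.uncurry g)) (hC : ∀ x y, ‖g x y‖ ≤ C)
    (hM : HasL2Entries X M) :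
    Integrable (fun p : ℝ × ℝ => ‖g p.1 p.2‖ ^ 2 * frobSq M p.2)
      ((perMeasure X).prod (perMeasure X)) := by
  have h1 : Integrable (fun p : ℝ × ℝ => (1 : ℝ) * frobSq M p.2)
      ((perMeasure X).prod (perMeasure X)) := (integrable_const 1).mul_prod hM.integrable_frobSq
  simp only [one_mul] at h1
  refine h1.bdd_mul (c := C ^ 2) ?_ (Eventually.of_forall fun p => ?_)
  · exact (hg.norm.pow_const 2).aestronglyMeasurable
  · have := hC p.1 p.2
    rw [norm_pow, norm_norm]
    gcongr

/-- The squared Hilbert-Schmidt norm of the operator with kernel `g(x,y) M(y)`. -/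
def kernelSq (X : ℝ) (g : ℝ → ℝ → ℂ) (M : ℝ → Matrix m m ℂ) : ℝ :=
  ∫ x, ∫ y, ‖g x y‖ ^ 2 * frobSq M y ∂perMeasure X ∂perMeasure X

lemma kernelSq_nonneg : 0 ≤ kernelSq X g M :=
  integral_nonneg fun x => integral_nonneg fun y => by
    have := frobSq_nonneg M y
    positivity

lemma aestronglyMeasurable_kernel_integral (hg : Measurable (Function.uncurry g)) {F : ℝ → ℂ}
    (hF : AEStronglyMeasurable F (perMeasure X)) :
    AEStronglyMeasurable (fun x => ∫ y, g x y * F y ∂perMeasure X) (perMeasure X) := by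
  have : AEStronglyMeasurable (fun p : ℝ × ℝ => g p.1 p.2 * F p.2)
      ((perMeasure X).prod (perMeasure X)) :=
    hg.aestronglyMeasurable.mul hF.comp_snd
  exact this.integral_prod_right'

lemma memLp_kernel_integral (hg : Measurable (Function.uncurry g)) (hC : ∀ x y, ‖g x y‖ ≤ C)
    (hM : HasL2Entries X M) (f : L2 X m) :
    MemLp (fun x => WithLp.toLp 2 fun a => ∫ y, g x y * (M y *ᵥ (f y).ofLp) a ∂perMeasure X :
      ℝ → EuclideanSpace ℂ m) 2 (perMeasure X) := by
  refine MemLp.of_eval_piLp fun a => ?_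
  refine MemLp.of_bound (aestronglyMeasurable_kernel_integral hg (hM.integrable_mulVec f a).1)
    (∫ y, C * ‖(M y *ᵥ (f y).ofLp) a‖ ∂perMeasure X) (Eventually.of_forall fun x => ?_)
  refine norm_integral_le_of_norm_le ((hM.integrable_mulVec f a).norm.const_mul C)
    (Eventually.of_forall fun y => ?_)
  rw [norm_mul]
  exact mul_le_mul_of_nonneg_right (hC x y) (norm_nonneg _)

/-- The components of the operator at `x` are inner products with the kernel rows. Bessel's
inequality holds for almost every `x`, and integrating it in `x` bounds the Hilbert-Schmidt norm by
the `L²` norm of the kernel. -/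
lemma exists_kernelOp_of_bounded (hg : Measurable (Function.uncurry g)) (hC : ∀ x y, ‖g x y‖ ≤ C)
    (hM : HasL2Entries X M) :
    ∃ T : L2 X m →L[ℂ] L2 X m, HSBound T √(kernelSq X g M) ∧ ∀ f, ∀ᵐ x ∂perMeasure X, ∀ a,
      (T f x) a = ∫ y, g x y * (M y *ᵥ (f y).ofLp) a ∂perMeasure X := by
  let T₀ : L2 X m → L2 X m := fun f => (memLp_kernel_integral hg hC hM f).toLp _
  have hT₀ : ∀ f, ∀ᵐ x ∂perMeasure X, ∀ a,
      (T₀ f x) a = inner ℂ (kernelRow hg hC hM x a) f := by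
    intro f
    filter_upwards [(memLp_kernel_integral hg hC hM f).coeFn_toLp] with x hx a
    rw [hx, inner_kernelRow]
  have hnorm : ∀ f, (fun x => ‖T₀ f x‖ ^ 2) =ᵐ[perMeasure X]
      fun x => ∑ a, ‖inner ℂ (kernelRow hg hC hM x a) f‖ ^ 2 := by
    intro f
    filter_upwards [hT₀ f] with x hx
    rw [EuclideanSpace.norm_sq_eq]
    simp only [hx]
  have hint : Integrable (fun x => ∑ a, ‖kernelRow hg hC hM x a‖ ^ 2) (perMeasure X) := by
    simp only [sum_norm_sq_kernelRow]
    exact (integrable_kernel_prod hg hC hM).integral_prod_left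
  have hkey : ∀ (ι : Type) [Fintype ι] (b : ι → L2 X m), Orthonormal ℂ b →
      ∑ i, ‖T₀ (b i)‖ ^ 2 ≤ kernelSq X g M := by
    intro ι _ b hb
    simp only [norm_sq_L2]
    rw [← integral_finsetSum _ fun i _ => integrable_norm_sq_L2 _]
    unfold kernelSq
    simp only [← sum_norm_sq_kernelRow hg hC hM]
    refine integral_mono_ae (integrable_finsetSum _ fun i _ => integrable_norm_sq_L2 _) hint ?_
    filter_upwards [ae_all_iff.2 fun i => hnorm (b i)] with x hx
    simp only [hx]
    rw [Finset.sum_comm]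
    refine Finset.sum_le_sum fun a _ => ?_
    simp only [norm_inner_symm (kernelRow hg hC hM x a)]
    exact hb.sum_inner_products_le (s := Finset.univ) _
  let T₁ : L2 X m →ₗ[ℂ] L2 X m :=
    { toFun := T₀
      map_add' := fun f f' => by
        apply Lp.ext
        filter_upwards [hT₀ f, hT₀ f', hT₀ (f + f'), Lp.coeFn_add (T₀ f) (T₀ f')] with x h1 h2 h3 h4
        ext a
        rw [h3, h4, Pi.add_apply, PiLp.add_apply, h1, h2, inner_add_right]
      map_smul' := fun c f => by
        apply Lp.ext
        filter_upwards [hT₀ f, hT₀ (c • f), Lp.coeFn_smul c (T₀ f)] with x h1 h3 h4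
        ext a
        rw [h3, RingHom.id_apply, h4, Pi.smul_apply, PiLp.smul_apply, h1, inner_smul_right,
          smul_eq_mul] }
  have hbd : ∀ f, ‖T₁ f‖ ≤ √(kernelSq X g M) * ‖f‖ := by
    intro f
    rcases eq_or_ne f 0 with rfl | hf
    · simp
    have hf' : ‖f‖ ≠ 0 := norm_ne_zero_iff.2 hf
    have h := hkey Unit (fun _ => ((‖f‖⁻¹ : ℝ) : ℂ) • f)
      ⟨fun _ => by simp [norm_smul, hf'], fun i j hij => (hij rfl).elim⟩
    have h1 : T₀ (((‖f‖⁻¹ : ℝ) : ℂ) • f) = ((‖f‖⁻¹ : ℝ) : ℂ) • T₁ f := T₁.map_smul _ _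
    simp only [Finset.univ_unique, Finset.sum_const, Finset.card_singleton, one_smul, h1,
      norm_smul] at h
    have h2 := Real.le_sqrt_of_sq_le h
    rwa [Complex.norm_real, norm_inv, norm_norm, inv_mul_le_iff₀ (by positivity), mul_comm] at h2
  refine ⟨T₁.mkContinuous _ hbd, ⟨Real.sqrt_nonneg _, fun ι _ b hb => ?_⟩, fun f => ?_⟩
  · rw [Real.sq_sqrt kernelSq_nonneg]
    exact hkey ι b hb
  · filter_upwards [hT₀ f] with x hx a
    rw [← inner_kernelRow hg hC hM]
    exact hx a

/-- The integral operator with kernel `g(x,y) M(y)`, where `g` is bounded on the period square and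
`M` is square integrable, is a Hilbert-Schmidt operator on `L²`. -/
theorem exists_kernelOp (hg : Measurable (Function.uncurry g))
    (hC : ∀ x ∈ Ioc 0 X, ∀ y ∈ Ioc 0 X, ‖g x y‖ ≤ C) (hM : HasL2Entries X M) :
    ∃ T : L2 X m →L[ℂ] L2 X m, HSBound T √(kernelSq X g M) ∧ ∀ f, ∀ᵐ x ∂perMeasure X, ∀ a,
      (T f x) a = ∫ y, g x y * (M y *ᵥ (f y).ofLp) a ∂perMeasure X := by
  classical
  let S : Set (ℝ × ℝ) := Ioc 0 X ×ˢ Ioc 0 X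
  have hS : MeasurableSet S := measurableSet_Ioc.prod measurableSet_Ioc
  -- The bound on `g` is available only on the period square, so the kernel is cut off outside it;
  -- the integrals do not see the change.
  let g' : ℝ → ℝ → ℂ := fun x y => S.indicator (Function.uncurry g) (x, y)
  have hg' : Measurable (Function.uncurry g') := hg.indicator hS
  have hC' : ∀ x y, ‖g' x y‖ ≤ max C 0 := by
    intro x y
    by_cases h : (x, y) ∈ S
    · simp only [g', Set.indicator_of_mem h]
      exact (hC x h.1 y h.2).trans (le_max_left _ _)
    · simp [g', Set.indicator_of_notMem h]
  have heq : ∀ x ∈ Ioc 0 X, ∀ y ∈ Ioc 0 X, g' x y = g x y := fun x hx y hy =>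
    Set.indicator_of_mem (s := S) (a := (x, y)) ⟨hx, hy⟩ _
  obtain ⟨T, hT, hTf⟩ := exists_kernelOp_of_bounded hg' hC' hM
  refine ⟨T, ?_, fun f => ?_⟩
  · convert hT using 2
    refine (setIntegral_congr_fun measurableSet_Ioc fun x hx => ?_).symm
    exact setIntegral_congr_fun measurableSet_Ioc fun y hy => by simp only [heq x hx y hy]
  · filter_upwards [hTf f, ae_restrict_mem measurableSet_Ioc] with x hx hxm a
    rw [hx a]
    exact setIntegral_congr_fun measurableSet_Ioc fun y hy => by simp only [heq x hxm y hy]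

end KernelOperators

/-! ### Integration by parts and Duhamel's formula for integrable data. -/

section ByParts

lemma setIntegral_ite_lt {x s : ℝ} (hs : s ≤ x) (h : ℝ → ℂ) :
    ∫ y in Ioc 0 x, (if y < s then h y else 0) = ∫ y in Ioc 0 s, h y := by
  have h1 : (fun y => if y < s then h y else 0) = (Iio s).indicator h := by
    ext y; simp [Set.indicator_apply]
  have h2 : Ioc 0 x ∩ Iio s = Ioo 0 s := by
    ext y; simp only [mem_inter_iff, mem_Ioc, mem_Iio, mem_Ioo]
    constructor
    · rintro ⟨⟨a, b⟩, c⟩; exact ⟨a, c⟩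
    · rintro ⟨a, c⟩; exact ⟨⟨a, (c.trans_le hs).le⟩, c⟩
  rw [h1, setIntegral_indicator measurableSet_Iio, h2, integral_Ioc_eq_integral_Ioo]

lemma setIntegral_ite_gt {x y : ℝ} (hy : 0 ≤ y) (hyx : y ≤ x) (h : ℝ → ℂ) :
    ∫ s in Ioc 0 x, (if y < s then h s else 0) = ∫ s in y..x, h s := by
  have h1 : (fun s => if y < s then h s else 0) = (Ioi y).indicator h := by
    ext y; simp [Set.indicator_apply]
  have h2 : Ioc 0 x ∩ Ioi y = Ioc y x := by
    ext s; simp only [mem_inter_iff, mem_Ioc, mem_Ioi]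
    constructor
    · rintro ⟨⟨a, b⟩, c⟩; exact ⟨c, b⟩
    · rintro ⟨a, c⟩; exact ⟨⟨hy.trans_lt a, c⟩, a⟩
  rw [h1, setIntegral_indicator measurableSet_Ioi, h2, intervalIntegral.integral_of_le hyx]

lemma measurableSet_lt_prod : MeasurableSet {p : ℝ × ℝ | p.2 < p.1} :=
  measurableSet_lt measurable_snd measurable_fst

/-- Integration by parts for a primitive of an integrable function. -/
lemma integral_deriv_mul_primitive {x : ℝ} (hx : 0 ≤ x) {φ φ' f : ℝ → ℂ}
    (hφ : ∀ s, HasDerivAt φ (φ' s) s) (hφ' : Continuous φ')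
    (hf : IntegrableOn f (Ioc 0 x)) (c : ℂ) :
    (∫ s in (0)..x, φ' s * (c + ∫ y in (0)..s, f y)) + ∫ s in (0)..x, φ s * f s =
      φ x * (c + ∫ y in (0)..x, f y) - φ 0 * c := by
  have hint : ∀ a b, ∫ s in a..b, φ' s = φ b - φ a := fun a b =>
    intervalIntegral.integral_eq_sub_of_hasDerivAt (fun s _ => hφ s) (hφ'.intervalIntegrable _ _)
  have hφc : Continuous φ := continuous_iff_continuousAt.2 fun s => (hφ s).continuousAt
  have hφi : IntegrableOn φ' (Ioc 0 x) := hφ'.integrableOn_Ioc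
  -- Since `f` is only integrable, the primitive need not be differentiable everywhere; Fubini on
  -- the triangle `y < s` replaces the product rule.
  have hfub : ∫ s in Ioc 0 x, ∫ y in Ioc 0 x, (if y < s then φ' s * f y else 0) =
      ∫ y in Ioc 0 x, ∫ s in Ioc 0 x, (if y < s then φ' s * f y else 0) := by
    refine integral_integral_swap (f := fun s y => if y < s then φ' s * f y else 0) ?_
    have h1 : Integrable (fun p : ℝ × ℝ => φ' p.1 * f p.2)
        ((volume.restrict (Ioc 0 x)).prod (volume.restrict (Ioc 0 x))) := Integrable.mul_prod hφi hf
    refine (h1.indicator measurableSet_lt_prod).congr (Eventually.of_forall fun p => ?_)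
    simp [Set.indicator_apply, Function.uncurry]
  have hL : ∫ s in Ioc 0 x, ∫ y in Ioc 0 x, (if y < s then φ' s * f y else 0) =
      ∫ s in (0)..x, φ' s * ∫ y in (0)..s, f y := by
    rw [intervalIntegral.integral_of_le hx]
    refine setIntegral_congr_fun measurableSet_Ioc fun s hs => ?_
    have h1 : ∀ y, (if y < s then φ' s * f y else 0) = φ' s * (if y < s then f y else 0) :=
      fun y => by split_ifs <;> simp
    simp only [h1]
    rw [integral_const_mul, setIntegral_ite_lt hs.2, intervalIntegral.integral_of_le hs.1.le]
  have hR : ∫ y in Ioc 0 x, ∫ s in Ioc 0 x, (if y < s then φ' s * f y else 0) =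
      ∫ y in Ioc 0 x, (φ x * f y - φ y * f y) := by
    refine setIntegral_congr_fun measurableSet_Ioc fun y hy => ?_
    rw [setIntegral_ite_gt hy.1.le hy.2, intervalIntegral.integral_mul_const, hint]
    ring
  have hφf : IntegrableOn (fun y => φ y * f y) (Ioc 0 x) := by
    obtain ⟨C, hC⟩ := (isCompact_Icc (a := (0 : ℝ)) (b := x)).exists_bound_of_continuousOn
      hφc.continuousOn
    refine hf.bdd_mul (c := C) hφc.aestronglyMeasurable ?_
    filter_upwards [ae_restrict_mem measurableSet_Ioc] with y hy using hC y (Ioc_subset_Icc_self hy)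
  have hprim : IntervalIntegrable (fun s => φ' s * ∫ y in (0)..s, f y) volume 0 x := by
    rw [intervalIntegrable_iff_integrableOn_Icc_of_le hx]
    refine ContinuousOn.integrableOn_Icc (hφ'.continuousOn.mul ?_)
    have := intervalIntegral.continuousOn_primitive_interval (μ := volume) (f := f) (a := 0) (b := x)
      (by rw [uIcc_of_le hx, integrableOn_Icc_iff_integrableOn_Ioc]; exact hf)
    rwa [uIcc_of_le hx] at this
  have e1 : ∫ s in (0)..x, φ' s * (c + ∫ y in (0)..s, f y) =
      (φ x - φ 0) * c + ∫ s in (0)..x, φ' s * ∫ y in (0)..s, f y := by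
    simp only [mul_add]
    rw [intervalIntegral.integral_add (show IntervalIntegrable (fun s => φ' s * c) volume 0 x from
      (hφ'.mul continuous_const).intervalIntegrable _ _) hprim,
      intervalIntegral.integral_mul_const, hint]
  rw [e1, ← hL, hfub, hR, integral_sub (hf.const_mul _) hφf, integral_const_mul,
    intervalIntegral.integral_of_le hx, intervalIntegral.integral_of_le hx]
  ring

lemma hasDerivAt_cexp_mul (σ x : ℝ) :
    HasDerivAt (fun s : ℝ => Complex.exp ((σ * s : ℝ) : ℂ)) (σ * Complex.exp ((σ * x : ℝ) : ℂ)) x := by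
  have h1 : HasDerivAt (fun s : ℝ => ((σ * s : ℝ) : ℂ)) (σ : ℂ) x := by
    have := ((hasDerivAt_id x).const_mul σ).ofReal_comp
    simpa using this
  have := h1.cexp
  rwa [mul_comm] at this

lemma continuous_cexp_mul (σ : ℝ) : Continuous fun s : ℝ => Complex.exp ((σ * s : ℝ) : ℂ) := by
  fun_prop

lemma integrableOn_cexp_mul {σ x : ℝ} {F : ℝ → ℂ} (hF : IntegrableOn F (Ioc 0 x)) :
    IntegrableOn (fun y => Complex.exp ((σ * y : ℝ) : ℂ) * F y) (Ioc 0 x) := by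
  obtain ⟨C, hC⟩ := (isCompact_Icc (a := (0 : ℝ)) (b := x)).exists_bound_of_continuousOn
    (continuous_cexp_mul σ).continuousOn
  refine hF.bdd_mul (c := C) (continuous_cexp_mul σ).aestronglyMeasurable ?_
  filter_upwards [ae_restrict_mem measurableSet_Ioc] with y hy using hC y (Ioc_subset_Icc_self hy)

lemma cexp_mul_cexp_neg (σ y : ℝ) (z : ℂ) :
    Complex.exp ((σ * y : ℝ) : ℂ) * (Complex.exp ((-σ * y : ℝ) : ℂ) * z) = z := by
  rw [← mul_assoc, ← Complex.exp_add]
  simp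

/-- The periodic solution of `w' = σ w + F` satisfies the equation weakly. -/
lemma weak_eq_of_duhamel {X σ : ℝ} (hX : 0 ≤ X) {F w : ℝ → ℂ} {c : ℂ}
    (hF : IntegrableOn F (Ioc 0 X))
    (hw : ∀ x ∈ Icc 0 X, w x = Complex.exp ((σ * x : ℝ) : ℂ) *
      (c + ∫ y in (0)..x, Complex.exp ((-σ * y : ℝ) : ℂ) * F y))
    (hper : w X = w 0) {ψ : ℝ → ℂ} (hψ : IsPeriodicTest X ψ) :
    ∫ x in (0)..X, (-deriv ψ x - σ * ψ x) * w x = ∫ x in (0)..X, ψ x * F x := by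
  have hd : ∀ s, HasDerivAt ψ (deriv ψ s) s := fun s =>
    ((hψ.1.differentiable (by simp)) s).hasDerivAt
  have hdc : Continuous (deriv ψ) := hψ.1.continuous_deriv (by simp)
  have hc : Continuous ψ := hψ.1.continuous
  -- The weight `ψ e^{σs}` turns the primitive of `e^{-σy} F` into `w`. The boundary terms then
  -- cancel because `ψ` and `w` take equal values at `0` and `X`.
  have key := integral_deriv_mul_primitive hX
    (φ := fun s => ψ s * Complex.exp ((σ * s : ℝ) : ℂ))
    (φ' := fun s => deriv ψ s * Complex.exp ((σ * s : ℝ) : ℂ) +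
      ψ s * (σ * Complex.exp ((σ * s : ℝ) : ℂ)))
    (fun s => (hd s).mul (hasDerivAt_cexp_mul σ s)) (by fun_prop)
    (integrableOn_cexp_mul (σ := -σ) hF) c
  have e1 : ∫ s in (0)..X, (deriv ψ s * Complex.exp ((σ * s : ℝ) : ℂ) +
      ψ s * (σ * Complex.exp ((σ * s : ℝ) : ℂ))) *
        (c + ∫ y in (0)..s, Complex.exp ((-σ * y : ℝ) : ℂ) * F y) =
      -∫ x in (0)..X, (-deriv ψ x - σ * ψ x) * w x := by
    rw [← intervalIntegral.integral_neg]
    refine intervalIntegral.integral_congr fun s hs => ?_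
    rw [uIcc_of_le hX] at hs
    simp only [hw s hs]
    ring
  have e2 : ∫ s in (0)..X, ψ s * Complex.exp ((σ * s : ℝ) : ℂ) *
      (Complex.exp ((-σ * s : ℝ) : ℂ) * F s) = ∫ x in (0)..X, ψ x * F x := by
    refine intervalIntegral.integral_congr fun s _ => ?_
    simp only [mul_assoc, cexp_mul_cexp_neg]
  have h0 := hw 0 ⟨le_rfl, hX⟩
  have hX' := hw X ⟨hX, le_rfl⟩
  simp only [mul_zero, Complex.ofReal_zero, Complex.exp_zero, one_mul,
    intervalIntegral.integral_same, add_zero] at h0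
  have hψ0 : ψ X = ψ 0 := by simpa using hψ.2 0
  rw [e1, e2, mul_assoc, ← hX', hper, h0, hψ0] at key
  simp only [mul_zero, Complex.ofReal_zero, Complex.exp_zero, mul_one, sub_self] at key
  linear_combination -key

/-- A solution of the Duhamel equation for `w' = w + F` solves the integrated equation. -/
lemma integral_eq_of_duhamel {X : ℝ} {F w : ℝ → ℂ} {c : ℂ} (hF : IntegrableOn F (Ioc 0 X))
    (hw : ∀ x ∈ Icc 0 X, w x = Complex.exp (((1 : ℝ) * x : ℝ) : ℂ) *
      (c + ∫ y in (0)..x, Complex.exp ((-(1 : ℝ) * y : ℝ) : ℂ) * F y))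
    {x : ℝ} (hx : x ∈ Icc 0 X) :
    w x = c + ((∫ y in (0)..x, w y) + ∫ y in (0)..x, F y) := by
  have hF' : IntegrableOn F (Ioc 0 x) := hF.mono_set (Ioc_subset_Ioc_right hx.2)
  have key := integral_deriv_mul_primitive hx.1
    (fun s => hasDerivAt_cexp_mul 1 s) (by fun_prop) (integrableOn_cexp_mul (σ := -1) hF') c
  have e1 : ∫ s in (0)..x, ((1 : ℝ) : ℂ) * Complex.exp (((1 : ℝ) * s : ℝ) : ℂ) *
        (c + ∫ y in (0)..s, Complex.exp ((-(1 : ℝ) * y : ℝ) : ℂ) * F y) = ∫ y in (0)..x, w y := by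
    refine intervalIntegral.integral_congr fun s hs => ?_
    rw [uIcc_of_le hx.1] at hs
    simp only [hw s ⟨hs.1, hs.2.trans hx.2⟩]
    simp
  simp only [cexp_mul_cexp_neg] at key
  rw [e1, ← hw x hx] at key
  simp only [mul_zero, Complex.ofReal_zero, Complex.exp_zero, one_mul] at key
  linear_combination -key

/-- A solution of the integrated equation solves the Duhamel equation. -/
lemma duhamel_of_integral_eq {X : ℝ} {F w : ℝ → ℂ} {c : ℂ} (hF : IntegrableOn F (Ioc 0 X))
    (hwi : IntegrableOn w (Ioc 0 X))
    (hw : ∀ x ∈ Icc 0 X, w x = c + ∫ y in (0)..x, (w y + F y))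
    {x : ℝ} (hx : x ∈ Icc 0 X) :
    w x = Complex.exp (((1 : ℝ) * x : ℝ) : ℂ) *
      (c + ∫ y in (0)..x, Complex.exp ((-(1 : ℝ) * y : ℝ) : ℂ) * F y) := by
  have hF' : IntegrableOn F (Ioc 0 x) := hF.mono_set (Ioc_subset_Ioc_right hx.2)
  have hw' : IntegrableOn w (Ioc 0 x) := hwi.mono_set (Ioc_subset_Ioc_right hx.2)
  have hE := integrableOn_cexp_mul (σ := -1) hF'
  have hE2 := integrableOn_cexp_mul (σ := -1) hw'
  have key := integral_deriv_mul_primitive hx.1 (f := fun y => w y + F y)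
    (fun s => hasDerivAt_cexp_mul (-1) s) (by fun_prop) (hw'.add hF') c
  have e1 : ∫ s in (0)..x, ((-1 : ℝ) : ℂ) * Complex.exp (((-1 : ℝ) * s : ℝ) : ℂ) *
        (c + ∫ y in (0)..s, (w y + F y)) =
      -∫ y in (0)..x, Complex.exp ((-(1 : ℝ) * y : ℝ) : ℂ) * w y := by
    rw [← intervalIntegral.integral_neg]
    refine intervalIntegral.integral_congr fun s hs => ?_
    rw [uIcc_of_le hx.1] at hs
    simp only [← hw s ⟨hs.1, hs.2.trans hx.2⟩]
    simp
  simp only [mul_add] at key e1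
  rw [e1, intervalIntegral.integral_add, ← mul_add, ← hw x hx] at key
  · simp only [mul_zero, Complex.ofReal_zero, Complex.exp_zero, one_mul] at key
    have h2 : c + ∫ y in (0)..x, Complex.exp ((-(1 : ℝ) * y : ℝ) : ℂ) * F y =
        Complex.exp (((-1 : ℝ) * x : ℝ) : ℂ) * w x := by linear_combination key
    rw [h2, cexp_mul_cexp_neg]
  · exact (intervalIntegrable_iff_integrableOn_Ioc_of_le hx.1).2 hE2
  · exact (intervalIntegrable_iff_integrableOn_Ioc_of_le hx.1).2 hE

end ByParts

/-! ### Periodic Green operators of first order. -/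

section Green

variable {X : ℝ} {m : Type} [Fintype m] {M : ℝ → Matrix m m ℂ}

/-- The kernel of the inverse of `∂ₓ - σ` with periodic boundary conditions. -/
def greenKernel (X σ : ℝ) (x y : ℝ) : ℂ :=
  Complex.exp ((σ * x : ℝ) : ℂ) * ((if y < x then Complex.exp ((-σ * y : ℝ) : ℂ) else 0) +
    Complex.exp ((σ * X : ℝ) : ℂ) / (1 - Complex.exp ((σ * X : ℝ) : ℂ)) *
      Complex.exp ((-σ * y : ℝ) : ℂ))

lemma measurable_greenKernel (σ : ℝ) : Measurable (Function.uncurry (greenKernel X σ)) := by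
  unfold greenKernel Function.uncurry
  refine Measurable.mul (by fun_prop) (Measurable.add (Measurable.ite ?_ (by fun_prop)
    (by fun_prop)) (by fun_prop))
  exact measurableSet_lt_prod

lemma norm_cexp_mul_le {σ x : ℝ} (hx : x ∈ Ioc 0 X) :
    ‖Complex.exp ((σ * x : ℝ) : ℂ)‖ ≤ Real.exp (|σ| * X) := by
  rw [Complex.norm_exp, Complex.ofReal_re, Real.exp_le_exp]
  calc σ * x ≤ |σ| * |x| := by rw [← abs_mul]; exact le_abs_self _
    _ ≤ |σ| * X := by rw [abs_of_pos hx.1]; gcongr; exact hx.2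

lemma exists_bound_greenKernel (X σ : ℝ) :
    ∃ C, ∀ x ∈ Ioc 0 X, ∀ y ∈ Ioc 0 X, ‖greenKernel X σ x y‖ ≤ C := by
  refine ⟨Real.exp (|σ| * X) * (Real.exp (|σ| * X) +
    ‖Complex.exp ((σ * X : ℝ) : ℂ) / (1 - Complex.exp ((σ * X : ℝ) : ℂ))‖ *
      Real.exp (|σ| * X)), fun x hx y hy => ?_⟩
  have hy' := norm_cexp_mul_le (σ := -σ) hy
  rw [abs_neg] at hy'
  rw [greenKernel, norm_mul]
  gcongr
  · exact norm_cexp_mul_le hx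
  · refine (norm_add_le _ _).trans (add_le_add ?_ ?_)
    · split_ifs
      · exact hy'
      · simpa using (Real.exp_pos _).le
    · rw [norm_mul]
      gcongr

lemma one_sub_cexp_ne_zero {t : ℝ} (ht : t ≠ 0) : 1 - Complex.exp (t : ℂ) ≠ 0 := by
  rw [sub_ne_zero, ← Complex.ofReal_exp, ne_comm]
  norm_cast
  rwa [Real.exp_eq_one_iff]

lemma integral_greenKernel (hX : 0 ≤ X) (σ : ℝ) {F : ℝ → ℂ} (hF : IntegrableOn F (Ioc 0 X)) {x : ℝ}
    (hx : x ∈ Icc 0 X) :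
    ∫ y in Ioc 0 X, greenKernel X σ x y * F y = Complex.exp ((σ * x : ℝ) : ℂ) *
      (Complex.exp ((σ * X : ℝ) : ℂ) / (1 - Complex.exp ((σ * X : ℝ) : ℂ)) *
        (∫ y in (0)..X, Complex.exp ((-σ * y : ℝ) : ℂ) * F y) +
        ∫ y in (0)..x, Complex.exp ((-σ * y : ℝ) : ℂ) * F y) := by
  have hE := integrableOn_cexp_mul (σ := -σ) hF
  have h1 : ∀ y, greenKernel X σ x y * F y = Complex.exp ((σ * x : ℝ) : ℂ) *
      ((if y < x then Complex.exp ((-σ * y : ℝ) : ℂ) * F y else 0) +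
      Complex.exp ((σ * X : ℝ) : ℂ) / (1 - Complex.exp ((σ * X : ℝ) : ℂ)) *
      (Complex.exp ((-σ * y : ℝ) : ℂ) * F y)) := by
    intro y; unfold greenKernel; split_ifs <;> ring
  have h2 : IntegrableOn (fun y => if y < x then Complex.exp ((-σ * y : ℝ) : ℂ) * F y else 0)
      (Ioc 0 X) := by
    refine (Integrable.indicator hE (measurableSet_Iio (a := x))).congr
      (Eventually.of_forall fun y => ?_)
    simp [Set.indicator_apply]
  simp only [h1]
  rw [integral_const_mul, integral_add h2 (hE.const_mul _), integral_const_mul,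
    setIntegral_ite_lt hx.2, intervalIntegral.integral_of_le hX, intervalIntegral.integral_of_le hx.1]
  ring

/-- The operator `(∂ₓ - σ)⁻¹ M` with periodic boundary conditions. -/
theorem exists_greenOp (hX : 0 < X) {σ : ℝ} (hσ : σ ≠ 0) (hM : HasL2Entries X M) :
    ∃ T : L2 X m →L[ℂ] L2 X m, (∃ C, HSBound T C) ∧
      (∀ f, ∀ᵐ x ∂perMeasure X, ∀ a,
        (T f x) a = ∫ y, greenKernel X σ x y * (M y *ᵥ (f y).ofLp) a ∂perMeasure X) ∧
      ∀ (f : L2 X m) (ψ : ℝ → ℂ), IsPeriodicTest X ψ → ∀ a,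
        ∫ x in (0)..X, (-deriv ψ x - σ * ψ x) * (T f x) a =
          ∫ x in (0)..X, ψ x * (M x *ᵥ (f x).ofLp) a := by
  obtain ⟨C, hC⟩ := exists_bound_greenKernel X σ
  obtain ⟨T, hT, hTf⟩ := exists_kernelOp (measurable_greenKernel σ) hC hM
  refine ⟨T, ⟨_, hT⟩, hTf, fun f ψ hψ a => ?_⟩
  have hF := hM.integrable_mulVec f a
  let w : ℝ → ℂ := fun x => ∫ y, greenKernel X σ x y * (M y *ᵥ (f y).ofLp) a ∂perMeasure X
  have hw := fun x hx => integral_greenKernel hX.le σ hF (x := x) hx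
  rw [← weak_eq_of_duhamel hX.le hF hw _ hψ]
  · rw [intervalIntegral.integral_of_le hX.le, intervalIntegral.integral_of_le hX.le]
    refine integral_congr_ae ?_
    filter_upwards [hTf f] with x hx
    rw [hx a]
  -- The coefficient `e^{σX} / (1 - e^{σX})` in `greenKernel` is the one forced by periodicity; `σ ≠
  -- 0` and `X > 0` make its denominator nonzero.
  · rw [hw X ⟨hX.le, le_rfl⟩, hw 0 ⟨le_rfl, hX.le⟩]
    have := one_sub_cexp_ne_zero (mul_ne_zero hσ hX.ne')
    simp only [mul_zero, Complex.ofReal_zero, Complex.exp_zero, one_mul,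
      intervalIntegral.integral_same, add_zero]
    field_simp
    ring

lemma integrableOn_mul_of_continuous {ψ F : ℝ → ℂ} (hψ : Continuous ψ)
    (hF : IntegrableOn F (Ioc 0 X)) : IntegrableOn (fun y => ψ y * F y) (Ioc 0 X) := by
  obtain ⟨C, hC⟩ := (isCompact_Icc (a := (0 : ℝ)) (b := X)).exists_bound_of_continuousOn
    hψ.continuousOn
  refine hF.bdd_mul (c := C) hψ.aestronglyMeasurable ?_
  filter_upwards [ae_restrict_mem measurableSet_Ioc] with y hy using hC y (Ioc_subset_Icc_self hy)

lemma integrable_coord (f : L2 X m) (a : m) : Integrable (fun y => f y a) (perMeasure X) :=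
  (memLp_coord f a).integrable (by norm_num)

end Green

/-! ### Existence of `𝕂` and `K` as Hilbert-Schmidt operators. -/

section Existence

variable {X : ℝ}

theorem exists_firstOrderOp {m : Type} [Fintype m] [DecidableEq m] (hX : 0 < X)
    {𝔸 : ℝ → Matrix m m ℂ} (hM : HasL2Entries X fun x => 𝔸 x - 1) :
    ∃ T : L2 X m →L[ℂ] L2 X m, IsFirstOrderOp X 𝔸 T ∧ (∃ C, HSBound T C) ∧
      ∀ f, ∀ᵐ x ∂perMeasure X, ∀ a,
        (T f x) a = ∫ y, greenKernel X 1 x y * ((𝔸 y - 1) *ᵥ (f y).ofLp) a ∂perMeasure X := by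
  obtain ⟨T, hT, hTf, hTw⟩ := exists_greenOp hX one_ne_zero hM
  refine ⟨T, fun W φ hφ i => ?_, hT, hTf⟩
  rw [← hTw W φ hφ i]
  simp

lemma IsPeriodicTest.deriv {φ : ℝ → ℂ} (hφ : IsPeriodicTest X φ) : IsPeriodicTest X (deriv φ) := by
  refine ⟨(contDiff_infty_iff_deriv.1 hφ.1).2, fun x => ?_⟩
  have h : (fun y => φ (y + X)) = φ := funext hφ.2
  rw [← deriv_comp_add_const, h]

/-- Partial fractions: with `Q = A₀ + 1 - λB₀`, `(∂² - 1)⁻¹(∂A₁ + Q)` is half of `(∂ - 1)⁻¹(A₁ + Q)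
+ (∂ + 1)⁻¹(A₁ - Q)`. This needs only first-order Green operators and no derivative of `A₁`. -/
theorem exists_birmanSchwingerOp {n : ℕ} (hX : 0 < X) {A₁ A₀ B₀ : ℝ → Matrix (Fin n) (Fin n) ℂ}
    {lam : ℂ} (hA₁ : HasL2Entries X A₁) (hC : HasL2Entries X fun x => A₀ x + 1 - lam • B₀ x) :
    ∃ T : L2 X (Fin n) →L[ℂ] L2 X (Fin n), IsBirmanSchwingerOp X A₁ A₀ B₀ lam T ∧
      ∃ C, HSBound T C := by
  set Q : ℝ → Matrix (Fin n) (Fin n) ℂ := fun x => A₀ x + 1 - lam • B₀ x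
  have hp : HasL2Entries X fun x => A₁ x + Q x := fun i j => (hA₁ i j).add (hC i j)
  have hm : HasL2Entries X fun x => A₁ x - Q x := fun i j => (hA₁ i j).sub (hC i j)
  obtain ⟨T, ⟨C, hT⟩, -, hTw⟩ := exists_greenOp hX one_ne_zero hp
  obtain ⟨S, ⟨D, hS⟩, -, hSw⟩ := exists_greenOp (σ := -1) hX (by norm_num) hm
  let K : L2 X (Fin n) →L[ℂ] L2 X (Fin n) := ((1 / 2 : ℂ) • ContinuousLinearMap.id ℂ _) ∘L (T + S)
  refine ⟨K, fun U φ hφ i => ?_,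
    ⟨_, (hT.add hS).comp_left _⟩⟩
  have hd := hφ.deriv
  have hd' := hd.deriv
  -- The test functions are the formal adjoints of `∂ + 1` and `∂ - 1` applied to `φ`; each supplies
  -- the factor missing from `∂² - 1`.
  have h1 := hTw U (fun x => φ x - deriv φ x)
    ⟨hφ.1.sub hd.1, fun x => by simp only [hφ.2 x, hd.2 x]⟩ i
  have h2 := hSw U (fun x => -φ x - deriv φ x)
    ⟨hφ.1.neg.sub hd.1, fun x => by simp only [hφ.2 x, hd.2 x]⟩ i
  have e1 : ∀ x, HasDerivAt φ (deriv φ x) x := fun s =>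
    ((hφ.1.differentiable (by simp)) s).hasDerivAt
  have e2 : ∀ x, HasDerivAt (deriv φ) (deriv (deriv φ) x) x := fun s =>
    ((hd.1.differentiable (by simp)) s).hasDerivAt
  have e3 : ∀ x, deriv (fun x => φ x - deriv φ x) x = deriv φ x - deriv (deriv φ) x :=
    fun x => ((e1 x).sub (e2 x)).deriv
  have e4 : ∀ x, deriv (fun x => -φ x - deriv φ x) x = -deriv φ x - deriv (deriv φ) x :=
    fun x => ((e1 x).neg.sub (e2 x)).deriv
  have c0 := hφ.1.continuous
  have c1 := hd.1.continuous
  have c2 := hd'.1.continuous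
  have hiA := hA₁.integrable_mulVec U i
  have hiQ := hC.integrable_mulVec U i
  have hiT := integrable_coord (T U) i
  have hiS := integrable_coord (S U) i
  rw [intervalIntegral.integral_of_le hX.le, intervalIntegral.integral_of_le hX.le] at h1 h2 ⊢
  have hL : ∫ x in Ioc 0 X, (deriv (deriv φ) x - φ x) *
      (K U x) i =
      ∫ x in Ioc 0 X, (1 / 2 : ℂ) *
        ((-deriv (fun x => φ x - deriv φ x) x - (1 : ℝ) * (φ x - deriv φ x)) * (T U x) i +
        (-deriv (fun x => -φ x - deriv φ x) x - (-1 : ℝ) * (-φ x - deriv φ x)) * (S U x) i) := by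
    refine integral_congr_ae ?_
    filter_upwards [Lp.coeFn_smul (1 / 2 : ℂ) ((T + S) U), Lp.coeFn_add (T U) (S U)] with x hx hx'
    have h3 : K U = (1 / 2 : ℂ) • (T + S) U := rfl
    have h4 : (T + S) U = T U + S U := rfl
    rw [h3, hx, Pi.smul_apply, h4, hx', e3, e4]
    simp only [Pi.add_apply, PiLp.smul_apply, PiLp.add_apply, smul_eq_mul]
    push_cast
    ring
  rw [hL, integral_const_mul, integral_add, h1, h2, ← integral_add, ← integral_const_mul]
  · refine integral_congr_ae (Eventually.of_forall fun x => ?_)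
    simp only [Matrix.add_mulVec, Matrix.sub_mulVec, Pi.add_apply, Pi.sub_apply, Q]
    ring
  · exact integrableOn_mul_of_continuous (by fun_prop) (hp.integrable_mulVec U i)
  · exact integrableOn_mul_of_continuous (by fun_prop) (hm.integrable_mulVec U i)
  · exact integrableOn_mul_of_continuous (by simp only [e3]; fun_prop) hiT
  · exact integrableOn_mul_of_continuous (by simp only [e4]; fun_prop) hiS

end Existence

/-! ### The Volterra part of `𝕂` has modified determinant one. -/

section Volterra

variable {X : ℝ} {m : Type} [Fintype m] {M : ℝ → Matrix m m ℂ}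

/-- Multiplication by a bounded continuous scalar function, as an operator on `L²`. -/
lemma exists_mulOp (h : ℝ → ℂ) (hh : Continuous h) :
    ∃ S : L2 X m →L[ℂ] L2 X m, ∀ f, ∀ᵐ x ∂perMeasure X, S f x = h x • f x := by
  obtain ⟨C, hC⟩ := (isCompact_Icc (a := (0 : ℝ)) (b := X)).exists_bound_of_continuousOn
    hh.continuousOn
  have hae : ∀ f : L2 X m, ∀ᵐ x ∂perMeasure X, ‖h x • f x‖ ≤ C * ‖f x‖ := by
    intro f
    filter_upwards [ae_restrict_mem measurableSet_Ioc] with x hx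
    rw [norm_smul]
    gcongr
    exact hC x (Ioc_subset_Icc_self hx)
  have hmem : ∀ f : L2 X m, MemLp (fun x => h x • f x) 2 (perMeasure X) := fun f =>
    (Lp.memLp f).of_le_mul (hh.aestronglyMeasurable.smul (Lp.memLp f).1) (hae f)
  let T : L2 X m →ₗ[ℂ] L2 X m :=
    { toFun := fun f => (hmem f).toLp _
      map_add' := fun f f' => by
        apply Lp.ext
        filter_upwards [(hmem f).coeFn_toLp, (hmem f').coeFn_toLp, (hmem (f + f')).coeFn_toLp,
          Lp.coeFn_add f f', Lp.coeFn_add ((hmem f).toLp _) ((hmem f').toLp _)]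
          with x h1 h2 h3 h4 h5
        rw [h3, h4, h5, Pi.add_apply, Pi.add_apply, h1, h2, smul_add]
      map_smul' := fun c f => by
        apply Lp.ext
        filter_upwards [(hmem f).coeFn_toLp, (hmem (c • f)).coeFn_toLp,
          Lp.coeFn_smul c f, Lp.coeFn_smul c ((hmem f).toLp _)] with x h1 h2 h3 h4
        rw [h2, h3, RingHom.id_apply, h4, Pi.smul_apply, Pi.smul_apply, h1, smul_comm] }
  refine ⟨T.mkContinuous C fun f => ?_, fun f => (hmem f).coeFn_toLp⟩
  refine Lp.norm_le_mul_norm_of_ae_le_mul ?_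
  filter_upwards [(hmem f).coeFn_toLp, hae f] with x h1 h2
  exact h1 ▸ h2

/-- The Volterra kernel of `(∂ₓ - 1)⁻¹` with zero initial value, conjugated by `e^{-τ x}`. -/
def volterraKernel (X τ x y : ℝ) : ℂ :=
  if 0 < y ∧ y < x ∧ x ≤ X then Complex.exp (((1 - τ) * (x - y) : ℝ) : ℂ) else 0

lemma measurable_volterraKernel (τ : ℝ) : Measurable (Function.uncurry (volterraKernel X τ)) := by
  unfold volterraKernel Function.uncurry
  refine Measurable.ite ?_ (by fun_prop) (by fun_prop)
  exact (measurableSet_lt measurable_const measurable_snd).inter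
    ((measurableSet_lt measurable_snd measurable_fst).inter
      (measurableSet_le measurable_fst measurable_const))

lemma norm_volterraKernel_le {τ : ℝ} (hτ : 0 ≤ τ) (x y : ℝ) :
    ‖volterraKernel X τ x y‖ ≤ Real.exp X := by
  unfold volterraKernel
  split_ifs with h
  · rw [Complex.norm_exp, Complex.ofReal_re, Real.exp_le_exp]
    nlinarith [h.1, h.2.1, h.2.2]
  · simpa using (Real.exp_pos _).le

lemma integral_volterraKernel (F : ℝ → ℂ) {x : ℝ} (hx : x ∈ Ioc 0 X) :
    ∫ y in Ioc 0 X, volterraKernel X 0 x y * F y = Complex.exp (((1 : ℝ) * x : ℝ) : ℂ) *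
      ∫ y in (0)..x, Complex.exp ((-(1 : ℝ) * y : ℝ) : ℂ) * F y := by
  rw [intervalIntegral.integral_of_le hx.1.le, ← setIntegral_ite_lt hx.2, ← integral_const_mul]
  refine setIntegral_congr_fun measurableSet_Ioc fun y hy => ?_
  simp only [volterraKernel, hy.1, hx.2, true_and, and_true]
  split_ifs
  · rw [← mul_assoc, ← Complex.exp_add]
    congr 2
    push_cast; ring
  · simp

/-- On the support `y < x`, so `e^{(1-k)(x-y)} → 0` pointwise; the bound `e^X`, uniform in `k`,
gives a majorant. -/
lemma tendsto_kernelSq_volterra (hM : HasL2Entries X M) :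
    Tendsto (fun k : ℕ => kernelSq X (volterraKernel X k) M) atTop (𝓝 0) := by
  have h1 : ∀ k : ℕ, kernelSq X (volterraKernel X k) M =
      ∫ p : ℝ × ℝ, ‖volterraKernel X k p.1 p.2‖ ^ 2 * frobSq M p.2
        ∂((perMeasure X).prod (perMeasure X)) := fun k =>
    (integral_prod _ (integrable_kernel_prod (measurable_volterraKernel k)
      (norm_volterraKernel_le k.cast_nonneg) hM)).symm
  simp only [h1]
  have h2 : (0 : ℝ) = ∫ _ : ℝ × ℝ, (0 : ℝ) ∂((perMeasure X).prod (perMeasure X)) := by simp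
  have h3 : Integrable (fun p : ℝ × ℝ => (1 : ℝ) * frobSq M p.2)
      ((perMeasure X).prod (perMeasure X)) := (integrable_const 1).mul_prod hM.integrable_frobSq
  rw [h2]
  refine tendsto_integral_of_dominated_convergence
    (fun p => Real.exp X ^ 2 * ((1 : ℝ) * frobSq M p.2))
    (fun k => (integrable_kernel_prod (measurable_volterraKernel k)
      (norm_volterraKernel_le k.cast_nonneg) hM).1) (h3.const_mul _)
    (fun k => Eventually.of_forall fun p => ?_) (Eventually.of_forall fun p => ?_)
  · have h4 := norm_volterraKernel_le (X := X) (τ := k) k.cast_nonneg p.1 p.2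
    have h5 := frobSq_nonneg M p.2
    rw [Real.norm_of_nonneg (by positivity), one_mul]
    gcongr
  · by_cases h : 0 < p.2 ∧ p.2 < p.1 ∧ p.1 ≤ X
    · have h4 : Tendsto (fun k : ℕ => ‖volterraKernel X k p.1 p.2‖) atTop (𝓝 0) := by
        simp only [volterraKernel, if_pos h, Complex.norm_exp, Complex.ofReal_re]
        refine Real.tendsto_exp_atBot.comp ?_
        refine Tendsto.atBot_mul_const (sub_pos.2 h.2.1) ?_
        exact tendsto_atBot_add_const_left _ 1 (tendsto_neg_atTop_atBot.comp
          tendsto_natCast_atTop_atTop)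
      simpa using (h4.pow 2).mul_const (frobSq M p.2)
    · simp [volterraKernel, if_neg h]

lemma hsBound_zero {H : Type} [NormedAddCommGroup H] [InnerProductSpace ℂ H] :
    HSBound (0 : H →L[ℂ] H) 0 := ⟨le_rfl, fun ι _ b _ => by simp⟩

lemma det2_zero {H : Type} [NormedAddCommGroup H] [InnerProductSpace ℂ H] [CompleteSpace H]
    {V : ℕ → Submodule ℂ H} [∀ J, FiniteDimensional ℂ (V J)] (hV : IsExhaustion V) :
    det2 (0 : H →L[ℂ] H) = 1 := by
  refine (hsBound_zero.hasDet2 hV).unique ⟨hsBound_zero.isHilbertSchmidt, fun W _ _ _ => ?_⟩ hV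
  have h : ∀ J, finDet2 (galerkin (0 : H →L[ℂ] H) (W J)) = 1 := by
    intro J
    have : galerkin (0 : H →L[ℂ] H) (W J) = 0 := by ext x; simp [galerkin_apply]
    rw [this, finDet2, sub_zero, LinearMap.det_id]
    simp
  simp only [h, tendsto_const_nhds]

/-- The operators with kernels `volterraKernel X k` are all similar, through multiplication by
`e^{-kx}`, while their Hilbert-Schmidt norms tend to zero. Similarity invariance and continuity of
`det2` at `0` give the value `1`; a Neumann series for one large `k` gives invertibility. -/
theorem exists_volterraOp {V : ℕ → Submodule ℂ (L2 X m)} [∀ J, FiniteDimensional ℂ (V J)]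
    (hV : IsExhaustion V) (hM : HasL2Entries X M) :
    ∃ T : L2 X m →L[ℂ] L2 X m, (∃ C, HSBound T C) ∧
      (∀ f, ∀ᵐ x ∂perMeasure X, ∀ a,
        (T f x) a = ∫ y, volterraKernel X 0 x y * (M y *ᵥ (f y).ofLp) a ∂perMeasure X) ∧
      det2 T = 1 ∧ IsUnit (1 - T) := by
  have hex := fun k : ℕ => exists_kernelOp_of_bounded (measurable_volterraKernel (X := X) k)
    (norm_volterraKernel_le k.cast_nonneg) hM
  choose T hT hTf using hex
  have hconj : ∀ k : ℕ, ∃ S S' : L2 X m →L[ℂ] L2 X m,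
      S' ∘L S = ContinuousLinearMap.id ℂ _ ∧ S ∘L S' = ContinuousLinearMap.id ℂ _ ∧
      S ∘L T 0 ∘L S' = T k := by
    intro k
    obtain ⟨S, hS⟩ := exists_mulOp (X := X) (m := m) _ (continuous_cexp_mul (-(k : ℝ)))
    obtain ⟨S', hS'⟩ := exists_mulOp (X := X) (m := m) _ (continuous_cexp_mul (k : ℝ))
    have hcancel : ∀ x : ℝ, Complex.exp (((k : ℝ) * x : ℝ) : ℂ) *
        Complex.exp ((-(k : ℝ) * x : ℝ) : ℂ) = 1 := fun x => by
      rw [← Complex.exp_add]; simp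
    refine ⟨S, S', ?_, ?_, ?_⟩
    · ext1 f
      apply Lp.ext
      filter_upwards [hS f, hS' (S f)] with x h1 h2
      rw [ContinuousLinearMap.comp_apply, h2, h1, smul_smul, hcancel, one_smul]
      rfl
    · ext1 f
      apply Lp.ext
      filter_upwards [hS' f, hS (S' f)] with x h1 h2
      rw [ContinuousLinearMap.comp_apply, h2, h1, smul_smul, mul_comm, hcancel, one_smul]
      rfl
    · ext1 f
      apply Lp.ext
      filter_upwards [hS (T 0 (S' f)), hTf 0 (S' f), hTf k f] with x h1 h2 h3
      ext a
      rw [ContinuousLinearMap.comp_apply, ContinuousLinearMap.comp_apply, h1, PiLp.smul_apply,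
        h2, h3, smul_eq_mul, ← integral_const_mul]
      refine integral_congr_ae ?_
      filter_upwards [hS' f] with y hy
      rw [hy, WithLp.ofLp_smul, Matrix.mulVec_smul, Pi.smul_apply, smul_eq_mul, ← mul_assoc,
        ← mul_assoc]
      congr 1
      simp only [volterraKernel]
      split_ifs
      · rw [← Complex.exp_add, ← Complex.exp_add]
        congr 1
        push_cast; ring
      · simp
  have hlim : Tendsto (fun k : ℕ => √(kernelSq X (volterraKernel X k) M)) atTop (𝓝 0) := by
    rw [← Real.sqrt_zero]
    exact (Real.continuous_sqrt.tendsto 0).comp (tendsto_kernelSq_volterra hM)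
  have hdet : ∀ k, det2 (T k) = det2 (T 0) := by
    intro k
    obtain ⟨S, S', h1, -, h3⟩ := hconj k
    rw [← h3, det2_conj hV (hT 0) S S' h1]
  refine ⟨T 0, ⟨_, hT 0⟩, by simpa using hTf 0, ?_, ?_⟩
  -- Once the norm is at most `1`, the Lipschitz constant can be fixed as `lipConst 1`, and the left
  -- side does not depend on `k`.
  · have h1 : ∀ᶠ k : ℕ in atTop, ‖det2 (T 0) - 1‖ ≤
        lipConst 1 * √(kernelSq X (volterraKernel X k) M) := by
      filter_upwards [hlim.eventually_le_const (zero_lt_one)] with k hk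
      have := norm_det2_sub_le hV ((hT k).mono hk) (hsBound_zero.mono zero_le_one)
        (by simpa using hT k)
      rwa [hdet, det2_zero hV] at this
    have h2 := ge_of_tendsto (hlim.const_mul (lipConst 1)) h1
    rw [mul_zero, norm_le_zero_iff, sub_eq_zero] at h2
    exact h2
  · obtain ⟨k, hk⟩ := (hlim.eventually_lt_const zero_lt_one).exists
    obtain ⟨S, S', h1, h2, h3⟩ := hconj k
    have hu : IsUnit (1 - T k) := isUnit_one_sub_of_norm_lt_one ((hT k).norm_le.trans_lt hk)
    let uS : (L2 X m →L[ℂ] L2 X m)ˣ := ⟨S, S', h2, h1⟩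
    have h4 : 1 - T 0 = (uS⁻¹ : (L2 X m →L[ℂ] L2 X m)ˣ) * (1 - T k) * uS := by
      have h5 : T k = uS * T 0 * (uS⁻¹ : (L2 X m →L[ℂ] L2 X m)ˣ) := by
        rw [← h3]; rfl
      rw [h5, mul_sub, sub_mul, mul_one, Units.inv_mul]
      simp only [mul_assoc, Units.inv_mul, mul_one, Units.inv_mul_cancel_left]
    rw [h4]
    exact (uS⁻¹.isUnit.mul hu).mul uS.isUnit

end Volterra

/-! ### The determinant of `I - 𝕂` in terms of the monodromy matrix. -/

section FundamentalSolution

variable {X : ℝ} {m : Type} [Fintype m]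

lemma exists_integralFunctional {M : ℝ → Matrix m m ℂ} (hM : HasL2Entries X M) {h : ℝ → ℂ}
    (hh : Continuous h) :
    ∃ l : L2 X m →L[ℂ] EuclideanSpace ℂ m, ∀ f a,
      (l f) a = ∫ y, h y * (M y *ᵥ (f y).ofLp) a ∂perMeasure X := by
  classical
  obtain ⟨C, hC⟩ := (isCompact_Icc (a := (0 : ℝ)) (b := X)).exists_bound_of_continuousOn
    hh.continuousOn
  -- A kernel that does not depend on `x`: its rows are the Riesz representatives of the components
  -- of the functional.
  let g : ℝ → ℝ → ℂ := fun _ y => (Ioc 0 X).indicator h y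
  have hg : Measurable (Function.uncurry g) :=
    (hh.measurable.indicator measurableSet_Ioc).comp measurable_snd
  have hgC : ∀ x y, ‖g x y‖ ≤ max C 0 := by
    intro x y
    by_cases hy : y ∈ Ioc 0 X
    · simp only [g, Set.indicator_of_mem hy]
      exact (hC y (Ioc_subset_Icc_self hy)).trans (le_max_left _ _)
    · simp [g, Set.indicator_of_notMem hy]
  refine ⟨(EuclideanSpace.equiv m ℂ).symm.toContinuousLinearMap ∘L
    ContinuousLinearMap.pi fun a => innerSL ℂ (kernelRow hg hgC hM 0 a), fun f a => ?_⟩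
  have h1 := inner_kernelRow hg hgC hM 0 a f
  refine Eq.trans h1 (setIntegral_congr_fun measurableSet_Ioc fun y hy => ?_)
  simp only [g, Set.indicator_of_mem hy]

lemma exists_scalarLift {h : ℝ → ℂ} (hh : Continuous h) :
    ∃ u : EuclideanSpace ℂ m →L[ℂ] L2 X m, ∀ c, ∀ᵐ x ∂perMeasure X, u c x = h x • c := by
  obtain ⟨S, hS⟩ := exists_mulOp (X := X) (m := m) h hh
  refine ⟨S ∘L Lp.constL 2 (perMeasure X) ℂ, fun c => ?_⟩
  filter_upwards [hS (Lp.const 2 (perMeasure X) c), Lp.coeFn_const (p := 2) (μ := perMeasure X) c]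
    with x h1 h2
  refine Eq.trans h1 ?_
  rw [h2]; rfl

lemma memLp_column {Φ : ℝ → Matrix m m ℂ} (hΦ : ContinuousOn Φ (Icc 0 X)) (b : m) :
    MemLp (fun y => WithLp.toLp 2 fun a => Φ y a b : ℝ → EuclideanSpace ℂ m) 2 (perMeasure X) := by
  refine MemLp.of_eval_piLp fun a => ?_
  have h1 : ContinuousOn (fun y => Φ y a b) (Icc 0 X) :=
    continuousOn_pi.1 (continuousOn_pi.1 hΦ a) b
  obtain ⟨C, hC⟩ := isCompact_Icc.exists_bound_of_continuousOn h1
  refine MemLp.of_bound ((h1.mono Ioc_subset_Icc_self).aestronglyMeasurable measurableSet_Ioc) C ?_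
  filter_upwards [ae_restrict_mem measurableSet_Ioc] with y hy using hC y (Ioc_subset_Icc_self hy)

variable [DecidableEq m] {𝔸 : ℝ → Matrix m m ℂ}

lemma mul_eq_add_sub_one_mul (A Φ : Matrix m m ℂ) (a b : m) :
    (A * Φ) a b = Φ a b + ((A - 1) * Φ) a b := by
  rw [sub_mul, one_mul, Matrix.sub_apply]; ring

/-- Fundamental solutions solve the Duhamel equation. -/
lemma IsFundamentalSolution.duhamel (hM : HasL2Entries X fun x => 𝔸 x - 1) {Φ : ℝ → Matrix m m ℂ}
    (hΦ : IsFundamentalSolution X 𝔸 Φ) (a b : m) :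
    IntegrableOn (fun y => ((𝔸 y - 1) * Φ y) a b) (Ioc 0 X) ∧ ∀ x ∈ Icc 0 X,
      Φ x a b = Complex.exp (((1 : ℝ) * x : ℝ) : ℂ) * ((1 : Matrix m m ℂ) a b +
        ∫ y in (0)..x, Complex.exp ((-(1 : ℝ) * y : ℝ) : ℂ) * ((𝔸 y - 1) * Φ y) a b) := by
  have hmem := memLp_column hΦ.1 b
  have hF : IntegrableOn (fun y => ((𝔸 y - 1) * Φ y) a b) (Ioc 0 X) := by
    refine (hM.integrable_mulVec (hmem.toLp _) a).congr ?_
    filter_upwards [hmem.coeFn_toLp] with y hy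
    rw [hy]
    rfl
  have hcont : ContinuousOn (fun y => Φ y a b) (Icc 0 X) :=
    continuousOn_pi.1 (continuousOn_pi.1 hΦ.1 a) b
  refine ⟨hF, fun x hx => duhamel_of_integral_eq hF
    (hcont.integrableOn_Icc.mono_set Ioc_subset_Icc_self) (fun x hx => ?_) hx⟩
  rw [hΦ.2 x hx a b]
  congr 1
  exact intervalIntegral.integral_congr fun y _ => mul_eq_add_sub_one_mul _ _ a b

/-- Solutions of the Duhamel equation are fundamental solutions. -/
lemma isFundamentalSolution_of_duhamel {Φ : ℝ → Matrix m m ℂ} {F : m → m → ℝ → ℂ}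
    (hF : ∀ a b, IntegrableOn (F a b) (Ioc 0 X))
    (hFΦ : ∀ a b, ∀ᵐ y ∂perMeasure X, F a b y = ((𝔸 y - 1) * Φ y) a b)
    (hΦ : ∀ x ∈ Icc 0 X, ∀ a b,
      Φ x a b = Complex.exp (((1 : ℝ) * x : ℝ) : ℂ) * ((1 : Matrix m m ℂ) a b +
        ∫ y in (0)..x, Complex.exp ((-(1 : ℝ) * y : ℝ) : ℂ) * F a b y)) :
    IsFundamentalSolution X 𝔸 Φ := by
  have hcont : ∀ a b, ContinuousOn (fun x => Φ x a b) (Icc 0 X) := by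
    intro a b
    rcases lt_or_ge X 0 with hX | hX
    · simp [Icc_eq_empty hX.not_ge]
    refine ContinuousOn.congr (f := fun x => Complex.exp (((1 : ℝ) * x : ℝ) : ℂ) *
      ((1 : Matrix m m ℂ) a b + ∫ y in (0)..x, Complex.exp ((-(1 : ℝ) * y : ℝ) : ℂ) * F a b y))
      ?_ fun x hx => hΦ x hx a b
    refine (continuous_cexp_mul 1).continuousOn.mul (continuousOn_const.add ?_)
    have := intervalIntegral.continuousOn_primitive_interval (μ := volume) (a := 0) (b := X)
      (f := fun y => Complex.exp ((-(1 : ℝ) * y : ℝ) : ℂ) * F a b y)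
      (by rw [uIcc_of_le hX, integrableOn_Icc_iff_integrableOn_Ioc]
          exact integrableOn_cexp_mul (σ := -1) (hF a b))
    rwa [uIcc_of_le hX] at this
  refine ⟨continuousOn_pi.2 fun a => continuousOn_pi.2 fun b => hcont a b, fun x hx a b => ?_⟩
  have hsub : Ioc 0 x ⊆ Ioc 0 X := Ioc_subset_Ioc_right hx.2
  have hΦi : IntegrableOn (fun y => Φ y a b) (Ioc 0 x) :=
    ((hcont a b).integrableOn_Icc.mono_set Ioc_subset_Icc_self).mono_set hsub
  rw [integral_eq_of_duhamel (hF a b) (fun x hx => hΦ x hx a b) hx,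
    intervalIntegral.integral_of_le hx.1, intervalIntegral.integral_of_le hx.1,
    intervalIntegral.integral_of_le hx.1, ← integral_add hΦi ((hF a b).mono_set hsub)]
  congr 1
  refine integral_congr_ae ?_
  filter_upwards [ae_restrict_of_ae_restrict_of_subset hsub (hFΦ a b)] with y hy
  rw [hy, mul_eq_add_sub_one_mul (𝔸 y)]

lemma integrable_matrix_entry {m : Type} [Fintype m] {M : ℝ → Matrix m m ℂ} (hM : HasL2Entries X M) (a b : m) :
    Integrable (fun y => M y a b) (perMeasure X) := (hM a b).integrable (by norm_num)

/-- Here `T = W + u ∘ l`, where `W` solves the initial value problem and `u ∘ l` restores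
periodicity, so `1 - T = (1 - W)(1 - w ∘ l)` with `w = (1 - W)⁻¹ u`. The Volterra factor contributes
`1`; the finite-rank factor lives on `ℂ^m`. -/
theorem det2_firstOrder (hX : 0 < X) {V : ℕ → Submodule ℂ (L2 X m)}
    [∀ J, FiniteDimensional ℂ (V J)] (hV : IsExhaustion V)
    (hM : HasL2Entries X fun x => 𝔸 x - 1) :
    (∃ Φ, IsFundamentalSolution X 𝔸 Φ) ∧ ∀ Φ, IsFundamentalSolution X 𝔸 Φ →
      ∀ (T : L2 X m →L[ℂ] L2 X m) (C : ℝ), HSBound T C →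
      (∀ f, ∀ᵐ x ∂perMeasure X, ∀ a,
        (T f x) a = ∫ y, greenKernel X 1 x y * ((𝔸 y - 1) *ᵥ (f y).ofLp) a ∂perMeasure X) →
      det2 T = Complex.exp (Complex.exp X / (1 - Complex.exp X) *
          ∫ y in (0)..X, (𝔸 y - 1).trace) *
        ((Complex.exp X - 1) ^ Fintype.card m)⁻¹ * (Φ X - 1).det := by
  obtain ⟨W, ⟨D, hW⟩, hWf, hWdet, ⟨U, hU⟩⟩ := exists_volterraOp hV hM
  set κ : ℂ := Complex.exp X / (1 - Complex.exp X) with hκ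
  have hne : 1 - Complex.exp (X : ℂ) ≠ 0 := one_sub_cexp_ne_zero hX.ne'
  obtain ⟨u, hu⟩ := exists_scalarLift (X := X) (m := m) (continuous_cexp_mul 1)
  obtain ⟨l, hl⟩ := exists_integralFunctional hM
    (h := fun y : ℝ => κ * Complex.exp (((-1 : ℝ) * y : ℝ) : ℂ)) (by fun_prop)
  let w : EuclideanSpace ℂ m →L[ℂ] L2 X m := (↑U⁻¹ : L2 X m →L[ℂ] L2 X m) ∘L u
  have hw : ∀ c, w c - W (w c) = u c := by
    intro c
    have h1 : ((U : L2 X m →L[ℂ] L2 X m) * (↑U⁻¹ : L2 X m →L[ℂ] L2 X m)) (u c) = u c := by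
      rw [Units.mul_inv]; rfl
    rw [hU] at h1
    exact h1
  have hwu : ∀ f c, f - W f = u c → f = w c := by
    intro f c h
    have h1 : ((↑U⁻¹ : L2 X m →L[ℂ] L2 X m) * (U : L2 X m →L[ℂ] L2 X m)) f = f := by
      rw [Units.inv_mul]; rfl
    rw [hU] at h1
    have h2 : (1 - W) f = u c := h
    rw [← h1, ContinuousLinearMap.mul_def, ContinuousLinearMap.comp_apply, h2]
    rfl
  have hWx : ∀ f, ∀ᵐ x ∂perMeasure X, ∀ a, (W f x) a = Complex.exp (((1 : ℝ) * x : ℝ) : ℂ) *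
      ∫ y in (0)..x, Complex.exp ((-(1 : ℝ) * y : ℝ) : ℂ) * ((𝔸 y - 1) *ᵥ (f y).ofLp) a := by
    intro f
    filter_upwards [hWf f, ae_restrict_mem measurableSet_Ioc] with x h1 h2 a
    rw [h1 a, integral_volterraKernel _ h2]
  let e : m → EuclideanSpace ℂ m := fun b => EuclideanSpace.single b 1
  have he : ∀ a b, (e b) a = (1 : Matrix m m ℂ) a b := by
    intro a b
    simp [e, Matrix.one_apply, PiLp.single_apply]
  refine ⟨?_, fun Φ hΦ T C hT hTf => ?_⟩
  -- The equation `f - W f = u e_b` is Duhamel's equation for column `b`. Its right-hand side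
  -- provides a continuous representative of the almost-everywhere class `w e_b`.
  · let F : m → m → ℝ → ℂ := fun a b y => ((𝔸 y - 1) *ᵥ (w (e b) y).ofLp) a
    let Φ : ℝ → Matrix m m ℂ := fun x a b => Complex.exp (((1 : ℝ) * x : ℝ) : ℂ) *
      ((1 : Matrix m m ℂ) a b + ∫ y in (0)..x, Complex.exp ((-(1 : ℝ) * y : ℝ) : ℂ) * F a b y)
    refine ⟨Φ, isFundamentalSolution_of_duhamel (F := F)
      (fun a b => hM.integrable_mulVec _ a) (fun a b => ?_) fun x _ a b => rfl⟩
    have h1 := Lp.coeFn_sub (w (e b)) (W (w (e b)))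
    rw [hw] at h1
    filter_upwards [h1, hu (e b), hWx (w (e b))] with y h2 h3 h4
    have h5 : ∀ a', (w (e b) y) a' = Φ y a' b := by
      intro a'
      have h6 := congrArg (fun z : EuclideanSpace ℂ m => z a') (h2.symm.trans h3)
      simp only [Pi.sub_apply, PiLp.sub_apply, PiLp.smul_apply, smul_eq_mul, he, h4] at h6
      rw [sub_eq_iff_eq_add] at h6
      rw [h6, ← mul_add]
    simp only [F, Matrix.mulVec, dotProduct, Matrix.mul_apply, h5]
  -- Columns of any fundamental solution solve the same equation, and invertibility of `1 - W` makes
  -- them equal to `w e_b`.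
  · have hcol : ∀ b, w (e b) = (memLp_column hΦ.1 b).toLp _ := by
      intro b
      symm
      refine hwu _ _ ?_
      apply Lp.ext
      filter_upwards [Lp.coeFn_sub ((memLp_column hΦ.1 b).toLp _)
        (W ((memLp_column hΦ.1 b).toLp _)), hu (e b), hWx ((memLp_column hΦ.1 b).toLp _),
        (memLp_column hΦ.1 b).coeFn_toLp, ae_restrict_mem measurableSet_Ioc] with x h1 h2 h3 h4 h5
      ext a
      rw [h1, h2, Pi.sub_apply, PiLp.sub_apply, h3, h4, PiLp.smul_apply, he]
      change Φ x a b - _ = _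
      rw [(hΦ.duhamel hM a b).2 x (Ioc_subset_Icc_self h5), smul_eq_mul, mul_add, add_sub_assoc,
        add_eq_left, sub_eq_zero]
      congr 1
      rw [intervalIntegral.integral_of_le h5.1.le, intervalIntegral.integral_of_le h5.1.le]
      refine integral_congr_ae ?_
      filter_upwards [ae_restrict_of_ae_restrict_of_subset (Ioc_subset_Ioc_right h5.2)
        (memLp_column hΦ.1 b).coeFn_toLp] with y hy
      rw [hy]
      rfl
    -- The functional `l` integrates over the whole period, so Duhamel's formula at `x = X`
    -- evaluates it on the columns.
    have hlw : ∀ a b, l (w (e b)) a =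
        κ * (Complex.exp (((-1 : ℝ) * X : ℝ) : ℂ) * Φ X a b - (1 : Matrix m m ℂ) a b) := by
      intro a b
      have h1 := (hΦ.duhamel hM a b).2 X ⟨hX.le, le_rfl⟩
      rw [hl, hcol]
      have h2 : ∫ y, κ * Complex.exp (((-1 : ℝ) * y : ℝ) : ℂ) * ((𝔸 y - 1) *ᵥ
          (((memLp_column hΦ.1 b).toLp _ : L2 X m) y).ofLp) a ∂perMeasure X =
          κ * ∫ y in (0)..X, Complex.exp ((-(1 : ℝ) * y : ℝ) : ℂ) * ((𝔸 y - 1) * Φ y) a b := by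
        rw [intervalIntegral.integral_of_le hX.le, ← integral_const_mul]
        refine integral_congr_ae ?_
        filter_upwards [(memLp_column hΦ.1 b).coeFn_toLp] with y hy
        rw [hy, mul_assoc]
        rfl
      rw [h2, h1, ← mul_assoc (Complex.exp _), ← Complex.exp_add]
      simp
    have hlu : ∀ a b, l (u (e b)) a = κ * ∫ y in (0)..X, (𝔸 y - 1) a b := by
      intro a b
      rw [hl, intervalIntegral.integral_of_le hX.le, ← integral_const_mul]
      refine integral_congr_ae ?_
      filter_upwards [hu (e b)] with y hy
      have h3 : (e b).ofLp = Pi.single b 1 := rfl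
      rw [hy, WithLp.ofLp_smul, Matrix.mulVec_smul, Pi.smul_apply, smul_eq_mul, h3,
        Matrix.mulVec_single_one, ← mul_assoc, mul_assoc κ, ← Complex.exp_add]
      simp
    have hTsum : T = W + u ∘L l := by
      ext1 f
      apply Lp.ext
      have h0 : (W + u ∘L l) f = W f + u (l f) := rfl
      rw [h0]
      filter_upwards [hTf f, hWx f, hu (l f), Lp.coeFn_add (W f) (u (l f)),
        ae_restrict_mem measurableSet_Ioc] with x h1 h2 h3 h4 h5
      ext a
      rw [h1, h4, Pi.add_apply, PiLp.add_apply, h2, h3, PiLp.smul_apply, hl, smul_eq_mul,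
        integral_greenKernel hX.le 1 (hM.integrable_mulVec f a) (Ioc_subset_Icc_self h5), mul_add,
        add_comm, intervalIntegral.integral_of_le hX.le, ← integral_const_mul]
      simp only [one_mul, hκ, mul_assoc]
    have hR : HSBound (u ∘L l) (C + D) := by
      have := hT.sub hW
      rwa [hTsum, add_sub_cancel_left] at this
    -- The bound comes from `w ∘ l = u ∘ l + W ∘ (w ∘ l)`, with `u ∘ l = T - W`.
    have hB : HSBound (w ∘L l) ((C + D) + D * ‖w ∘L l‖) := by
      have := hR.add (hW.comp_right (w ∘L l))
      convert this using 1
      ext1 f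
      exact eq_add_of_sub_eq (hw (l f))
    have hprod := det2_mul_finiteRank hV hW w l hB
    have hT' : W + w ∘L l - W ∘L (w ∘L l) = T := by
      rw [hTsum, add_sub_assoc]
      congr 1
      ext1 f
      exact hw (l f)
    let be := (EuclideanSpace.basisFun m ℂ).toBasis
    have hbe : ∀ (S : EuclideanSpace ℂ m →L[ℂ] EuclideanSpace ℂ m) a b,
        LinearMap.toMatrix be be S.toLinearMap a b = S (e b) a := by
      intro S a b
      simp [be, LinearMap.toMatrix_apply, e]
    -- The two exponents of the product formula combine because `w - W w = u`; the inverse of `1 -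
    -- W` disappears and only the trace of `𝔸 - 1` is left.
    have htr : LinearMap.trace ℂ _ (l ∘L w : EuclideanSpace ℂ m →L[ℂ] _).toLinearMap -
        LinearMap.trace ℂ _ (l ∘L W ∘L w : EuclideanSpace ℂ m →L[ℂ] _).toLinearMap =
        κ * ∫ y in (0)..X, (𝔸 y - 1).trace := by
      rw [← map_sub]
      have h1 : (l ∘L w : EuclideanSpace ℂ m →L[ℂ] _).toLinearMap -
          (l ∘L W ∘L w : EuclideanSpace ℂ m →L[ℂ] _).toLinearMap =
          (l ∘L u : EuclideanSpace ℂ m →L[ℂ] _).toLinearMap := by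
        ext1 c
        change l (w c) - l (W (w c)) = l (u c)
        rw [← map_sub, hw]
      rw [h1, LinearMap.trace_eq_matrix_trace ℂ be]
      simp only [Matrix.trace, Matrix.diag, hbe, ContinuousLinearMap.comp_apply, hlu]
      rw [intervalIntegral.integral_of_le hX.le, integral_finsetSum _ fun a _ =>
        integrable_matrix_entry hM a a, Finset.mul_sum]
      simp only [intervalIntegral.integral_of_le hX.le]
    -- With `κ = e^X / (1 - e^X)`, both `1 + κ` and `κ e^{-X}` equal `1 / (1 - e^X)`.
    have hmat : 1 - LinearMap.toMatrix be be (l ∘L w : EuclideanSpace ℂ m →L[ℂ] _).toLinearMap =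
        (Complex.exp X - 1)⁻¹ • (Φ X - 1) := by
      ext a b
      have hne' : Complex.exp (X : ℂ) - 1 ≠ 0 := by
        rw [← neg_sub]; exact neg_ne_zero.2 hne
      have hexp : Complex.exp (((-1 : ℝ) * X : ℝ) : ℂ) = (Complex.exp X)⁻¹ := by
        rw [← Complex.exp_neg]; simp
      have h0 := Complex.exp_ne_zero (X : ℂ)
      rw [Matrix.sub_apply, hbe, ContinuousLinearMap.comp_apply, hlw, Matrix.smul_apply,
        Matrix.sub_apply, smul_eq_mul, hexp, hκ]
      have h7 : 1 - Complex.exp (X : ℂ) = -(Complex.exp X - 1) := by ring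
      rw [h7]
      field_simp
      ring
    rw [hT', hWdet, one_mul, finDet2] at hprod
    rw [hprod, mul_assoc, ← Complex.exp_add, ← sub_eq_add_neg, htr,
      ← LinearMap.det_toMatrix be, map_sub, LinearMap.toMatrix_id, hmat, Matrix.det_smul, inv_pow]
    ring

end FundamentalSolution

/-! ### Fourier modes and the matrix entries of the operators. -/

section FourierModes

/-- The exponential `e^{ijx}`. -/
def fmode (j : ℤ) (x : ℝ) : ℂ := Complex.exp (Complex.I * j * x)

variable {X : ℝ}

lemma hasDerivAt_fmode (j : ℤ) (x : ℝ) : HasDerivAt (fmode j) (Complex.I * j * fmode j x) x := by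
  have h1 : HasDerivAt (fun y : ℝ => Complex.I * j * (y : ℂ)) (Complex.I * j * 1) x :=
    ((hasDerivAt_id x).ofReal_comp).const_mul _
  have h2 := h1.cexp
  rw [mul_one, mul_comm (Complex.exp _)] at h2
  exact h2

lemma deriv_fmode (j : ℤ) : deriv (fmode j) = fun x => Complex.I * j * fmode j x :=
  funext fun x => (hasDerivAt_fmode j x).deriv

lemma contDiff_fmode (j : ℤ) : ContDiff ℝ ∞ (fmode j) := by
  unfold fmode
  exact (contDiff_const.mul Complex.ofRealCLM.contDiff).cexp

lemma continuous_fmode (j : ℤ) : Continuous (fmode j) := (contDiff_fmode j).continuous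

lemma isPeriodicTest_fmode (hX : X = 2 * Real.pi) (j : ℤ) : IsPeriodicTest X (fmode j) := by
  refine ⟨contDiff_fmode j, fun x => ?_⟩
  unfold fmode
  rw [Complex.exp_eq_exp_iff_exists_int]
  exact ⟨j, by rw [hX]; push_cast; ring⟩

lemma fmode_add (j k : ℤ) (x : ℝ) : fmode (j + k) x = fmode j x * fmode k x := by
  unfold fmode
  rw [← Complex.exp_add]
  congr 1
  push_cast; ring

lemma fmode_zero (x : ℝ) : fmode 0 x = 1 := by simp [fmode]

lemma star_fmode (j : ℤ) (x : ℝ) : star (fmode j x) = fmode (-j) x := by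
  unfold fmode
  rw [Complex.star_def, ← Complex.exp_conj]
  congr 1
  simp

lemma norm_fmode (j : ℤ) (x : ℝ) : ‖fmode j x‖ = 1 := by
  unfold fmode
  rw [Complex.norm_exp]
  simp

lemma integral_fmode (hX : X = 2 * Real.pi) (j : ℤ) :
    ∫ x in (0)..X, fmode j x = if j = 0 then (X : ℂ) else 0 := by
  split_ifs with h
  · subst h; simp [fmode_zero]
  · have h1 : ∀ x ∈ uIcc 0 X, HasDerivAt (fun y => (Complex.I * j)⁻¹ * fmode j y) (fmode j x) x := by
      intro x _
      have hj : Complex.I * (j : ℂ) ≠ 0 := mul_ne_zero Complex.I_ne_zero (by exact_mod_cast h)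
      have := (hasDerivAt_fmode j x).const_mul (Complex.I * (j : ℂ))⁻¹
      rwa [← mul_assoc, inv_mul_cancel₀ hj, one_mul] at this
    rw [intervalIntegral.integral_eq_sub_of_hasDerivAt h1
      ((continuous_fmode j).intervalIntegrable _ _)]
    have := (isPeriodicTest_fmode hX j).2 0
    rw [zero_add] at this
    rw [this, sub_self]

/-- Completeness of the exponentials. -/
lemma ae_eq_zero_of_integral_fmode_mul (hX : X = 2 * Real.pi) {f : ℝ → ℂ}
    (hf : MemLp f 2 (perMeasure X)) (h : ∀ j : ℤ, ∫ x in (0)..X, fmode j x * f x = 0) :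
    f =ᵐ[perMeasure X] 0 := by
  have hpos : (0 : ℝ) < X := by rw [hX]; positivity
  have h1 := hasSum_sq_fourierCoeffOn hpos hf
  have h2 : ∀ j : ℤ, fourierCoeffOn hpos f j = 0 := by
    intro j
    rw [fourierCoeffOn_eq_integral]
    have h3 : ∀ x : ℝ, fourier (-j) (x : AddCircle (X - 0)) = fmode (-j) x := by
      intro x
      rw [fourier_coe_apply, fmode]
      congr 1
      have : ((X - 0 : ℝ) : ℂ) = 2 * Real.pi := by rw [hX]; push_cast; ring
      rw [this]
      have hpi : (Real.pi : ℂ) ≠ 0 := by exact_mod_cast Real.pi_ne_zero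
      field_simp
    simp only [h3, smul_eq_mul, h, smul_zero]
  simp only [h2, norm_zero, ne_eq, OfNat.ofNat_ne_zero, not_false_eq_true, zero_pow] at h1
  have h4 := h1.unique hasSum_zero
  rw [smul_eq_zero, or_iff_right (by simpa using hpos.ne'),
    intervalIntegral.integral_of_le hpos.le, integral_eq_zero_iff_of_nonneg
      (fun x => by positivity) ((memLp_two_iff_integrable_sq_norm hf.1).1 hf)] at h4
  filter_upwards [h4] with x hx
  simpa using hx

variable {m : Type} [Fintype m]

lemma L2_eq_zero_of_integral_fmode_mul (hX : X = 2 * Real.pi) {f : L2 X m}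
    (h : ∀ (j : ℤ) a, ∫ x in (0)..X, fmode j x * f x a = 0) : f = 0 := by
  apply Lp.ext
  filter_upwards [ae_all_iff.2 fun a =>
    ae_eq_zero_of_integral_fmode_mul hX (memLp_coord f a) fun j => h j a,
    Lp.coeFn_zero (EuclideanSpace ℂ m) 2 (perMeasure X)] with x hx h0
  rw [h0]
  ext a
  exact hx a

lemma integral_mul_coord_sub (hX : 0 ≤ X) {ψ : ℝ → ℂ} (hψ : Continuous ψ) (f g : L2 X m) (a : m) :
    ∫ x in (0)..X, ψ x * (f - g) x a =
      (∫ x in (0)..X, ψ x * f x a) - ∫ x in (0)..X, ψ x * g x a := by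
  simp only [intervalIntegral.integral_of_le hX]
  rw [← integral_sub (integrableOn_mul_of_continuous hψ (integrable_coord f a))
    (integrableOn_mul_of_continuous hψ (integrable_coord g a))]
  refine integral_congr_ae ?_
  filter_upwards [Lp.coeFn_sub f g] with x hx
  rw [hx, Pi.sub_apply, PiLp.sub_apply, mul_sub]

/-- An element of `L²` is determined by its Fourier coefficients up to nonzero factors. -/
lemma L2_eq_of_integral_fmode_mul (hX : X = 2 * Real.pi) {f g : L2 X m} {c : ℤ → ℂ}
    (hc : ∀ j, c j ≠ 0)
    (h : ∀ (j : ℤ) a, ∫ x in (0)..X, c j * fmode j x * f x a =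
      ∫ x in (0)..X, c j * fmode j x * g x a) : f = g := by
  rw [← sub_eq_zero]
  refine L2_eq_zero_of_integral_fmode_mul hX fun j a => ?_
  rw [integral_mul_coord_sub (by rw [hX]; positivity) (continuous_fmode j), sub_eq_zero]
  have := h j a
  simp only [mul_assoc, intervalIntegral.integral_const_mul] at this
  exact mul_left_cancel₀ (hc j) this

lemma I_mul_int_ne {j : ℤ} {r : ℝ} (hr : r ≠ 0) : Complex.I * (j : ℂ) + r ≠ 0 := by
  intro h
  have := congrArg Complex.re h
  simp at this
  exact hr this

lemma int_sq_add_one_ne (j : ℤ) : (j : ℂ) ^ 2 + 1 ≠ 0 := by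
  have : (0 : ℝ) < (j : ℝ) ^ 2 + 1 := by positivity
  exact_mod_cast this.ne'

/-- Testing with `e^{ijx}` determines each Fourier coefficient, since the symbol `-ij - 1` never
vanishes. Uniqueness identifies the operator obtained by choice with the integral operator
constructed above. -/
lemma IsFirstOrderOp.unique [DecidableEq m] (hX : X = 2 * Real.pi) {𝔸 : ℝ → Matrix m m ℂ}
    {T S : L2 X m →L[ℂ] L2 X m} (hT : IsFirstOrderOp X 𝔸 T) (hS : IsFirstOrderOp X 𝔸 S) :
    T = S := by
  ext1 W
  refine L2_eq_of_integral_fmode_mul hX (c := fun j => -(Complex.I * j) - 1) (fun j h => ?_)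
    fun j a => ?_
  · exact I_mul_int_ne (j := j) one_ne_zero (by push_cast; linear_combination -h)
  · have h := (hT W _ (isPeriodicTest_fmode hX j) a).trans
      (hS W _ (isPeriodicTest_fmode hX j) a).symm
    have e : ∀ x, -deriv (fmode j) x - fmode j x = (-(Complex.I * j) - 1) * fmode j x := by
      intro x; rw [deriv_fmode]; ring
    simpa only [e] using h

lemma deriv_deriv_fmode (j : ℤ) (x : ℝ) :
    deriv (deriv (fmode j)) x = -(j : ℂ) ^ 2 * fmode j x := by
  rw [deriv_fmode, deriv_const_mul _ (hasDerivAt_fmode j x).differentiableAt, deriv_fmode]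
  linear_combination (j : ℂ) ^ 2 * fmode j x * Complex.I_sq

/-- The same argument with the nonvanishing symbol `-(j² + 1)`. -/
lemma IsBirmanSchwingerOp.unique {n : ℕ} (hX : X = 2 * Real.pi)
    {A₁ A₀ B₀ : ℝ → Matrix (Fin n) (Fin n) ℂ} {lam : ℂ}
    {T S : L2 X (Fin n) →L[ℂ] L2 X (Fin n)} (hT : IsBirmanSchwingerOp X A₁ A₀ B₀ lam T)
    (hS : IsBirmanSchwingerOp X A₁ A₀ B₀ lam S) : T = S := by
  ext1 W
  refine L2_eq_of_integral_fmode_mul hX (c := fun j => -((j : ℂ) ^ 2 + 1)) (fun j h => ?_)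
    fun j a => ?_
  · exact int_sq_add_one_ne j (neg_eq_zero.1 h)
  · have h := (hT W _ (isPeriodicTest_fmode hX j) a).trans
      (hS W _ (isPeriodicTest_fmode hX j) a).symm
    have e : ∀ x, deriv (deriv (fmode j)) x - fmode j x = -((j : ℂ) ^ 2 + 1) * fmode j x := by
      intro x; rw [deriv_deriv_fmode]; ring
    simpa only [e] using h

variable [DecidableEq m]

lemma memLp_modeVec (X : ℝ) (j : ℤ) (a : m) :
    MemLp (fun x => (((√X)⁻¹ : ℝ) * fmode j x : ℂ) • EuclideanSpace.single a (1 : ℂ)) 2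
      (perMeasure X) := by
  refine MemLp.of_bound ?_ ‖(((√X)⁻¹ : ℝ) : ℂ)‖ (Eventually.of_forall fun x => ?_)
  · exact ((continuous_const.mul (continuous_fmode j)).smul continuous_const).aestronglyMeasurable
  · rw [norm_smul, norm_mul, norm_fmode]
    simp

/-- The normalized Fourier modes in `L²`. -/
def modeVec (X : ℝ) (j : ℤ) (a : m) : L2 X m := (memLp_modeVec X j a).toLp _

lemma coeFn_modeVec (X : ℝ) (j : ℤ) (a : m) : ∀ᵐ x ∂perMeasure X,
    modeVec X j a x = (((√X)⁻¹ : ℝ) * fmode j x : ℂ) • EuclideanSpace.single a (1 : ℂ) :=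
  (memLp_modeVec X j a).coeFn_toLp

lemma inner_modeVec (hX : 0 ≤ X) (j : ℤ) (a : m) (f : L2 X m) :
    inner ℂ (modeVec X j a) f = ((√X)⁻¹ : ℝ) * ∫ x in (0)..X, fmode (-j) x * f x a := by
  rw [L2.inner_def, intervalIntegral.integral_of_le hX, ← integral_const_mul]
  refine integral_congr_ae ?_
  filter_upwards [coeFn_modeVec X j a] with x hx
  rw [hx, inner_smul_left, EuclideanSpace.inner_single_left, map_mul, Complex.conj_ofReal,
    ← Complex.star_def, star_fmode]
  simp [mul_assoc]

lemma inv_sqrt_mul_self (hX : 0 < X) :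
    (((√X)⁻¹ : ℝ) : ℂ) * (((√X)⁻¹ : ℝ) : ℂ) = 1 / (X : ℂ) := by
  rw [← Complex.ofReal_mul, ← mul_inv, Real.mul_self_sqrt hX.le]
  simp

/-- The Fourier coefficients of a matrix function. -/
def matCoeff (X : ℝ) (M : ℝ → Matrix m m ℂ) (l : ℤ) : Matrix m m ℂ :=
  fun a b => (1 / (X : ℂ)) * ∫ x in (0)..X, fmode (-l) x * M x a b

/-- Fourier coefficients of `M` applied to a Fourier mode. -/
lemma integral_fmode_mulVec_modeVec (hX : 0 < X) (M : ℝ → Matrix m m ℂ) (j k : ℤ) (a b : m) :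
    ((√X)⁻¹ : ℝ) * ∫ x in (0)..X, fmode (-j) x * (M x *ᵥ (modeVec X k b x).ofLp) a =
      matCoeff X M (j - k) a b := by
  rw [matCoeff, ← inv_sqrt_mul_self hX, mul_assoc, intervalIntegral.integral_of_le hX.le,
    intervalIntegral.integral_of_le hX.le, ← integral_const_mul (((√X)⁻¹ : ℝ) : ℂ) fun x =>
      fmode (-(j - k)) x * M x a b]
  congr 1
  refine integral_congr_ae ?_
  filter_upwards [coeFn_modeVec X k b] with x hx
  have h3 : (EuclideanSpace.single b (1 : ℂ)).ofLp = Pi.single b 1 := rfl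
  rw [hx, WithLp.ofLp_smul, Matrix.mulVec_smul, h3, Matrix.mulVec_single_one,
    show -(j - k) = -j + k by ring, fmode_add]
  simp only [Pi.smul_apply, smul_eq_mul, Matrix.col_apply]
  ring

lemma orthonormal_modeVec (hX : X = 2 * Real.pi) :
    Orthonormal ℂ fun p : ℤ × m => modeVec X p.1 p.2 := by
  have hpos : (0 : ℝ) < X := by rw [hX]; positivity
  have hX0 : (X : ℂ) ≠ 0 := by exact_mod_cast hpos.ne'
  rw [orthonormal_iff_ite]
  rintro ⟨j, a⟩ ⟨k, b⟩
  rw [inner_modeVec hpos.le]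
  -- For the constant matrix `1` the coefficient formula gives the inner products of the modes
  -- themselves.
  have h := integral_fmode_mulVec_modeVec hpos (fun _ => (1 : Matrix m m ℂ)) j k a b
  simp only [Matrix.one_mulVec] at h
  rw [h, matCoeff]
  simp only [intervalIntegral.integral_mul_const, integral_fmode hX, Prod.mk.injEq,
    Matrix.one_apply]
  by_cases hjk : j = k
  · subst hjk; by_cases hab : a = b
    · simp [hab, hX0]
    · simp [hab]
  · have : k - j ≠ 0 := by omega
    simp [hjk, this]

/-- The span of the Fourier modes with `|j| ≤ J`. -/
def fourierSpace (X : ℝ) (m : Type) [Fintype m] [DecidableEq m] (J : ℕ) : Submodule ℂ (L2 X m) :=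
  Submodule.span ℂ (Set.range fun p : Finset.Icc (-(J : ℤ)) J × m => modeVec X (p.1 : ℤ) p.2)

instance (J : ℕ) : FiniteDimensional ℂ (fourierSpace X m J) :=
  FiniteDimensional.span_of_finite ℂ (Set.finite_range _)

lemma isExhaustion_fourierSpace (hX : X = 2 * Real.pi) : IsExhaustion (fourierSpace X m) := by
  have hpos : (0 : ℝ) < X := by rw [hX]; positivity
  refine ⟨inferInstance, fun J K hJK => Submodule.span_mono ?_, ?_⟩
  · rintro _ ⟨⟨⟨j, hj⟩, a⟩, rfl⟩
    rw [Finset.mem_Icc] at hj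
    exact ⟨⟨⟨j, Finset.mem_Icc.2 ⟨by omega, by omega⟩⟩, a⟩, rfl⟩
  · rw [Submodule.topologicalClosure_eq_top_iff, Submodule.eq_bot_iff]
    intro f hf
    refine L2_eq_zero_of_integral_fmode_mul hX fun j a => ?_
    have hmem : modeVec X (-j) a ∈ ⨆ J, fourierSpace X m J := by
      refine Submodule.mem_iSup_of_mem j.natAbs (Submodule.subset_span ?_)
      exact ⟨⟨⟨-j, Finset.mem_Icc.2 ⟨by omega, by omega⟩⟩, a⟩, rfl⟩
    have h := (Submodule.mem_orthogonal _ f).1 hf _ hmem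
    rw [inner_modeVec hpos.le, neg_neg, mul_eq_zero] at h
    refine h.resolve_left ?_
    have : (√X)⁻¹ ≠ 0 := inv_ne_zero (Real.sqrt_ne_zero'.2 hpos)
    exact_mod_cast this

lemma finDet2_galerkin_span {H : Type} [NormedAddCommGroup H] [InnerProductSpace ℂ H] {ι : Type}
    [Fintype ι] [DecidableEq ι] {v : ι → H} (hv : Orthonormal ℂ v) (T : H →L[ℂ] H)
    [FiniteDimensional ℂ (Submodule.span ℂ (Set.range v))] :
    finDet2 (galerkin T (Submodule.span ℂ (Set.range v))) =
      matDet2 (Matrix.of fun i j => inner ℂ (v i) (T (v j))) := by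
  let b := Module.Basis.span hv.linearIndependent
  have hb : ∀ i, (b i : H) = v i := fun i => congrArg Subtype.val (Module.Basis.span_apply hv.linearIndependent i)
  have ho : Orthonormal ℂ b := by
    rw [orthonormal_iff_ite] at hv ⊢
    intro i j
    rw [Submodule.coe_inner, hb, hb, hv]
  rw [finDet2_eq_matDet2 (b.toOrthonormalBasis ho).toBasis]
  congr 1
  ext i j
  rw [toMatrix_galerkin, Matrix.of_apply]
  simp only [Module.Basis.coe_toOrthonormalBasis, hb]

lemma finDet2_galerkin_fourierSpace (hX : X = 2 * Real.pi) (T : L2 X m →L[ℂ] L2 X m) (J : ℕ) :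
    finDet2 (galerkin T (fourierSpace X m J)) =
      matDet2 (Matrix.of fun p q : Finset.Icc (-(J : ℤ)) J × m =>
        inner ℂ (modeVec X (p.1 : ℤ) p.2) (T (modeVec X (q.1 : ℤ) q.2))) := by
  have : FiniteDimensional ℂ (Submodule.span ℂ (Set.range
      fun p : Finset.Icc (-(J : ℤ)) J × m => modeVec X (p.1 : ℤ) p.2)) :=
    inferInstanceAs (FiniteDimensional ℂ (fourierSpace X m J))
  refine finDet2_galerkin_span (v := fun p : Finset.Icc (-(J : ℤ)) J × m =>
    modeVec X (p.1 : ℤ) p.2) ?_ T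
  refine (orthonormal_modeVec hX).comp
    (fun p : Finset.Icc (-(J : ℤ)) J × m => ((p.1 : ℤ), p.2)) fun p q h => ?_
  simp only [Prod.mk.injEq] at h
  exact Prod.ext (Subtype.ext h.1) h.2

/-- Testing with `e^{-ijx}` shows that the matrix of `𝕂` is a Toeplitz matrix divided row by row by
the symbol of `∂ₓ - 1`. -/
lemma IsFirstOrderOp.inner_modeVec (hX : X = 2 * Real.pi) {𝔸 : ℝ → Matrix m m ℂ}
    {T : L2 X m →L[ℂ] L2 X m} (hT : IsFirstOrderOp X 𝔸 T) (j k : ℤ) (a b : m) :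
    (Complex.I * j - 1) * inner ℂ (modeVec X j a) (T (modeVec X k b)) =
      matCoeff X (fun x => 𝔸 x - 1) (j - k) a b := by
  have hpos : (0 : ℝ) < X := by rw [hX]; positivity
  rw [HillEvans.inner_modeVec hpos.le, ← integral_fmode_mulVec_modeVec hpos,
    ← hT _ _ (isPeriodicTest_fmode hX (-j)) a]
  have e : ∀ x, -deriv (fmode (-j)) x - fmode (-j) x = (Complex.I * j - 1) * fmode (-j) x := by
    intro x; rw [deriv_fmode]; push_cast; ring
  simp only [e, mul_assoc, intervalIntegral.integral_const_mul]
  ring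

lemma IsBirmanSchwingerOp.inner_modeVec {n : ℕ} (hX : X = 2 * Real.pi)
    {A₁ A₀ B₀ : ℝ → Matrix (Fin n) (Fin n) ℂ} {lam : ℂ}
    {T : L2 X (Fin n) →L[ℂ] L2 X (Fin n)} (hT : IsBirmanSchwingerOp X A₁ A₀ B₀ lam T)
    (hA₁ : HasL2Entries X A₁) (hC : HasL2Entries X fun x => A₀ x + 1 - lam • B₀ x)
    (j k : ℤ) (a b : Fin n) :
    ((j : ℂ) ^ 2 + 1) * inner ℂ (modeVec X j a) ((-T) (modeVec X k b)) =
      Complex.I * j * matCoeff X A₁ (j - k) a b +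
        matCoeff X (fun x => A₀ x + 1 - lam • B₀ x) (j - k) a b := by
  have hpos : (0 : ℝ) < X := by rw [hX]; positivity
  have h0 : (-T) (modeVec X k b) = -T (modeVec X k b) := rfl
  rw [h0, inner_neg_right, HillEvans.inner_modeVec hpos.le,
    ← integral_fmode_mulVec_modeVec hpos, ← integral_fmode_mulVec_modeVec hpos]
  have h := hT (modeVec X k b) _ (isPeriodicTest_fmode hX (-j)) a
  have e : ∀ x, deriv (deriv (fmode (-j))) x - fmode (-j) x =
      -((j : ℂ) ^ 2 + 1) * fmode (-j) x := by
    intro x; rw [deriv_deriv_fmode]; push_cast; ring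
  have e2 : ∀ x, -deriv (fmode (-j)) x = Complex.I * j * fmode (-j) x := by
    intro x; rw [deriv_fmode]; push_cast; ring
  simp only [e, e2, mul_assoc, intervalIntegral.integral_const_mul] at h
  rw [intervalIntegral.integral_add, intervalIntegral.integral_const_mul,
    intervalIntegral.integral_const_mul] at h
  · linear_combination (((√X)⁻¹ : ℝ) : ℂ) * h
  · rw [intervalIntegrable_iff_integrableOn_Ioc_of_le hpos.le]
    exact ((integrableOn_mul_of_continuous (continuous_fmode _)
      (hA₁.integrable_mulVec _ a)).const_mul _).const_mul _
  · rw [intervalIntegrable_iff_integrableOn_Ioc_of_le hpos.le]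
    exact integrableOn_mul_of_continuous (continuous_fmode _) (hC.integrable_mulVec _ a)

end FourierModes

/-! ### Fourier coefficients of the coefficient functions. -/

section Coefficients

variable {X : ℝ}

/-- The Fourier coefficients of a scalar function. -/
def scalarCoeff (X : ℝ) (f : ℝ → ℂ) (l : ℤ) : ℂ :=
  (1 / (X : ℂ)) * ∫ x in (0)..X, fmode (-l) x * f x

lemma intervalIntegrable_fmode_mul (hX : 0 ≤ X) {f : ℝ → ℂ} (hf : Integrable f (perMeasure X))
    (l : ℤ) : IntervalIntegrable (fun x => fmode l x * f x) volume 0 X := by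
  rw [intervalIntegrable_iff_integrableOn_Ioc_of_le hX]
  exact integrableOn_mul_of_continuous (continuous_fmode _) hf

lemma scalarCoeff_add (hX : 0 ≤ X) {f g : ℝ → ℂ} (hf : Integrable f (perMeasure X))
    (hg : Integrable g (perMeasure X)) (l : ℤ) :
    scalarCoeff X (fun x => f x + g x) l = scalarCoeff X f l + scalarCoeff X g l := by
  simp only [scalarCoeff, mul_add]
  rw [intervalIntegral.integral_add (intervalIntegrable_fmode_mul hX hf _)
    (intervalIntegrable_fmode_mul hX hg _), mul_add]

lemma scalarCoeff_const_mul (c : ℂ) (f : ℝ → ℂ) (l : ℤ) :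
    scalarCoeff X (fun x => c * f x) l = c * scalarCoeff X f l := by
  simp only [scalarCoeff, mul_left_comm _ c, intervalIntegral.integral_const_mul]

lemma scalarCoeff_neg (f : ℝ → ℂ) (l : ℤ) :
    scalarCoeff X (fun x => -f x) l = -scalarCoeff X f l := by
  simpa using scalarCoeff_const_mul (X := X) (-1) f l

lemma scalarCoeff_sub (hX : 0 ≤ X) {f g : ℝ → ℂ} (hf : Integrable f (perMeasure X))
    (hg : Integrable g (perMeasure X)) (l : ℤ) :
    scalarCoeff X (fun x => f x - g x) l = scalarCoeff X f l - scalarCoeff X g l := by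
  simp only [sub_eq_add_neg]
  rw [scalarCoeff_add hX hf (show Integrable (fun x => -g x) _ from hg.neg), scalarCoeff_neg]

lemma scalarCoeff_const (hX : X = 2 * Real.pi) (c : ℂ) (l : ℤ) :
    scalarCoeff X (fun _ => c) l = if l = 0 then c else 0 := by
  have hX0 : (X : ℂ) ≠ 0 := by
    rw [hX]; exact_mod_cast Real.two_pi_pos.ne'
  simp only [scalarCoeff, intervalIntegral.integral_mul_const, integral_fmode hX, neg_eq_zero]
  split_ifs
  · field_simp
  · simp

lemma scalarCoeff_weakDeriv {n : ℕ} (hX : X = 2 * Real.pi) {A A' : ℝ → Matrix (Fin n) (Fin n) ℂ}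
    (h : IsPeriodicWeakDeriv X A A') (l : ℤ) (a b : Fin n) :
    scalarCoeff X (fun x => A' x a b) l = Complex.I * l * scalarCoeff X (fun x => A x a b) l := by
  have h1 := h _ (isPeriodicTest_fmode hX (-l)) a b
  rw [scalarCoeff, h1, deriv_fmode]
  simp only [scalarCoeff, mul_assoc, intervalIntegral.integral_const_mul]
  push_cast
  ring

variable {m : Type} [Fintype m] [DecidableEq m]

lemma matCoeff_apply {m : Type} [Fintype m] [DecidableEq m] (M : ℝ → Matrix m m ℂ) (l : ℤ) (a b : m) :
    matCoeff X M l a b = scalarCoeff X (fun x => M x a b) l := rfl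

lemma mean_apply {m : Type} (M : ℝ → Matrix m m ℂ) (a b : m) :
    mean X M a b = scalarCoeff X (fun x => M x a b) 0 := by
  simp [mean, scalarCoeff, fmode_zero]

lemma matCoeff_zero (M : ℝ → Matrix m m ℂ) : matCoeff X M 0 = mean X M := by
  ext a b
  rw [matCoeff_apply, mean_apply]

lemma integral_trace (hX : X = 2 * Real.pi) {M : ℝ → Matrix m m ℂ} (hM : HasL2Entries X M) :
    ∫ x in (0)..X, (M x).trace = X * (mean X M).trace := by
  have hpos : (0 : ℝ) < X := by rw [hX]; positivity
  have hX0 : (X : ℂ) ≠ 0 := by exact_mod_cast hpos.ne'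
  simp only [Matrix.trace, Matrix.diag, mean]
  rw [intervalIntegral.integral_finsetSum, Finset.mul_sum]
  · refine Finset.sum_congr rfl fun a _ => ?_
    field_simp
  · intro a _
    rw [intervalIntegrable_iff_integrableOn_Ioc_of_le hpos.le]
    exact integrable_matrix_entry hM a a

end Coefficients

/-! ### Determinant of a block linearization. -/

section Blocks

variable {N : Type*} [Fintype N] [DecidableEq N]

/-- Right multiplication by a matrix of determinant one makes the block matrix lower triangular.
This inverts none of the blocks and needs no commutation among them. -/
lemma det_fromBlocks_neg_one (A C D : Matrix N N ℂ) :
    (Matrix.fromBlocks A (-1) C D).det = (D * A + C).det := by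
  have h1 : (Matrix.fromBlocks 0 1 (-1) A : Matrix (N ⊕ N) (N ⊕ N) ℂ).det = 1 := by
    have h2 : (Matrix.fromBlocks 0 1 (-1) A : Matrix (N ⊕ N) (N ⊕ N) ℂ) *
        Matrix.fromBlocks 1 0 1 1 = Matrix.fromBlocks 1 1 (A - 1) A := by
      rw [Matrix.fromBlocks_multiply]
      congr 1 <;> simp [sub_eq_neg_add]
    have h3 := congrArg Matrix.det h2
    rw [Matrix.det_mul, Matrix.det_fromBlocks_zero₁₂, Matrix.det_fromBlocks_one₁₁] at h3
    simpa using h3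
  have h4 : Matrix.fromBlocks A (-1) C D * Matrix.fromBlocks 0 1 (-1) A =
      Matrix.fromBlocks 1 0 (-D) (D * A + C) := by
    rw [Matrix.fromBlocks_multiply]
    congr 1 <;> simp [add_comm]
  have h5 := congrArg Matrix.det h4
  rw [Matrix.det_mul, h1, Matrix.det_fromBlocks_zero₁₂] at h5
  simpa using h5

end Blocks

/-! ### The two first-order systems and their truncations. -/

section FirstOrderForms

variable {X : ℝ} {n : ℕ} {A₁ A₀ B₀ : ℝ → Matrix (Fin n) (Fin n) ℂ} {lam : ℂ}
  {𝔸 : ℝ → Matrix (Fin n ⊕ Fin n) (Fin n ⊕ Fin n) ℂ}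

lemma memLp_const_perMeasure (c : ℂ) : MemLp (fun _ : ℝ => c) 2 (perMeasure X) := memLp_const c

lemma hasL2Entries_zeroOrder (hA₀ : IsL2Coeff X A₀) (hB₀ : IsL2Coeff X B₀) :
    HasL2Entries X fun x => A₀ x + 1 - lam • B₀ x := fun i j =>
  ((hA₀.2 i j).add (memLp_const_perMeasure _)).sub ((hB₀.2 i j).const_mul lam)

lemma IsFirstOrderForm.hasL2Entries (h : IsFirstOrderForm X A₁ A₀ B₀ lam 𝔸)
    (hA₁ : IsL2Coeff X A₁) (hA₀ : IsL2Coeff X A₀) (hB₀ : IsL2Coeff X B₀) :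
    HasL2Entries X fun x => 𝔸 x - 1 := by
  suffices h1 : HasL2Entries X 𝔸 from fun i j => (h1 i j).sub (memLp_const_perMeasure _)
  rcases h with ⟨A₁', hmem, -⟩ | _
  · rintro (i | i) (j | j)
    · exact memLp_const_perMeasure _
    · exact memLp_const_perMeasure _
    · exact (((hB₀.2 i j).const_mul lam).sub (hA₀.2 i j)).sub (hmem.2 i j)
    · exact (hA₁.2 i j).neg
  · rintro (i | i) (j | j)
    · exact (hA₁.2 i j).neg
    · exact memLp_const_perMeasure _
    · exact ((hB₀.2 i j).const_mul lam).sub (hA₀.2 i j)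
    · exact memLp_const_perMeasure _

lemma IsFirstOrderForm.trace_sub_one (h : IsFirstOrderForm X A₁ A₀ B₀ lam 𝔸) (x : ℝ) :
    (𝔸 x - 1).trace = -(A₁ x + (2 : ℂ) • (1 : Matrix (Fin n) (Fin n) ℂ)).trace := by
  rcases h with ⟨A₁', hmem, -⟩ | _
  all_goals
    simp [Matrix.trace, Fintype.sum_sum_type, Finset.sum_add_distrib, Finset.sum_sub_distrib]
    ring

lemma trace_mean_add_two (hX : X = 2 * Real.pi) (hA₁ : IsL2Coeff X A₁) :
    (mean X fun x => A₁ x + (2 : ℂ) • (1 : Matrix (Fin n) (Fin n) ℂ)) =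
      mean X A₁ + (2 : ℂ) • (1 : Matrix (Fin n) (Fin n) ℂ) := by
  have hpos : (0 : ℝ) < X := by rw [hX]; positivity
  ext a b
  rw [mean_apply, Matrix.add_apply, mean_apply]
  simp only [Matrix.add_apply]
  rw [scalarCoeff_add hpos.le (integrable_matrix_entry hA₁.2 a b) (integrable_const _),
    scalarCoeff_const hX, if_pos rfl]

lemma mean_zeroOrder (hX : X = 2 * Real.pi) (hA₀ : IsL2Coeff X A₀) (hB₀ : IsL2Coeff X B₀) :
    mean X (fun x => A₀ x + 1 - lam • B₀ x) = mean X A₀ + 1 - lam • mean X B₀ := by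
  have hpos : (0 : ℝ) < X := by rw [hX]; positivity
  ext a b
  have hA := integrable_matrix_entry hA₀.2 a b
  have hB := integrable_matrix_entry hB₀.2 a b
  simp only [mean_apply, Matrix.add_apply, Matrix.sub_apply, Matrix.smul_apply, smul_eq_mul]
  rw [scalarCoeff_sub hpos.le (show Integrable (fun x => A₀ x a b + (1 : Matrix _ _ ℂ) a b) _ from
      hA.add (integrable_const _)) (hB.const_mul lam),
    scalarCoeff_add hpos.le hA (integrable_const _), scalarCoeff_const hX, if_pos rfl,
    scalarCoeff_const_mul]

lemma IsFirstOrderForm.integral_trace (hX : X = 2 * Real.pi)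
    (h : IsFirstOrderForm X A₁ A₀ B₀ lam 𝔸) (hA₁ : IsL2Coeff X A₁) :
    ∫ x in (0)..X, (𝔸 x - 1).trace =
      -(X * (mean X A₁ + (2 : ℂ) • (1 : Matrix (Fin n) (Fin n) ℂ)).trace) := by
  have h2 : HasL2Entries X fun x => A₁ x + (2 : ℂ) • (1 : Matrix (Fin n) (Fin n) ℂ) :=
    fun i j => (hA₁.2 i j).add (memLp_const_perMeasure _)
  simp only [h.trace_sub_one, intervalIntegral.integral_neg]
  rw [HillEvans.integral_trace hX h2, trace_mean_add_two hX hA₁]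

/-- The block Toeplitz matrix of the Fourier coefficients of `M`, truncated to `|j| ≤ J`. -/
def toeplitz (X : ℝ) {m : Type} [Fintype m] [DecidableEq m] (J : ℕ) (M : ℝ → Matrix m m ℂ) :
    Matrix (Finset.Icc (-(J : ℤ)) J × m) (Finset.Icc (-(J : ℤ)) J × m) ℂ :=
  Matrix.of fun p q => matCoeff X M ((p.1 : ℤ) - q.1) p.2 q.2

/-- The truncated Fourier multiplier with symbol `f`. -/
def fourierDiag (m : Type) [DecidableEq m] (J : ℕ) (f : ℤ → ℂ) :
    Matrix (Finset.Icc (-(J : ℤ)) J × m) (Finset.Icc (-(J : ℤ)) J × m) ℂ :=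
  Matrix.diagonal fun p => f p.1

lemma det_fourierDiag (m : Type) [Fintype m] [DecidableEq m] (J : ℕ) (f : ℤ → ℂ) :
    (fourierDiag m J f).det = ∏ j ∈ Finset.Icc (-(J : ℤ)) J, f j ^ Fintype.card m := by
  rw [fourierDiag, Matrix.det_diagonal, Fintype.prod_prod_type,
    ← Finset.prod_coe_sort (Finset.Icc (-(J : ℤ)) J)]
  simp

/-- The truncation of `∂ₓ² + ∂ₓ A₁ + A₀ - lam B₀` to the Fourier modes with `|j| ≤ J`. -/
def secondOrderMatrix (X : ℝ) (A₁ A₀ B₀ : ℝ → Matrix (Fin n) (Fin n) ℂ) (lam : ℂ) (J : ℕ) :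
    Matrix (Finset.Icc (-(J : ℤ)) J × Fin n) (Finset.Icc (-(J : ℤ)) J × Fin n) ℂ :=
  let D := fourierDiag (Fin n) J fun j => Complex.I * j
  D * D + D * toeplitz X J A₁ + toeplitz X J (fun x => A₀ x + 1 - lam • B₀ x) - 1

lemma scalarCoeff_one_apply (hX : X = 2 * Real.pi) {J : ℕ}
    (p q : Finset.Icc (-(J : ℤ)) J × Fin n) :
    scalarCoeff X (fun _ => (1 : Matrix (Fin n) (Fin n) ℂ) p.2 q.2) ((p.1 : ℤ) - q.1) =
      (1 : Matrix (Finset.Icc (-(J : ℤ)) J × Fin n) _ ℂ) p q := by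
  rw [scalarCoeff_const hX]
  simp only [Matrix.one_apply, Prod.ext_iff, sub_eq_zero, Subtype.ext_iff]
  split_ifs <;> simp_all

/-- The truncation of `∂ₓ - 𝔸` is a linearization of that of the second-order operator. -/
lemma IsFirstOrderForm.det_truncation (hX : X = 2 * Real.pi)
    (h : IsFirstOrderForm X A₁ A₀ B₀ lam 𝔸) (hA₁ : IsL2Coeff X A₁) (hA₀ : IsL2Coeff X A₀)
    (hB₀ : IsL2Coeff X B₀) (J : ℕ) :
    (fourierDiag (Fin n ⊕ Fin n) J (fun j => Complex.I * j - 1) -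
      toeplitz X J fun x => 𝔸 x - 1).det = (secondOrderMatrix X A₁ A₀ B₀ lam J).det := by
  have hpos : (0 : ℝ) < X := by rw [hX]; positivity
  let e : (Finset.Icc (-(J : ℤ)) J × (Fin n ⊕ Fin n)) ≃
    (Finset.Icc (-(J : ℤ)) J × Fin n) ⊕ (Finset.Icc (-(J : ℤ)) J × Fin n) :=
    Equiv.prodSumDistrib _ _ _
  set D := fourierDiag (Fin n) J fun j => Complex.I * j with hD
  set a := toeplitz X J A₁ with ha
  set c := toeplitz X J (fun x => A₀ x + 1 - lam • B₀ x) with hc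
  have hDs : ∀ p q : Finset.Icc (-(J : ℤ)) J × Fin n, D p q =
      if p = q then Complex.I * (p.1 : ℤ) else 0 := fun p q => Matrix.diagonal_apply _ _ _
  have hi : ∀ {M : ℝ → Matrix (Fin n) (Fin n) ℂ} (_ : IsL2Coeff X M) i j,
    Integrable (fun x => M x i j) (perMeasure X) := fun hM i j => integrable_matrix_entry hM.2 i j
  have hQi := fun i j =>
    integrable_matrix_entry (hasL2Entries_zeroOrder (lam := lam) hA₀ hB₀) i j
  have hone : ∀ (x : ℂ), Integrable (fun _ : ℝ => x) (perMeasure X) := integrable_const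
  have hll : ∀ p q : Finset.Icc (-(J : ℤ)) J × Fin n,
      (fourierDiag (Fin n ⊕ Fin n) J (fun j => Complex.I * j - 1)) (p.1, Sum.inl p.2)
        (q.1, Sum.inl q.2) = D p q - (1 : Matrix _ _ ℂ) p q := by
    intro p q
    rw [hDs, fourierDiag, Matrix.diagonal_apply, Matrix.one_apply]
    simp only [Prod.ext_iff, Sum.inl.injEq]
    split_ifs <;> simp
  have hrr : ∀ p q : Finset.Icc (-(J : ℤ)) J × Fin n,
      (fourierDiag (Fin n ⊕ Fin n) J (fun j => Complex.I * j - 1)) (p.1, Sum.inr p.2)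
        (q.1, Sum.inr q.2) = D p q - (1 : Matrix _ _ ℂ) p q := by
    intro p q
    rw [hDs, fourierDiag, Matrix.diagonal_apply, Matrix.one_apply]
    simp only [Prod.ext_iff, Sum.inr.injEq]
    split_ifs <;> simp
  have hlr : ∀ p q : Finset.Icc (-(J : ℤ)) J × Fin n,
      (fourierDiag (Fin n ⊕ Fin n) J (fun j => Complex.I * j - 1)) (p.1, Sum.inl p.2)
        (q.1, Sum.inr q.2) = 0 := by
    intro p q
    rw [fourierDiag, Matrix.diagonal_apply]
    simp
  have hrl : ∀ p q : Finset.Icc (-(J : ℤ)) J × Fin n,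
      (fourierDiag (Fin n ⊕ Fin n) J (fun j => Complex.I * j - 1)) (p.1, Sum.inr p.2)
        (q.1, Sum.inl q.2) = 0 := by
    intro p q
    rw [fourierDiag, Matrix.diagonal_apply]
    simp
  have hS : ∀ p q, a p q = scalarCoeff X (fun x => A₁ x p.2 q.2) ((p.1 : ℤ) - q.1) :=
    fun p q => rfl
  have hSc : ∀ p q, c p q = scalarCoeff X (fun x => (A₀ x + 1 - lam • B₀ x) p.2 q.2)
    ((p.1 : ℤ) - q.1) := fun p q => rfl
  have hsec : secondOrderMatrix X A₁ A₀ B₀ lam J = D * D + D * a + c - 1 := rfl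
  rw [← Matrix.det_reindex_self e, hsec]
  rcases h with ⟨A₁', hmem, hder⟩ | _
  · have hblock : Matrix.reindex e e (fourierDiag (Fin n ⊕ Fin n) J (fun j => Complex.I * j - 1) -
        toeplitz X J fun x => Matrix.fromBlocks 0 1 (lam • B₀ x - A₀ x - A₁' x) (-A₁ x) - 1) =
        Matrix.fromBlocks D (-1) (c - 1 + toeplitz X J A₁') (D + a) := by
      ext (p | p) (q | q)
      · change fourierDiag (Fin n ⊕ Fin n) J _ (p.1, Sum.inl p.2) (q.1, Sum.inl q.2) -
          scalarCoeff X (fun x => (0 : ℂ) - (1 : Matrix (Fin n ⊕ Fin n) (Fin n ⊕ Fin n) ℂ) (Sum.inl p.2)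
            (Sum.inl q.2)) ((p.1 : ℤ) - q.1) = D p q
        have : (1 : Matrix (Fin n ⊕ Fin n) (Fin n ⊕ Fin n) ℂ) (Sum.inl p.2) (Sum.inl q.2) =
          (1 : Matrix (Fin n) (Fin n) ℂ) p.2 q.2 := by simp [Matrix.one_apply]
        simp only [zero_sub, this]
        rw [hll, scalarCoeff_neg, scalarCoeff_one_apply hX]
        ring
      · change fourierDiag (Fin n ⊕ Fin n) J _ (p.1, Sum.inl p.2) (q.1, Sum.inr q.2) -
          scalarCoeff X (fun x => (1 : Matrix (Fin n) (Fin n) ℂ) p.2 q.2 -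
            (1 : Matrix (Fin n ⊕ Fin n) (Fin n ⊕ Fin n) ℂ) (Sum.inl p.2)
            (Sum.inr q.2)) ((p.1 : ℤ) - q.1) = (-1 : Matrix _ _ ℂ) p q
        have : (1 : Matrix (Fin n ⊕ Fin n) (Fin n ⊕ Fin n) ℂ) (Sum.inl p.2) (Sum.inr q.2) = 0 := by
          simp
        simp only [sub_zero, this]
        rw [hlr, scalarCoeff_one_apply hX, Matrix.neg_apply]
        ring
      · change fourierDiag (Fin n ⊕ Fin n) J _ (p.1, Sum.inr p.2) (q.1, Sum.inl q.2) -
          scalarCoeff X (fun x => (lam • B₀ x - A₀ x - A₁' x) p.2 q.2 -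
            (1 : Matrix (Fin n ⊕ Fin n) (Fin n ⊕ Fin n) ℂ) (Sum.inr p.2)
            (Sum.inl q.2)) ((p.1 : ℤ) - q.1) = c p q - (1 : Matrix _ _ ℂ) p q +
              scalarCoeff X (fun x => A₁' x p.2 q.2) ((p.1 : ℤ) - q.1)
        have : ∀ x, (lam • B₀ x - A₀ x - A₁' x) p.2 q.2 -
            (1 : Matrix (Fin n ⊕ Fin n) (Fin n ⊕ Fin n) ℂ) (Sum.inr p.2) (Sum.inl q.2) =
            (1 : Matrix (Fin n) (Fin n) ℂ) p.2 q.2 -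
              (A₀ x + 1 - lam • B₀ x) p.2 q.2 - A₁' x p.2 q.2 := by
          intro x
          simp only [Matrix.sub_apply, Matrix.add_apply, Matrix.one_apply, reduceCtorEq, if_false]
          ring
        simp only [this]
        rw [hrl, scalarCoeff_sub hpos.le (show Integrable (fun x =>
          (1 : Matrix (Fin n) (Fin n) ℂ) p.2 q.2 - (A₀ x + 1 - lam • B₀ x) p.2 q.2) _ from
            (hone _).sub (hQi _ _)) (hi hmem _ _),
          scalarCoeff_sub hpos.le (hone _) (hQi _ _), scalarCoeff_one_apply hX, hSc]
        ring
      · change fourierDiag (Fin n ⊕ Fin n) J _ (p.1, Sum.inr p.2) (q.1, Sum.inr q.2) -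
          scalarCoeff X (fun x => -A₁ x p.2 q.2 - (1 : Matrix (Fin n ⊕ Fin n) (Fin n ⊕ Fin n) ℂ) (Sum.inr p.2)
            (Sum.inr q.2)) ((p.1 : ℤ) - q.1) = D p q + a p q
        have : (1 : Matrix (Fin n ⊕ Fin n) (Fin n ⊕ Fin n) ℂ) (Sum.inr p.2) (Sum.inr q.2) =
          (1 : Matrix (Fin n) (Fin n) ℂ) p.2 q.2 := by simp [Matrix.one_apply]
        simp only [this]
        rw [hrr, scalarCoeff_sub hpos.le (show Integrable (fun x => -A₁ x p.2 q.2) _ from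
          (hi hA₁ _ _).neg) (hone _), scalarCoeff_neg,
          scalarCoeff_one_apply hX, hS]
        ring
    -- The coefficient of `A₁'` at `j - k` carries the factor `i(j - k)`. As `D` is diagonal, `∂ₓA₁
    -- = [∂ₓ, A₁]` persists exactly after truncation.
    have hcomm : toeplitz X J A₁' = D * a - a * D := by
      ext p q
      rw [Matrix.sub_apply, hD, fourierDiag, Matrix.diagonal_mul, Matrix.mul_diagonal, hS]
      refine (scalarCoeff_weakDeriv hX hder _ _ _).trans ?_
      push_cast
      ring
    rw [hblock, det_fromBlocks_neg_one, hcomm]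
    congr 1
    -- The commutator reverses the order in `(D + a) D`, leaving `D² + D a + c - 1`.
    noncomm_ring
  · have hblock : Matrix.reindex e e (fourierDiag (Fin n ⊕ Fin n) J (fun j => Complex.I * j - 1) -
        toeplitz X J fun x => Matrix.fromBlocks (-A₁ x) 1 (lam • B₀ x - A₀ x) 0 - 1) =
        Matrix.fromBlocks (D + a) (-1) (c - 1) D := by
      ext (p | p) (q | q)
      · change fourierDiag (Fin n ⊕ Fin n) J _ (p.1, Sum.inl p.2) (q.1, Sum.inl q.2) -
          scalarCoeff X (fun x => -A₁ x p.2 q.2 - (1 : Matrix (Fin n ⊕ Fin n) (Fin n ⊕ Fin n) ℂ) (Sum.inl p.2)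
            (Sum.inl q.2)) ((p.1 : ℤ) - q.1) = D p q + a p q
        have : (1 : Matrix (Fin n ⊕ Fin n) (Fin n ⊕ Fin n) ℂ) (Sum.inl p.2) (Sum.inl q.2) =
          (1 : Matrix (Fin n) (Fin n) ℂ) p.2 q.2 := by simp [Matrix.one_apply]
        simp only [this]
        rw [hll, scalarCoeff_sub hpos.le (show Integrable (fun x => -A₁ x p.2 q.2) _ from
          (hi hA₁ _ _).neg) (hone _), scalarCoeff_neg,
          scalarCoeff_one_apply hX, hS]
        ring
      · change fourierDiag (Fin n ⊕ Fin n) J _ (p.1, Sum.inl p.2) (q.1, Sum.inr q.2) -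
          scalarCoeff X (fun x => (1 : Matrix (Fin n) (Fin n) ℂ) p.2 q.2 -
            (1 : Matrix (Fin n ⊕ Fin n) (Fin n ⊕ Fin n) ℂ) (Sum.inl p.2)
            (Sum.inr q.2)) ((p.1 : ℤ) - q.1) = (-1 : Matrix _ _ ℂ) p q
        have : (1 : Matrix (Fin n ⊕ Fin n) (Fin n ⊕ Fin n) ℂ) (Sum.inl p.2) (Sum.inr q.2) = 0 := by
          simp
        simp only [sub_zero, this]
        rw [hlr, scalarCoeff_one_apply hX, Matrix.neg_apply]
        ring
      · change fourierDiag (Fin n ⊕ Fin n) J _ (p.1, Sum.inr p.2) (q.1, Sum.inl q.2) -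
          scalarCoeff X (fun x => (lam • B₀ x - A₀ x) p.2 q.2 -
            (1 : Matrix (Fin n ⊕ Fin n) (Fin n ⊕ Fin n) ℂ) (Sum.inr p.2)
            (Sum.inl q.2)) ((p.1 : ℤ) - q.1) = c p q - (1 : Matrix _ _ ℂ) p q
        have : ∀ x, (lam • B₀ x - A₀ x) p.2 q.2 -
            (1 : Matrix (Fin n ⊕ Fin n) (Fin n ⊕ Fin n) ℂ) (Sum.inr p.2) (Sum.inl q.2) =
            (1 : Matrix (Fin n) (Fin n) ℂ) p.2 q.2 - (A₀ x + 1 - lam • B₀ x) p.2 q.2 := by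
          intro x
          simp only [Matrix.sub_apply, Matrix.add_apply, Matrix.one_apply, reduceCtorEq, if_false]
          ring
        simp only [this]
        rw [hrl, scalarCoeff_sub hpos.le (hone _) (hQi _ _), scalarCoeff_one_apply hX, hSc]
        ring
      · change fourierDiag (Fin n ⊕ Fin n) J _ (p.1, Sum.inr p.2) (q.1, Sum.inr q.2) -
          scalarCoeff X (fun x => (0 : ℂ) - (1 : Matrix (Fin n ⊕ Fin n) (Fin n ⊕ Fin n) ℂ) (Sum.inr p.2)
            (Sum.inr q.2)) ((p.1 : ℤ) - q.1) = D p q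
        have : (1 : Matrix (Fin n ⊕ Fin n) (Fin n ⊕ Fin n) ℂ) (Sum.inr p.2) (Sum.inr q.2) =
          (1 : Matrix (Fin n) (Fin n) ℂ) p.2 q.2 := by simp [Matrix.one_apply]
        simp only [zero_sub, this]
        rw [hrr, scalarCoeff_neg, scalarCoeff_one_apply hX]
        ring
    rw [hblock, det_fromBlocks_neg_one]
    congr 1
    noncomm_ring

end FirstOrderForms

/-! ### The product for `ε` and the sums for `δ` and `δ̂`. -/

section Constants

lemma one_sub_two_div (j : ℤ) :
    1 - 2 / (Complex.I * (j : ℂ) + 1) = (Complex.I * j - 1) / (Complex.I * j + 1) := by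
  have h : Complex.I * (j : ℂ) + 1 ≠ 0 := by simpa using I_mul_int_ne (j := j) one_ne_zero
  field_simp
  ring

lemma Icc_neg_succ (J : ℕ) : Finset.Icc (-((J + 1 : ℕ) : ℤ)) ((J + 1 : ℕ) : ℤ) =
    insert (-((J : ℤ) + 1)) (insert ((J : ℤ) + 1) (Finset.Icc (-(J : ℤ)) J)) := by
  ext j
  simp only [Finset.mem_Icc, Finset.mem_insert]
  push_cast
  omega

/-- The factors `(ij - 1)/(ij + 1)` for `j` and `-j` are reciprocal and `j = 0` gives `-1`, so the
partial products are constant in `J`. -/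
lemma epsilonProd_eq (n J : ℕ) : epsilonProd n J = (-1) ^ n := by
  have h : ∏ j ∈ Finset.Icc (-(J : ℤ)) (J : ℤ), (1 - 2 / (Complex.I * (j : ℂ) + 1)) = -1 := by
    induction J with
    | zero => norm_num
    | succ J ih =>
      rw [Icc_neg_succ, Finset.prod_insert, Finset.prod_insert, ih, one_sub_two_div,
        one_sub_two_div]
      · have h1 : Complex.I * ((J : ℂ) + 1) + 1 ≠ 0 := by
          have := I_mul_int_ne (j := (J : ℤ) + 1) one_ne_zero
          push_cast at this; exact this
        have h2 : -(Complex.I * ((J : ℂ) + 1)) + 1 ≠ 0 := by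
          have := I_mul_int_ne (j := -((J : ℤ) + 1)) one_ne_zero
          push_cast at this; rwa [mul_neg] at this
        push_cast
        rw [mul_neg]
        field_simp
        ring
      · simp
      · simp only [Finset.mem_insert, Finset.mem_Icc]
        omega
  rw [epsilonProd, Finset.prod_pow, h]

lemma tendsto_epsilonProd (n : ℕ) : Tendsto (epsilonProd n) atTop (𝓝 ((-1) ^ n)) := by
  have : epsilonProd n = fun _ => (-1) ^ n := funext (epsilonProd_eq n)
  rw [this]
  exact tendsto_const_nhds

lemma epsilon_eq (n : ℕ) : epsilon n = (-1) ^ n := (tendsto_epsilonProd n).limUnder_eq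

lemma summable_inv_sq_add_one : Summable fun j : ℤ => 1 / ((j : ℂ) ^ 2 + 1) := by
  have h1 : Summable fun j : ℤ => 1 / ((j : ℝ)) ^ 2 :=
    Real.summable_one_div_int_pow.2 one_lt_two
  refine Summable.of_norm_bounded_eventually h1 ?_
  rw [eventually_cofinite]
  -- The comparison fails only at `j = 0`, where `1 / 0²` is `0` by convention.
  refine (Set.finite_singleton (0 : ℤ)).subset fun j hj => ?_
  by_contra h0
  refine hj ?_
  have h0' : (0 : ℝ) < (j : ℝ) ^ 2 := by
    have : j ≠ 0 := h0
    positivity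
  have h2 : ‖1 / ((j : ℂ) ^ 2 + 1)‖ = 1 / ((j : ℝ) ^ 2 + 1) := by
    have : (1 / ((j : ℂ) ^ 2 + 1)) = ((1 / ((j : ℝ) ^ 2 + 1) : ℝ) : ℂ) := by push_cast; rfl
    rw [this, Complex.norm_real, Real.norm_of_nonneg (by positivity)]
  rw [h2]
  exact one_div_le_one_div_of_le h0' (by linarith)

/-- The odd part of `1 / (j² + i j)`. -/
def oddPart (j : ℤ) : ℂ := Complex.I / (j * ((j : ℂ) ^ 2 + 1))

lemma summable_oddPart : Summable oddPart := by
  refine Summable.of_norm_bounded summable_inv_sq_add_one.norm fun j => ?_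
  rcases eq_or_ne j 0 with rfl | hj
  · simp [oddPart]
  rw [oddPart, norm_div, norm_div, Complex.norm_I, norm_one, norm_mul]
  have h1 : (1 : ℝ) ≤ ‖(j : ℂ)‖ := by
    rw [Complex.norm_intCast]
    exact_mod_cast Int.one_le_abs hj
  have h2 : 0 < ‖(j : ℂ) ^ 2 + 1‖ := norm_pos_iff.2 (int_sq_add_one_ne j)
  exact one_div_le_one_div_of_le h2 (by nlinarith)

lemma tsum_oddPart : ∑' j, oddPart j = 0 := by
  have h1 : ∑' j, oddPart (-j) = ∑' j, oddPart j := (Equiv.neg ℤ).tsum_eq oddPart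
  have h2 : ∀ j, oddPart (-j) = -oddPart j := by
    intro j
    simp only [oddPart, Int.cast_neg, neg_sq, neg_mul, div_neg]
  simp only [h2, tsum_neg] at h1
  exact self_eq_neg.1 h1.symm

lemma one_div_sq_add_I_mul {j : ℤ} (hj : j ≠ 0) :
    1 / ((j : ℂ) ^ 2 + Complex.I * j) = 1 / ((j : ℂ) ^ 2 + 1) - oddPart j := by
  have hj' : (j : ℂ) ≠ 0 := by exact_mod_cast hj
  have h1 := int_sq_add_one_ne j
  have h2 : (j : ℂ) + Complex.I ≠ 0 := by
    intro h
    have := congrArg Complex.im h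
    simp at this
  have h3 : (j : ℂ) ^ 2 + Complex.I * j = j * (j + Complex.I) := by ring
  have h4 : (j : ℂ) ^ 2 + 1 = (j + Complex.I) * (j - Complex.I) := by
    ring_nf; rw [Complex.I_sq]; ring
  have h5 : (j : ℂ) - Complex.I ≠ 0 := fun h => h1 (by rw [h4, h, mul_zero])
  rw [oddPart, h3, h4]
  field_simp

/-- The odd part sums to zero, so the sum in `δ̂`, with its extra `1`, equals the sum in `δ`. -/
lemma hasSum_one_div_sq_add_I_mul :
    HasSum (fun j : {j : ℤ // j ≠ 0} => 1 / ((j : ℂ) ^ 2 + Complex.I * (j : ℂ)))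
      ((∑' j : ℤ, 1 / ((j : ℂ) ^ 2 + 1)) - 1) := by
  have h1 := summable_inv_sq_add_one.hasSum.sub summable_oddPart.hasSum
  rw [tsum_oddPart, sub_zero] at h1
  have h2 := h1.sub (hasSum_ite_eq (0 : ℤ) (1 : ℂ))
  -- At `j = 0` the even part is `1` and `oddPart 0` is `0` by division by zero, so subtracting the
  -- indicator removes exactly this index.
  have hsupp : Function.support (fun j : ℤ => 1 / ((j : ℂ) ^ 2 + 1) - oddPart j -
      if j = 0 then (1 : ℂ) else 0) ⊆ {j : ℤ | j ≠ 0} := by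
    intro j hj h0
    subst h0
    exact hj (by simp [oddPart])
  have h3 := (hasSum_subtype_iff_of_support_subset hsupp).2 h2
  refine (congrArg (HasSum · _) (funext fun j => ?_)).mp h3
  simp only [Function.comp_apply]
  rw [if_neg j.2, sub_zero, one_div_sq_add_I_mul j.2]

lemma deltaHat_eq {n : ℕ} (X : ℝ) (A₁ : ℝ → Matrix (Fin n) (Fin n) ℂ) :
    deltaHat X A₁ = (mean X A₁ + (2 : ℂ) • (1 : Matrix (Fin n) (Fin n) ℂ)).trace *
      ∑' j : ℤ, 1 / ((j : ℂ) ^ 2 + 1) := by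
  rw [deltaHat, hasSum_one_div_sq_add_I_mul.tsum_eq]
  ring

/-- The partial sums of `∑ 1 / (j² + 1)`. -/
def partialSum (J : ℕ) : ℂ := ∑ j ∈ Finset.Icc (-(J : ℤ)) J, 1 / ((j : ℂ) ^ 2 + 1)

lemma tendsto_partialSum :
    Tendsto partialSum atTop (𝓝 (∑' j : ℤ, 1 / ((j : ℂ) ^ 2 + 1))) :=
  (summable_inv_sq_add_one.hasSum.comp Finset.tendsto_Icc_neg :)

lemma sum_Icc_odd {f : ℤ → ℂ} (hf : ∀ j, f (-j) = -f j) (J : ℕ) :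
    ∑ j ∈ Finset.Icc (-(J : ℤ)) J, f j = 0 := by
  have h : ∑ j ∈ Finset.Icc (-(J : ℤ)) J, f (-j) = ∑ j ∈ Finset.Icc (-(J : ℤ)) J, f j := by
    refine Finset.sum_nbij' (fun j => -j) (fun j => -j) ?_ ?_ ?_ ?_ ?_ <;>
      simp only [Finset.mem_Icc, neg_neg, implies_true] <;> omega
  simp only [hf, Finset.sum_neg_distrib] at h
  exact self_eq_neg.1 h.symm

end Constants

/-! ### The exact relation between the two Galerkin determinants. -/

section Truncations

variable {X : ℝ} {n : ℕ} {A₁ A₀ B₀ : ℝ → Matrix (Fin n) (Fin n) ℂ} {lam : ℂ}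

lemma I_mul_int_sub_one_ne (j : ℤ) : Complex.I * (j : ℂ) - 1 ≠ 0 := by
  have := I_mul_int_ne (j := j) (r := -1) (by norm_num)
  push_cast at this
  rwa [← sub_eq_add_neg] at this

/-- The Galerkin determinant of `I + K`. -/
lemma IsBirmanSchwingerOp.finDet2_galerkin (hX : X = 2 * Real.pi)
    {K : L2 X (Fin n) →L[ℂ] L2 X (Fin n)} (hK : IsBirmanSchwingerOp X A₁ A₀ B₀ lam K)
    (hA₁ : IsL2Coeff X A₁) (hA₀ : IsL2Coeff X A₀) (hB₀ : IsL2Coeff X B₀) (J : ℕ) :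
    (fourierDiag (Fin n) J fun j => -((j : ℂ) ^ 2 + 1)).det *
      finDet2 (galerkin (-K) (fourierSpace X (Fin n) J)) =
      (secondOrderMatrix X A₁ A₀ B₀ lam J).det *
        Complex.exp (partialSum J * (mean X A₀ + 1 - lam • mean X B₀).trace) := by
  rw [finDet2_galerkin_fourierSpace hX, matDet2, ← mul_assoc, ← Matrix.det_mul]
  set M := Matrix.of fun p q : Finset.Icc (-(J : ℤ)) J × Fin n =>
        inner ℂ (modeVec X (p.1 : ℤ) p.2) ((-K) (modeVec X (q.1 : ℤ) q.2)) with hM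
  have hent : ∀ p q, ((p.1 : ℤ) ^ 2 + 1 : ℂ) * M p q =
      Complex.I * (p.1 : ℤ) * matCoeff X A₁ ((p.1 : ℤ) - q.1) p.2 q.2 +
        matCoeff X (fun x => A₀ x + 1 - lam • B₀ x) ((p.1 : ℤ) - q.1) p.2 q.2 := fun p q =>
    hK.inner_modeVec hX hA₁.2 (hasL2Entries_zeroOrder hA₀ hB₀) _ _ _ _
  congr 2
  · rw [secondOrderMatrix]
    ext p q
    simp only [fourierDiag, Matrix.diagonal_mul, Matrix.sub_apply, Matrix.add_apply,
      Matrix.diagonal_mul_diagonal, mul_sub, neg_mul, hent]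
    simp only [toeplitz, Matrix.of_apply, Matrix.one_apply, Matrix.diagonal_apply]
    split_ifs
    · linear_combination (-(p.1 : ℤ) ^ 2 : ℂ) * Complex.I_sq
    · ring
  · have hdiag : ∀ p, M p p = Complex.I * (p.1 : ℤ) / ((p.1 : ℤ) ^ 2 + 1) * mean X A₁ p.2 p.2 +
        1 / ((p.1 : ℤ) ^ 2 + 1) * mean X (fun x => A₀ x + 1 - lam • B₀ x) p.2 p.2 := by
      intro p
      have h1 := hent p p
      have h2 := int_sq_add_one_ne (p.1 : ℤ)
      rw [sub_self, matCoeff_zero, matCoeff_zero] at h1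
      field_simp
      linear_combination h1
    rw [Matrix.trace]
    simp only [Matrix.diag_apply, hdiag]
    rw [Fintype.sum_prod_type]
    simp only [Finset.sum_add_distrib, ← Finset.mul_sum]
    -- The contribution of `A₁` to the trace carries the odd factor `ij / (j² + 1)` and cancels on
    -- the symmetric window; this is why `δ` does not involve `A₁`.
    rw [← mean_zeroOrder hX hA₀ hB₀, ← Finset.sum_mul, ← Finset.sum_mul,
      Finset.sum_coe_sort (Finset.Icc (-(J : ℤ)) J) fun j => Complex.I * (j : ℂ) / ((j : ℂ) ^ 2 + 1),
      Finset.sum_coe_sort (Finset.Icc (-(J : ℤ)) J) fun j => 1 / ((j : ℂ) ^ 2 + 1),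
      sum_Icc_odd (fun j => by push_cast; ring)]
    simp [partialSum, Matrix.trace]

/-- The Galerkin determinant of `I - 𝕂`. -/
lemma IsFirstOrderForm.finDet2_galerkin (hX : X = 2 * Real.pi)
    {𝔸 : ℝ → Matrix (Fin n ⊕ Fin n) (Fin n ⊕ Fin n) ℂ} (h : IsFirstOrderForm X A₁ A₀ B₀ lam 𝔸)
    {T : L2 X (Fin n ⊕ Fin n) →L[ℂ] L2 X (Fin n ⊕ Fin n)} (hT : IsFirstOrderOp X 𝔸 T)
    (hA₁ : IsL2Coeff X A₁) (hA₀ : IsL2Coeff X A₀) (hB₀ : IsL2Coeff X B₀) (J : ℕ) :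
    (fourierDiag (Fin n ⊕ Fin n) J fun j => Complex.I * j - 1).det *
      finDet2 (galerkin T (fourierSpace X (Fin n ⊕ Fin n) J)) =
      (secondOrderMatrix X A₁ A₀ B₀ lam J).det * Complex.exp (partialSum J *
        (mean X A₁ + (2 : ℂ) • (1 : Matrix (Fin n) (Fin n) ℂ)).trace) := by
  have hpos : (0 : ℝ) < X := by rw [hX]; positivity
  have hX0 : (X : ℂ) ≠ 0 := by exact_mod_cast hpos.ne'
  rw [finDet2_galerkin_fourierSpace hX, matDet2, ← mul_assoc, ← Matrix.det_mul,
    ← h.det_truncation hX hA₁ hA₀ hB₀]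
  set M := Matrix.of fun p q : Finset.Icc (-(J : ℤ)) J × (Fin n ⊕ Fin n) =>
        inner ℂ (modeVec X (p.1 : ℤ) p.2) (T (modeVec X (q.1 : ℤ) q.2)) with hM
  have hent : ∀ p q, (Complex.I * (p.1 : ℤ) - 1 : ℂ) * M p q =
      matCoeff X (fun x => 𝔸 x - 1) ((p.1 : ℤ) - q.1) p.2 q.2 := fun p q =>
    hT.inner_modeVec hX _ _ _ _
  congr 2
  · rw [mul_sub, mul_one]
    congr 1
    ext p q
    rw [fourierDiag, Matrix.diagonal_mul, hent]
    rfl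
  · have hdiag : ∀ p, M p p = 1 / (Complex.I * (p.1 : ℤ) - 1) *
        mean X (fun x => 𝔸 x - 1) p.2 p.2 := by
      intro p
      have h1 := hent p p
      have h2 := I_mul_int_sub_one_ne (p.1 : ℤ)
      rw [sub_self, matCoeff_zero] at h1
      rw [← h1]
      field_simp
    have htr : (mean X fun x => 𝔸 x - 1).trace =
        -(mean X A₁ + (2 : ℂ) • (1 : Matrix (Fin n) (Fin n) ℂ)).trace := by
      have h1 := h.integral_trace hX hA₁
      rw [HillEvans.integral_trace hX (h.hasL2Entries hA₁ hA₀ hB₀)] at h1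
      refine mul_left_cancel₀ hX0 ?_
      rw [h1]; ring
    -- `1/(ij - 1) = -(ij + 1)/(j² + 1)`, whose odd part cancels on the symmetric window. The minus
    -- sign meets that of `tr (𝔸 - 1)`.
    have hsum : ∑ j ∈ Finset.Icc (-(J : ℤ)) J, 1 / (Complex.I * (j : ℂ) - 1) = -partialSum J := by
      have h3 : ∀ j : ℤ, 1 / (Complex.I * (j : ℂ) - 1) =
          -(Complex.I * j / ((j : ℂ) ^ 2 + 1)) - 1 / ((j : ℂ) ^ 2 + 1) := by
        intro j
        have h4 := I_mul_int_sub_one_ne j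
        have h5 := int_sq_add_one_ne j
        field_simp
        ring_nf
        rw [Complex.I_sq]
        ring
      simp only [h3, Finset.sum_sub_distrib, Finset.sum_neg_distrib]
      rw [sum_Icc_odd (fun j => by push_cast; ring), partialSum]
      ring
    rw [Matrix.trace]
    simp only [Matrix.diag_apply, hdiag]
    rw [Fintype.sum_prod_type]
    simp only [← Finset.mul_sum]
    have h6 : ∑ a, mean X (fun x => 𝔸 x - 1) a a = (mean X fun x => 𝔸 x - 1).trace := rfl
    rw [h6, htr, ← Finset.sum_mul,
      Finset.sum_coe_sort (Finset.Icc (-(J : ℤ)) J) fun j => 1 / (Complex.I * (j : ℂ) - 1), hsum]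
    ring

/-- Since `-(j² + 1) = (ij - 1)(ij + 1)`, the ratio is the product of `((ij - 1)/(ij + 1))^n`, the
partial product of `ε`. -/
lemma det_fourierDiag_ratio (n J : ℕ) :
    (fourierDiag (Fin n ⊕ Fin n) J fun j => Complex.I * j - 1).det =
      (-1) ^ n * (fourierDiag (Fin n) J fun j => -((j : ℂ) ^ 2 + 1)).det := by
  rw [det_fourierDiag, det_fourierDiag, ← epsilonProd_eq n J, epsilonProd, ← Finset.prod_mul_distrib]
  refine Finset.prod_congr rfl fun j _ => ?_
  rw [Fintype.card_sum, Fintype.card_fin, pow_add, ← mul_pow, ← mul_pow, one_sub_two_div]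
  congr 1
  have h : Complex.I * (j : ℂ) + 1 ≠ 0 := by simpa using I_mul_int_ne (j := j) one_ne_zero
  field_simp
  linear_combination (Complex.I * j ^ 3 - j ^ 2 : ℂ) * Complex.I_sq

lemma det_fourierDiag_ne_zero (n J : ℕ) :
    (fourierDiag (Fin n) J fun j => -((j : ℂ) ^ 2 + 1)).det ≠ 0 := by
  rw [det_fourierDiag]
  exact Finset.prod_ne_zero_iff.2 fun j _ => pow_ne_zero _ (neg_ne_zero.2 (int_sq_add_one_ne j))

/-- Both sides, after multiplication by nonzero diagonal determinants, equal the same `det L_J`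
times an exponential. That determinant is eliminated without division, so eigenvalues are not
excluded. -/
lemma finDet2_galerkin_eq (hX : X = 2 * Real.pi)
    {𝔸 : ℝ → Matrix (Fin n ⊕ Fin n) (Fin n ⊕ Fin n) ℂ} (h : IsFirstOrderForm X A₁ A₀ B₀ lam 𝔸)
    {T : L2 X (Fin n ⊕ Fin n) →L[ℂ] L2 X (Fin n ⊕ Fin n)} (hT : IsFirstOrderOp X 𝔸 T)
    {K : L2 X (Fin n) →L[ℂ] L2 X (Fin n)} (hK : IsBirmanSchwingerOp X A₁ A₀ B₀ lam K)
    (hA₁ : IsL2Coeff X A₁) (hA₀ : IsL2Coeff X A₀) (hB₀ : IsL2Coeff X B₀) (J : ℕ) :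
    finDet2 (galerkin (-K) (fourierSpace X (Fin n) J)) =
      Complex.exp ((mean X A₀ + 1 - lam • mean X B₀).trace * partialSum J -
        (mean X A₁ + (2 : ℂ) • (1 : Matrix (Fin n) (Fin n) ℂ)).trace * partialSum J) / (-1) ^ n *
        finDet2 (galerkin T (fourierSpace X (Fin n ⊕ Fin n) J)) := by
  have h1 := hK.finDet2_galerkin hX hA₁ hA₀ hB₀ J
  have h2 := h.finDet2_galerkin hX hT hA₁ hA₀ hB₀ J
  rw [det_fourierDiag_ratio] at h2
  refine mul_left_cancel₀ (det_fourierDiag_ne_zero n J) ?_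
  rw [h1, Complex.exp_sub]
  have h3 : ((-1 : ℂ)) ^ n * (-1) ^ n = 1 := by rw [← mul_pow]; simp
  have h4 : ((-1 : ℂ)) ^ n ≠ 0 := pow_ne_zero _ (by norm_num)
  have h5 := Complex.exp_ne_zero
    ((mean X A₁ + (2 : ℂ) • (1 : Matrix (Fin n) (Fin n) ℂ)).trace * partialSum J)
  rw [mul_comm (partialSum J) (mean X A₁ + _).trace] at h2
  rw [mul_comm (partialSum J)]
  generalize Complex.exp ((mean X A₀ + 1 - lam • mean X B₀).trace * partialSum J) = E₁
  generalize Complex.exp ((mean X A₁ + (2 : ℂ) • (1 : Matrix (Fin n) (Fin n) ℂ)).trace *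
    partialSum J) = E₂ at h2 h5 ⊢
  generalize (-1 : ℂ) ^ n = s at h2 h3 h4 ⊢
  field_simp
  linear_combination (-s * E₁) * h2 +
    (fourierDiag (Fin n) J fun j => -((j : ℂ) ^ 2 + 1)).det *
      finDet2 (galerkin T (fourierSpace X (Fin n ⊕ Fin n) J)) * E₁ * h3

end Truncations

/-! ### Passage to the limit and identification of the constants. -/

section Main

variable {X : ℝ} {n : ℕ} {A₁ A₀ B₀ : ℝ → Matrix (Fin n) (Fin n) ℂ} {lam : ℂ}
  {𝔸 : ℝ → Matrix (Fin n ⊕ Fin n) (Fin n ⊕ Fin n) ℂ}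

lemma birmanSchwingerOp_spec (hX : 0 < X) (hA₁ : IsL2Coeff X A₁) (hA₀ : IsL2Coeff X A₀)
    (hB₀ : IsL2Coeff X B₀) : IsBirmanSchwingerOp X A₁ A₀ B₀ lam (birmanSchwingerOp X A₁ A₀ B₀ lam) := by
  obtain ⟨T, hT, -⟩ := exists_birmanSchwingerOp hX hA₁.2 (hasL2Entries_zeroOrder hA₀ hB₀)
  have h : ∃ K, IsBirmanSchwingerOp X A₁ A₀ B₀ lam K := ⟨T, hT⟩
  rw [birmanSchwingerOp, dif_pos h]
  exact h.choose_spec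

/-- The Hilbert-Schmidt bound is known for the constructed operator; uniqueness transfers it to the
chosen one. -/
lemma hasDet2_birmanSchwingerOp (hX : X = 2 * Real.pi) (hA₁ : IsL2Coeff X A₁)
    (hA₀ : IsL2Coeff X A₀) (hB₀ : IsL2Coeff X B₀) :
    HasDet2 (-birmanSchwingerOp X A₁ A₀ B₀ lam) (evansD X A₁ A₀ B₀ lam) := by
  have hpos : 0 < X := by rw [hX]; positivity
  obtain ⟨T, hT, C, hC⟩ :=
    exists_birmanSchwingerOp hpos hA₁.2 (hasL2Entries_zeroOrder (lam := lam) hA₀ hB₀)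
  rw [evansD, (birmanSchwingerOp_spec hpos hA₁ hA₀ hB₀).unique hX hT]
  exact hC.neg.hasDet2 (isExhaustion_fourierSpace hX)

lemma firstOrderOp_spec (hX : 0 < X) (hM : HasL2Entries X fun x => 𝔸 x - 1) :
    IsFirstOrderOp X 𝔸 (firstOrderOp X 𝔸) := by
  obtain ⟨T, hT, -⟩ := exists_firstOrderOp hX hM
  have h : ∃ T, IsFirstOrderOp X 𝔸 T := ⟨T, hT⟩
  rw [firstOrderOp, dif_pos h]
  exact h.choose_spec

lemma fundamentalSolution_spec (hX : X = 2 * Real.pi) (hM : HasL2Entries X fun x => 𝔸 x - 1) :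
    IsFundamentalSolution X 𝔸 (fundamentalSolution X 𝔸) := by
  have hpos : 0 < X := by rw [hX]; positivity
  have h := (det2_firstOrder hpos (isExhaustion_fourierSpace hX) hM).1
  rw [fundamentalSolution, dif_pos h]
  exact h.choose_spec

lemma hasDet2_firstOrderOp (hX : X = 2 * Real.pi) (hM : HasL2Entries X fun x => 𝔸 x - 1) :
    HasDet2 (firstOrderOp X 𝔸) (evansF X 𝔸) := by
  have hpos : 0 < X := by rw [hX]; positivity
  obtain ⟨T, hT, ⟨C, hC⟩, -⟩ := exists_firstOrderOp hpos hM
  rw [evansF, (firstOrderOp_spec hpos hM).unique hX hT]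
  exact hC.hasDet2 (isExhaustion_fourierSpace hX)

lemma evansF_eq (hX : X = 2 * Real.pi) (hM : HasL2Entries X fun x => 𝔸 x - 1) :
    evansF X 𝔸 = Complex.exp (Complex.exp X / (1 - Complex.exp X) *
        ∫ y in (0)..X, (𝔸 y - 1).trace) *
      ((Complex.exp X - 1) ^ Fintype.card (Fin n ⊕ Fin n))⁻¹ * evansE X 𝔸 := by
  have hpos : 0 < X := by rw [hX]; positivity
  obtain ⟨T, hT, ⟨C, hC⟩, hker⟩ := exists_firstOrderOp hpos hM
  rw [evansF, (firstOrderOp_spec hpos hM).unique hX hT, evansE]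
  exact (det2_firstOrder hpos (isExhaustion_fourierSpace hX) hM).2 _
    (fundamentalSolution_spec hX hM) T C hC hker

/-- Both forms of `𝔸` have trace `-tr A₁`; this sign is absorbed by passing from `1 - e^X` to `e^X -
1`. -/
lemma gamma_eq (hX : X = 2 * Real.pi) (h : IsFirstOrderForm X A₁ A₀ B₀ lam 𝔸)
    (hA₁ : IsL2Coeff X A₁) :
    gamma X A₁ = Complex.exp (Complex.exp X / (1 - Complex.exp X) *
      ∫ y in (0)..X, (𝔸 y - 1).trace) := by
  rw [h.integral_trace hX hA₁, gamma, ← neg_sub (Complex.exp X) 1, div_neg, neg_mul_neg,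
    Matrix.trace_add, Matrix.trace_smul, Matrix.trace_one, Fintype.card_fin, smul_eq_mul]
  congr 1
  ring

/-- `D` and `F` agree up to an explicit factor. -/
lemma evansD_eq (hX : X = 2 * Real.pi) (h : IsFirstOrderForm X A₁ A₀ B₀ lam 𝔸)
    (hA₁ : IsL2Coeff X A₁) (hA₀ : IsL2Coeff X A₀) (hB₀ : IsL2Coeff X B₀) :
    evansD X A₁ A₀ B₀ lam =
      Complex.exp (delta X A₀ B₀ lam - deltaHat X A₁) / epsilon n * evansF X 𝔸 := by
  have hpos : 0 < X := by rw [hX]; positivity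
  have hM := h.hasL2Entries hA₁ hA₀ hB₀
  have hD := (hasDet2_birmanSchwingerOp (lam := lam) hX hA₁ hA₀ hB₀).tendsto
    (isExhaustion_fourierSpace hX)
  have hF := (hasDet2_firstOrderOp hX hM).tendsto (isExhaustion_fourierSpace hX)
  simp only [finDet2_galerkin_eq hX h (firstOrderOp_spec hpos hM)
    (birmanSchwingerOp_spec hpos hA₁ hA₀ hB₀) hA₁ hA₀ hB₀] at hD
  refine tendsto_nhds_unique hD (Tendsto.mul ?_ hF)
  rw [epsilon_eq, deltaHat_eq, delta]
  exact ((Complex.continuous_exp.tendsto _).comp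
    ((tendsto_partialSum.const_mul _).sub (tendsto_partialSum.const_mul _))).div_const _

lemma epsilon_ne_zero (n : ℕ) : epsilon n ≠ 0 := by
  rw [epsilon_eq]
  exact pow_ne_zero _ (by norm_num)

end Main

end HillEvans

end

theorem corollary5p5 (n : ℕ) (X : ℝ) (hX : X = 2 * Real.pi)
    (A₁ A₀ B₀ : ℝ → Matrix (Fin n) (Fin n) ℂ)
    (hA₁ : HillEvans.IsL2Coeff X A₁) (hA₀ : HillEvans.IsL2Coeff X A₀)
    (hB₀ : HillEvans.IsL2Coeff X B₀) :
    -- the constants are well defined and the factor does not vanish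
    (Summable fun j : {j : ℤ // j ≠ 0} => 1 / ((j : ℂ) ^ 2 + Complex.I * (j : ℂ))) ∧
    (Summable fun j : ℤ => 1 / ((j : ℂ) ^ 2 + 1)) ∧
    Tendsto (HillEvans.epsilonProd n) atTop (𝓝 (HillEvans.epsilon n)) ∧
    HillEvans.epsilon n ≠ 0 ∧
    (∀ lam : ℂ,
      Complex.exp (HillEvans.delta X A₀ B₀ lam - HillEvans.deltaHat X A₁) / HillEvans.epsilon n *
        HillEvans.gamma X A₁ * (Complex.exp X - 1) ^ (-(2 * (n : ℤ))) ≠ 0) ∧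
    -- `D` is well defined
    (∀ lam : ℂ,
      HillEvans.IsBirmanSchwingerOp X A₁ A₀ B₀ lam
        (HillEvans.birmanSchwingerOp X A₁ A₀ B₀ lam) ∧
      HillEvans.HasDet2 (-HillEvans.birmanSchwingerOp X A₁ A₀ B₀ lam)
        (HillEvans.evansD X A₁ A₀ B₀ lam)) ∧
    ∀ (lam : ℂ) (𝔸 : ℝ → Matrix (Fin n ⊕ Fin n) (Fin n ⊕ Fin n) ℂ),
      HillEvans.IsFirstOrderForm X A₁ A₀ B₀ lam 𝔸 →
      -- `F` and `E` are well defined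
      HillEvans.IsFirstOrderOp X 𝔸 (HillEvans.firstOrderOp X 𝔸) ∧
      HillEvans.HasDet2 (HillEvans.firstOrderOp X 𝔸) (HillEvans.evansF X 𝔸) ∧
      HillEvans.IsFundamentalSolution X 𝔸 (HillEvans.fundamentalSolution X 𝔸) ∧
      -- the two expressions for `γ` agree
      HillEvans.gamma X A₁ = Complex.exp (Complex.exp X / (1 - Complex.exp X) *
        ∫ y in (0)..X, ((𝔸 y).trace - 2 * n)) ∧
      -- the relations
      HillEvans.evansD X A₁ A₀ B₀ lam =
        Complex.exp (HillEvans.delta X A₀ B₀ lam - HillEvans.deltaHat X A₁) /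
          HillEvans.epsilon n * HillEvans.evansF X 𝔸 ∧
      HillEvans.evansD X A₁ A₀ B₀ lam =
        Complex.exp (HillEvans.delta X A₀ B₀ lam - HillEvans.deltaHat X A₁) /
          HillEvans.epsilon n * HillEvans.gamma X A₁ *
          (Complex.exp X - 1) ^ (-(2 * (n : ℤ))) * HillEvans.evansE X 𝔸 := by
  have hpos : 0 < X := by rw [hX]; positivity
  have hexp : Complex.exp X - 1 ≠ 0 := fun h =>
    HillEvans.one_sub_cexp_ne_zero hpos.ne' (by rw [← neg_sub, h, neg_zero])
  refine ⟨HillEvans.hasSum_one_div_sq_add_I_mul.summable, HillEvans.summable_inv_sq_add_one,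
    ?_, HillEvans.epsilon_ne_zero n, fun lam => ?_, fun lam => ?_, fun lam 𝔸 h => ?_⟩
  · rw [HillEvans.epsilon_eq]
    exact HillEvans.tendsto_epsilonProd n
  · exact mul_ne_zero (mul_ne_zero (div_ne_zero (Complex.exp_ne_zero _)
      (HillEvans.epsilon_ne_zero n)) (Complex.exp_ne_zero _)) (zpow_ne_zero _ hexp)
  · exact ⟨HillEvans.birmanSchwingerOp_spec hpos hA₁ hA₀ hB₀,
      HillEvans.hasDet2_birmanSchwingerOp hX hA₁ hA₀ hB₀⟩
  have hM := h.hasL2Entries hA₁ hA₀ hB₀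
  have hDF := HillEvans.evansD_eq hX h hA₁ hA₀ hB₀
  have htr : ∀ y, (𝔸 y - 1).trace = (𝔸 y).trace - 2 * n := by
    intro y
    rw [Matrix.trace_sub, Matrix.trace_one, Fintype.card_sum, Fintype.card_fin]
    push_cast
    ring
  have hpow : (Complex.exp X - 1) ^ (-(2 * (n : ℤ))) =
      ((Complex.exp X - 1) ^ Fintype.card (Fin n ⊕ Fin n))⁻¹ := by
    rw [Fintype.card_sum, Fintype.card_fin, zpow_neg, ← two_mul, ← zpow_natCast]
    push_cast
    rfl
  refine ⟨HillEvans.firstOrderOp_spec hpos hM, HillEvans.hasDet2_firstOrderOp hX hM,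
    HillEvans.fundamentalSolution_spec hX hM, ?_, hDF, ?_⟩
  · simp only [← htr]
    exact HillEvans.gamma_eq hX h hA₁
  · rw [hDF, HillEvans.evansF_eq hX hM, ← HillEvans.gamma_eq hX h hA₁, hpow]
    ring
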